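/- Let $(z,z')$ be a random pair, $A(z)\in\mathbb R^{d\times d}$ a random matrix and $b(z')\in\mathbb R^d$ a random vector with finite expectations, $c\in\mathbb R$ a constant, and $\mathcal W\subseteq\mathbb R^d$ a nonempty bounded polyhedron. Put $$f(w,z,z')=w^\top A(z)w+w^\top b(z')+c,\qquad P(w)=w^\top\mathbb E[A(z)]w+w^\top\mathbb E[b(z')]+c,\qquad P_*=\min_{w\in\mathcal W}P(w),$$ and let $\mathcal W_*$ be the set of minimizers of $P$ over $\mathcal W$. The problem $\min_{w\in\mathcal W}P(w)$ satisfies EBC$(\theta,\alpha)$, where $\theta\in(0,1]$ and $0<\alpha<\infty$, if $\|w-w^*\|_2^2\le\alpha\,(P(w)-P(w^*))^\theta$ for every $w\in\mathcal W$, where $w^*$ is the point of $\mathcal W_*$ closest to $w$. Assume that $\mathbb E[A(z)]$ is (symmetric) positive semidefinite. Let $(z_1,z_1'),(z_2,z_2'),\dots$ be i.i.d. copies of $(z,z')$. An ERM solution is any minimizer $\widehat w$ of $\frac1n\sum_{i=1}^n f(w,z_i,z_i')$ over $w\in\mathcal W$. Then: (i) There is $\alpha\in(0,\infty)$ such that the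 problem satisfies EBC$(1,\alpha)$. In (ii), (iii), (iv) let $\alpha$ be any number such that EBC$(1,\alpha)$ holds; in (ii)-(iv) assume that $\max(\|A(z)\|_2,\|b(z')\|_2)\le\sigma<\infty$ almost surely, and let $R$ be such that $\|w\|_2\le R$ on $\mathcal W$. (ii) There is a constant $C$ depending only on $\alpha,\sigma,R$ such that for all $n\ge2$ and $\delta\in(0,1)$, with probability at least $1-\delta$, every ERM solution satisfies $$P(\widehat w)-P_*\le C\,\frac{d\log n+\log(1/\delta)}{n}.$$ (iii) Suppose in addition that almost surely $f(\cdot,z,z')$ is non-negative on $\mathbb R^d$ and is convex and $L$-smooth on $\mathcal W$, that is, $0\le f(w,z,z')-f(u,z,z')-\nabla f(u,z,z')^\top(w-u)\le\frac L2\|w-u\|_2^2$ for all $w,u\in\mathcal W$. Then there are constants $C,N>0$ depending only on $\alpha,\sigma,R,L$ such that for all $n\ge2$ with $n\ge N\,d\log n$ and all $\delta\in(0,1)$, with probability at least $1-\delta$, every ERM solution satisfies $$P(\widehat w)-P_*\le C\left[\left(\frac{d\log n+\log(1/\delta)}{n}\right)^2+\frac{(d\log n+\log(1/\delta))\,P_*}{n}\right].$$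 If $f(\cdot,z,z')$ is almost surely non-negative only on $\mathcal W$, the same holds with constants $C,N$ that may depend on the problem (but not on $n$ and $\delta$). (iv) Let $G>0$ be such that almost surely $f(\cdot,z,z')$ is $G$-Lipschitz on $\mathcal W$, let $w_1\in\mathcal W$, and let $R_0\ge\|w_1-w_1^*\|_2$, where $w_1^*$ is the point of $\mathcal W_*$ closest to $w_1$. For $n\ge100$ put $m=\lfloor\frac12\log_2\frac{2n}{\log_2n}\rfloor-1$, $n_0=\lfloor n/m\rfloor$, $\widehat w_0=w_1$ and $R_k=R_0/2^k$. ASA computes $\widehat w_1,\dots,\widehat w_m$ as follows: for $k=1,\dots,m$, $\widehat w_k$ is the average of the $n_0+1$ iterates $u_1=\widehat w_{k-1}$, $u_{t+1}=\Pi_k\big(u_t-\gamma_k\nabla f(u_t,\cdot)\big)$, $t=1,\dots,n_0$, where the gradient in $w$ is taken at a fresh sample in each step, $\gamma_k=\frac{R_{k-1}}{G\sqrt{n_0+1}}$, and $\Pi_k$ is the Euclidean projection onto $\mathcal W\cap\{w:\|w-\widehat w_{k-1}\|_2\le R_{k-1}\}$; in total at most $n$ samples are used, each once. There is an absolute constant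 $C$ such that for all $n\ge100$ and $\delta\in(0,1)$, with probability at least $1-\delta$, $$P(\widehat w_m)-P_*\le C\,\max(\alpha G^2,R_0G)\,\frac{\log n\,\log(\log(n)/\delta)}{n}.$$ -/

import Mathlib

open MeasureTheory ProbabilityTheory
open scoped Matrix Matrix.Norms.L2Operator RealInnerProductSpace

universe u v w

noncomputable section

/-! Optimization vocabulary -/

/-- A polyhedron of `ℝ^d`: the intersection of finitely many closed half-spaces. -/
def IsPolyhedron {d : ℕ} (W : Set (EuclideanSpace ℝ (Fin d))) : Prop :=
  ∃ (k : ℕ) (a : Fin k → EuclideanSpace ℝ (Fin d)) (β : Fin k → ℝ),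
    W = {x | ∀ i, ⟪a i, x⟫ ≤ β i}

/-- The set of minimizers of `F` over `W`. -/
def argminOn {E : Type*} (F : E → ℝ) (W : Set E) : Set E :=
  {x | x ∈ W ∧ ∀ y ∈ W, F x ≤ F y}

/-- `y` is a point of `K` closest to `x` in Euclidean norm. -/
def IsClosest {d : ℕ} (K : Set (EuclideanSpace ℝ (Fin d)))
    (x y : EuclideanSpace ℝ (Fin d)) : Prop :=
  y ∈ K ∧ ∀ v ∈ K, ‖x - y‖ ≤ ‖x - v‖

/-- The Euclidean projection onto `K`; it is the unique closest point of `K` as soon as `K` is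
nonempty, closed and convex. -/
def proj {d : ℕ} (K : Set (EuclideanSpace ℝ (Fin d)))
    (x : EuclideanSpace ℝ (Fin d)) : EuclideanSpace ℝ (Fin d) :=
  Classical.epsilon (IsClosest K x)

/-- The error bound condition `EBC(θ, α)` for the minimization of `F` over `W`: every `x ∈ W` has a
closest minimizer `xs`, and `‖x - xs‖² ≤ α (F x - F xs)^θ`. (Both sides are the same for all
closest minimizers of `x`.) -/
def EBC {d : ℕ} (W : Set (EuclideanSpace ℝ (Fin d))) (F : EuclideanSpace ℝ (Fin d) → ℝ)
    (θ α : ℝ) : Prop :=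
  0 < θ ∧ θ ≤ 1 ∧ 0 < α ∧
    ∀ x ∈ W, ∃ xs, IsClosest (argminOn F W) x xs ∧ ‖x - xs‖ ^ 2 ≤ α * (F x - F xs) ^ θ

/-! Stochastic quadratic problems -/

/-- The data of a stochastic quadratic problem in dimension `d`: the joint law `μ` of the random
pair `(z, z')`, the random matrix `A(z)`, the random vector `b(z')`, the constant `c` and the
feasible set `W`. -/
structure QuadProblem (d : ℕ) (Z : Type u) (Z' : Type v)
    [MeasurableSpace Z] [MeasurableSpace Z'] where
  μ : Measure (Z × Z')
  A : Z → Matrix (Fin d) (Fin d) ℝ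
  b : Z' → EuclideanSpace ℝ (Fin d)
  c : ℝ
  W : Set (EuclideanSpace ℝ (Fin d))

namespace QuadProblem

variable {d : ℕ} {Z : Type u} {Z' : Type v} [MeasurableSpace Z] [MeasurableSpace Z']

/-- The expected matrix `E[A(z)]`. -/
def meanA (Q : QuadProblem d Z Z') : Matrix (Fin d) (Fin d) ℝ :=
  Matrix.of fun i j => ∫ p, Q.A p.1 i j ∂Q.μ

/-- The expected vector `E[b(z')]`. -/
def meanb (Q : QuadProblem d Z Z') : EuclideanSpace ℝ (Fin d) :=
  ∫ p, Q.b p.2 ∂Q.μ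

/-- The random function `f(w, z, z') = wᵀ A(z) w + wᵀ b(z') + c`. -/
def loss (Q : QuadProblem d Z Z') (x : EuclideanSpace ℝ (Fin d)) (p : Z × Z') : ℝ :=
  x.ofLp ⬝ᵥ (Q.A p.1 *ᵥ x.ofLp) + ⟪x, Q.b p.2⟫ + Q.c

/-- The objective `P(w) = wᵀ E[A(z)] w + wᵀ E[b(z')] + c`. -/
def risk (Q : QuadProblem d Z Z') (x : EuclideanSpace ℝ (Fin d)) : ℝ :=
  x.ofLp ⬝ᵥ (Q.meanA *ᵥ x.ofLp) + ⟪x, Q.meanb⟫ + Q.c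

/-- The optimal risk `P_* = min_{w ∈ W} P(w)`. -/
def optRisk (Q : QuadProblem d Z Z') : ℝ :=
  sInf (Q.risk '' Q.W)

/-- The empirical risk of the first `n` terms of a sample sequence. -/
def empRisk (Q : QuadProblem d Z Z') (n : ℕ) (s : ℕ → Z × Z')
    (x : EuclideanSpace ℝ (Fin d)) : ℝ :=
  (1 / (n : ℝ)) * ∑ i ∈ Finset.range n, Q.loss x (s i)

/-- The standing assumptions: `A(z)` and `b(z')` are random variables with finite expectations,
`E[A(z)]` is (symmetric) positive semidefinite and `W` is a nonempty bounded polyhedron. -/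
structure Standing (Q : QuadProblem d Z Z') : Prop where
  isProbability : IsProbabilityMeasure Q.μ
  measurable_A : ∀ i j, Measurable fun z => Q.A z i j
  measurable_b : Measurable Q.b
  integrable_A : ∀ i j, Integrable (fun p => Q.A p.1 i j) Q.μ
  integrable_b : Integrable (fun p => Q.b p.2) Q.μ
  posSemidef : Q.meanA.PosSemidef
  polyhedron : IsPolyhedron Q.W
  bounded : Bornology.IsBounded Q.W
  nonempty : Q.W.Nonempty

/-- `max(‖A(z)‖₂, ‖b(z')‖₂) ≤ σ`, with the spectral norm of `A(z)`, for almost every pair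
`(z, z')`. -/
def BoundedBy (Q : QuadProblem d Z Z') (σ : ℝ) : Prop :=
  ∀ᵐ p ∂Q.μ, max ‖Q.A p.1‖ ‖Q.b p.2‖ ≤ σ

/-- `f(·, z, z')` is `G`-Lipschitz on `W`, with the same constant for almost all data. -/
def LossLipschitz (Q : QuadProblem d Z Z') (G : ℝ) : Prop :=
  ∀ᵐ p ∂Q.μ, ∀ x ∈ Q.W, ∀ y ∈ Q.W, |Q.loss x p - Q.loss y p| ≤ G * ‖x - y‖

/-- `f(·, z, z')` is convex and `L`-smooth on `W`, with the same constant for almost all data. -/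
def LossConvexSmooth (Q : QuadProblem d Z Z') (L : ℝ) : Prop :=
  ∀ᵐ p ∂Q.μ, ∀ x ∈ Q.W, ∀ y ∈ Q.W,
    0 ≤ Q.loss x p - Q.loss y p - ⟪gradient (fun t => Q.loss t p) y, x - y⟫ ∧
    Q.loss x p - Q.loss y p - ⟪gradient (fun t => Q.loss t p) y, x - y⟫ ≤ L / 2 * ‖x - y‖ ^ 2

/-! The stochastic approximation algorithm -/

/-- The iterates of the projected stochastic (sub)gradient method on the feasible set `K` with step
size `γ`, started at `x₁` and fed with the samples `s 0, s 1, …`. Index `t` is the `(t+1)`-st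
iterate. -/
def ssgIter (Q : QuadProblem d Z Z') (K : Set (EuclideanSpace ℝ (Fin d))) (γ : ℝ)
    (x₁ : EuclideanSpace ℝ (Fin d)) (s : ℕ → Z × Z') : ℕ → EuclideanSpace ℝ (Fin d)
  | 0 => x₁
  | t + 1 =>
      proj K (ssgIter Q K γ x₁ s t
        - γ • gradient (fun y => Q.loss y (s t)) (ssgIter Q K γ x₁ s t))

/-- `SSG(x₁, γ, T, K)`: run `T` steps and return the average of the `T + 1` iterates. -/
def ssg (Q : QuadProblem d Z Z') (x₁ : EuclideanSpace ℝ (Fin d)) (γ : ℝ) (T : ℕ)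
    (K : Set (EuclideanSpace ℝ (Fin d))) (s : ℕ → Z × Z') : EuclideanSpace ℝ (Fin d) :=
  (1 / ((T : ℝ) + 1)) • ∑ t ∈ Finset.range (T + 1), ssgIter Q K γ x₁ s t

/-- The stage outputs of ASA with `n₀` steps per stage. Stage `k + 1` starts at the output of stage
`k`, uses the radius `R₀ / 2^k`, the step size `R₀ / 2^k / (G √(n₀ + 1))`, the feasible set
`W ∩ B(output of stage k, R₀ / 2^k)` and the fresh samples number `k n₀, …, k n₀ + n₀ - 1`. -/
def asaStage (Q : QuadProblem d Z Z') (G R₀ : ℝ) (n₀ : ℕ) (x₁ : EuclideanSpace ℝ (Fin d))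
    (s : ℕ → Z × Z') : ℕ → EuclideanSpace ℝ (Fin d)
  | 0 => x₁
  | k + 1 =>
      ssg Q (asaStage Q G R₀ n₀ x₁ s k)
        (R₀ / 2 ^ k / (G * Real.sqrt ((n₀ : ℝ) + 1))) n₀
        (Q.W ∩ Metric.closedBall (asaStage Q G R₀ n₀ x₁ s k) (R₀ / 2 ^ k))
        (fun t => s (k * n₀ + t))

end QuadProblem

/-- The number of stages `m = ⌊(1/2) log₂ (2n / log₂ n)⌋ - 1` of ASA (it is positive for
`n ≥ 100`). -/
def asaNumStages (n : ℕ) : ℕ :=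
  ⌊(1 / 2 : ℝ) * Real.logb 2 (2 * (n : ℝ) / Real.logb 2 (n : ℝ))⌋₊ - 1

/-- `ASA(x₁, n, R₀)` with Lipschitz parameter `G`: `m` stages of `n₀ = ⌊n / m⌋` steps each, hence
one pass over (at most) the first `n` samples. -/
def QuadProblem.asa {d : ℕ} {Z : Type u} {Z' : Type v} [MeasurableSpace Z] [MeasurableSpace Z']
    (Q : QuadProblem d Z Z') (G : ℝ) (x₁ : EuclideanSpace ℝ (Fin d)) (n : ℕ) (R₀ : ℝ)
    (s : ℕ → Z × Z') : EuclideanSpace ℝ (Fin d) :=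
  Q.asaStage G R₀ (n / asaNumStages n) x₁ s (asaNumStages n)

/-! Samples and high probability -/

/-- `ξ 0, ξ 1, …` are independent random variables on `(Ω, Pr)` with common law `μ`. -/
structure IsIIDSample {Ω : Type w} {X : Type*} [MeasurableSpace Ω] [MeasurableSpace X]
    (Pr : Measure Ω) (μ : Measure X) (ξ : ℕ → Ω → X) : Prop where
  measurable : ∀ i, Measurable (ξ i)
  indep : iIndepFun ξ Pr
  law : ∀ i, Pr.map (ξ i) = μ

/-- "With probability at least `1 - δ`": the (outer) probability that `p` fails is at most `δ`. -/
def WithHighProb {Ω : Type w} [MeasurableSpace Ω] (Pr : Measure Ω) (δ : ℝ) (p : Ω → Prop) : Prop :=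
  Pr {ω | ¬ p ω} ≤ ENNReal.ofReal δ

/-- For every sample size `n` admitted by `adm` and every `δ ∈ (0,1)`, with probability at least
`1 - δ` every empirical risk minimizer computed from `n` i.i.d. samples has excess risk at most
`rate n δ`. Here `Ω` ranges over all probability spaces carrying an i.i.d. sequence. -/
def QuadProblem.ERMRate {d : ℕ} {Z : Type u} {Z' : Type v} [MeasurableSpace Z] [MeasurableSpace Z']
    (Q : QuadProblem d Z Z') (adm : ℕ → Prop) (rate : ℕ → ℝ → ℝ) : Prop :=
  ∀ (Ω : Type w) [MeasurableSpace Ω] (Pr : Measure Ω) [IsProbabilityMeasure Pr]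
    (ξ : ℕ → Ω → Z × Z'), IsIIDSample Pr Q.μ ξ →
    ∀ n : ℕ, adm n → ∀ δ : ℝ, 0 < δ → δ < 1 →
      WithHighProb Pr δ fun ω =>
        ∀ x ∈ argminOn (Q.empRisk n fun i => ξ i ω) Q.W, Q.risk x - Q.optRisk ≤ rate n δ

end

/-! Error bound. Let `x₀` minimize `P` over `W`, let `g` be the gradient of `P` there, `A` the mean
matrix and `h = x - x₀`. Then `P x - P x₀ = ⟪g, h⟫ + hᵀ A h` with both terms non-negative. The
points of `W` with `A y = A x₀` and `⟪g, y⟫ ≤ ⟪g, x₀⟫` are minimizers and form a polyhedron, so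
Hoffman's bound controls the distance to them by `∑ |(A h)_j| + ⟪g, h⟫`. Cauchy-Schwarz for the form
of `A`, and boundedness of `W` for the linear term, make this `O(√(P x - P x₀))`
(`exists_EBC_quad`).

ERM. Write `Δ` for the excess risk of a feasible `x` and `y` for its closest minimizer. The error
bound makes the second moment of the loss difference between `x` and `y` at most `G² α Δ`, so the
variance shrinks with the mean. A one-sided Bernstein inequality and a union bound over a net of
mesh `1/n²` show that net points with large `Δ` are empirically worse than their comparators by a
margin (`erm_excess_le`). With `η = (d log n + log (1/δ)) / n` this gives the rate `η`. If the
losses are non-negative on the whole space, their gradients are small where their values are small,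
so the second moment is of order `P_* ‖x - y‖² + ‖x - y‖⁴`, and the rate becomes `η² + η P_*`. If
they are non-negative on `W` only, the case `P_* > 0` follows from the rate `η`, and for `P_* = 0`
the loss at a minimizer vanishes almost surely.

ASA. One stage of radius `r` loses at most `b r` against any admissible comparator, where `b` is of
order `G √(ℓ / n₀)`: this is the regret bound of projected gradient steps plus the Azuma-Hoeffding
inequality for the gradient noise (`risk_ssg_sub_le`, `measure_sum_gt_le`). While the closest
minimizer lies within the radius, the error halves with the radius. Once it does not, the error
bound shows that the error is already `O(α b²)`, and later stages add only a geometric series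
(`stage_error_le`). Azuma needs the iterates to be measurable functions of past samples, which
follows from the continuity of projections onto moving sets. -/

/-! Hoffman's error bound -/

section Hoffman

variable {E : Type*} [NormedAddCommGroup E] [InnerProductSpace ℝ E]

/-- Hoffman's bound for the unit normal vectors of a homogeneous system. -/
theorem exists_pos_le_sum_max_inner [FiniteDimensional ℝ E] {ι : Type*} (a : ι → E)
    (I : Finset ι) :
    ∃ c : ℝ, 0 < c ∧ ∀ u : E, ‖u‖ = 1 → (∀ y, (∀ i ∈ I, ⟪a i, y⟫ ≤ 0) → ⟪u, y⟫ ≤ 0) →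
      c ≤ ∑ i ∈ I, max ⟪a i, u⟫ 0 := by
  set N : Set E := {u | ‖u‖ = 1 ∧ ∀ y, (∀ i ∈ I, ⟪a i, y⟫ ≤ 0) → ⟪u, y⟫ ≤ 0} with hN
  have hcl : IsClosed N := by
    have : N = {u | ‖u‖ = 1} ∩ ⋂ y, ⋂ (_ : ∀ i ∈ I, ⟪a i, y⟫ ≤ 0), {u | ⟪u, y⟫ ≤ 0} := by
      ext u; simp [hN]
    rw [this]
    refine (isClosed_eq continuous_norm continuous_const).inter ?_
    refine isClosed_iInter fun y => isClosed_iInter fun _ => ?_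
    exact isClosed_le (by fun_prop) continuous_const
  have hcomp : IsCompact N := by
    refine (isCompact_closedBall (0 : E) 1).of_isClosed_subset hcl ?_
    intro u hu
    simp [hu.1]
  rcases N.eq_empty_or_nonempty with hne | hne
  · refine ⟨1, one_pos, fun u h1 h2 => ?_⟩
    have : u ∈ N := ⟨h1, h2⟩
    simp [hne] at this
  · have hcont : Continuous fun u : E => ∑ i ∈ I, max ⟪a i, u⟫ 0 := by fun_prop
    obtain ⟨u₀, hu₀, hmin⟩ := hcomp.exists_isMinOn hne hcont.continuousOn
    refine ⟨∑ i ∈ I, max ⟪a i, u₀⟫ 0, ?_, fun u h1 h2 => hmin ⟨h1, h2⟩⟩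
    by_contra hcon
    -- If no constraint is violated, `u₀` lies in the cone to which it is polar; testing with `y =
    -- u₀` gives `‖u₀‖² ≤ 0`.
    have h0 : ∑ i ∈ I, max ⟪a i, u₀⟫ 0 = 0 :=
      le_antisymm (not_lt.1 hcon) (Finset.sum_nonneg fun i _ => le_max_right _ _)
    rw [Finset.sum_eq_zero_iff_of_nonneg fun i _ => le_max_right _ _] at h0
    have h3 := hu₀.2 u₀ fun i hi => by
      have := h0 i hi
      exact max_eq_right_iff.1 this
    rw [real_inner_self_eq_norm_sq, hu₀.1] at h3
    norm_num at h3

/-- **Hoffman's error bound**: the distance of a point to a polyhedron is at most a multiple,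
which does not depend on the right-hand sides, of the total violation of the constraints. -/
theorem exists_hoffman_const [FiniteDimensional ℝ E] {ι : Type*} [Fintype ι] (a : ι → E) :
    ∃ κ : ℝ, 0 < κ ∧ ∀ (β : ι → ℝ) (x p : E), (∀ i, ⟪a i, p⟫ ≤ β i) →
      (∀ y, (∀ i, ⟪a i, y⟫ ≤ β i) → ‖x - p‖ ≤ ‖x - y‖) →
      ‖x - p‖ ≤ κ * ∑ i, max (⟪a i, x⟫ - β i) 0 := by
  classical
  choose c hc hcI using exists_pos_le_sum_max_inner a
  -- There are finitely many candidate active sets, and `c` sees only the normals `a`; hence `κ` can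
  -- be fixed before `β`.
  obtain ⟨c₀, hc₀, hle⟩ : ∃ c₀ : ℝ, 0 < c₀ ∧ ∀ I : Finset ι, c₀ ≤ c I := by
    obtain ⟨I, hI⟩ := Finite.exists_min c
    exact ⟨c I, hc I, hI⟩
  refine ⟨c₀⁻¹, inv_pos.2 hc₀, fun β x p hp hmin => ?_⟩
  rcases eq_or_ne x p with rfl | hxp
  · rw [sub_self, norm_zero]
    exact mul_nonneg (inv_nonneg.2 hc₀.le) (Finset.sum_nonneg fun i _ => le_max_right _ _)
  set I : Finset ι := Finset.univ.filter fun i => ⟪a i, p⟫ = β i with hI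
  have hpos : 0 < ‖x - p‖ := norm_pos_iff.2 (sub_ne_zero.2 hxp)
  -- `x - p` is in the normal cone at `p`: a direction allowed by the active constraints stays
  -- feasible for small `t > 0`, and an acute angle with `x - p` would bring a point closer to `x`.
  have hnormal : ∀ y, (∀ i ∈ I, ⟪a i, y⟫ ≤ 0) → ⟪x - p, y⟫ ≤ 0 := by
    intro y hy
    have hev : ∀ᶠ t in nhdsWithin (0 : ℝ) (Set.Ioi 0), ∀ i, ⟪a i, p + t • y⟫ ≤ β i := by
      rw [Filter.eventually_all]
      intro i
      by_cases hi : ⟪a i, p⟫ = β i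
      · filter_upwards [self_mem_nhdsWithin] with t ht
        have := hy i (by simp [hI, hi])
        rw [inner_add_right, inner_smul_right, hi]
        nlinarith [Set.mem_Ioi.1 ht]
      · have hlt : ⟪a i, p⟫ < β i := lt_of_le_of_ne (hp i) hi
        have hcont : Filter.Tendsto (fun t : ℝ => ⟪a i, p + t • y⟫) (nhdsWithin 0 (Set.Ioi 0))
            (nhds ⟪a i, p + (0 : ℝ) • y⟫) :=
          Filter.Tendsto.mono_left (Continuous.tendsto (by fun_prop) 0) nhdsWithin_le_nhds
        rw [zero_smul, add_zero] at hcont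
        filter_upwards [hcont.eventually_lt_const hlt] with t ht using ht.le
    by_contra hcon
    push Not at hcon
    have hev2 : ∀ᶠ t in nhdsWithin (0 : ℝ) (Set.Ioi 0), t * ‖y‖ ^ 2 < 2 * ⟪x - p, y⟫ := by
      have hcont : Filter.Tendsto (fun t : ℝ => t * ‖y‖ ^ 2) (nhdsWithin 0 (Set.Ioi 0))
          (nhds (0 * ‖y‖ ^ 2)) :=
        Filter.Tendsto.mono_left (Continuous.tendsto (by fun_prop) 0) nhdsWithin_le_nhds
      exact hcont.eventually_lt_const (by linarith)
    obtain ⟨t, ht1, ht2, ht3⟩ := (hev.and (hev2.and self_mem_nhdsWithin)).exists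
    have ht0 : 0 < t := ht3
    have h := hmin _ ht1
    have h' : ‖x - p‖ ^ 2 ≤ ‖x - (p + t • y)‖ ^ 2 := by gcongr
    have e : x - (p + t • y) = (x - p) - t • y := by abel
    rw [e, norm_sub_sq_real (x - p), inner_smul_right, norm_smul, mul_pow,
      Real.norm_eq_abs, sq_abs] at h'
    nlinarith
  have hu := hcI I (‖x - p‖⁻¹ • (x - p))
    (by rw [norm_smul, norm_inv, norm_norm, inv_mul_cancel₀ hpos.ne'])
    (fun y hy => by
      rw [real_inner_smul_left]
      exact mul_nonpos_of_nonneg_of_nonpos (inv_nonneg.2 hpos.le) (hnormal y hy))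
  -- On active constraints `⟪a i, x - p⟫` is the violation `⟪a i, x⟫ - β i`; the others contribute
  -- non-negative terms.
  have h1 : ∑ i ∈ I, max ⟪a i, ‖x - p‖⁻¹ • (x - p)⟫ 0
      ≤ ‖x - p‖⁻¹ * ∑ i, max (⟪a i, x⟫ - β i) 0 := by
    rw [Finset.mul_sum]
    calc ∑ i ∈ I, max ⟪a i, ‖x - p‖⁻¹ • (x - p)⟫ 0
        = ∑ i ∈ I, ‖x - p‖⁻¹ * max (⟪a i, x⟫ - β i) 0 := by
          refine Finset.sum_congr rfl fun i hi => ?_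
          have hi' : ⟪a i, p⟫ = β i := by simpa [hI] using hi
          rw [inner_smul_right, inner_sub_right, hi', mul_max_of_nonneg _ _ (inv_nonneg.2 hpos.le),
            mul_zero]
      _ ≤ _ := Finset.sum_le_sum_of_subset_of_nonneg (Finset.subset_univ _) fun i _ _ =>
          mul_nonneg (inv_nonneg.2 hpos.le) (le_max_right _ _)
  have h2 : c₀ ≤ ‖x - p‖⁻¹ * ∑ i, max (⟪a i, x⟫ - β i) 0 := (hle I).trans (hu.trans h1)
  rw [inv_mul_eq_div, le_div_iff₀ hpos] at h2
  rw [inv_mul_eq_div, le_div_iff₀ hc₀]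
  linarith

end Hoffman

/-! Closest points -/

section Closest

variable {d : ℕ} {K : Set (EuclideanSpace ℝ (Fin d))}

theorem IsPolyhedron.isClosed (h : IsPolyhedron K) : IsClosed K := by
  obtain ⟨k, a, β, rfl⟩ := h
  rw [Set.ofPred_forall]
  exact isClosed_iInter fun i => isClosed_le (by fun_prop) continuous_const

theorem IsPolyhedron.convex (h : IsPolyhedron K) : Convex ℝ K := by
  obtain ⟨k, a, β, rfl⟩ := h
  rw [Set.ofPred_forall]
  refine convex_iInter fun i => ?_
  exact convex_halfSpace_le (f := fun x => ⟪a i, x⟫)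
    ⟨fun x y => inner_add_right _ _ _, fun c x => by simp [inner_smul_right]⟩ _

theorem exists_isClosest (hc : IsClosed K) (hne : K.Nonempty) (x : EuclideanSpace ℝ (Fin d)) :
    ∃ y, IsClosest K x y := by
  obtain ⟨y, hy, h⟩ := hc.exists_infDist_eq_dist hne x
  refine ⟨y, hy, fun v hv => ?_⟩
  rw [← dist_eq_norm, ← dist_eq_norm, ← h]
  exact Metric.infDist_le_dist_of_mem hv

theorem proj_isClosest (hc : IsClosed K) (hne : K.Nonempty) (x : EuclideanSpace ℝ (Fin d)) :
    IsClosest K x (proj K x) :=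
  Classical.epsilon_spec (exists_isClosest hc hne x)

theorem IsClosest.inner_le_zero (hK : Convex ℝ K) {x y : EuclideanSpace ℝ (Fin d)}
    (h : IsClosest K x y) {v : EuclideanSpace ℝ (Fin d)} (hv : v ∈ K) : ⟪x - y, v - y⟫ ≤ 0 := by
  have : Nonempty K := ⟨⟨y, h.1⟩⟩
  refine (norm_eq_iInf_iff_real_inner_le_zero hK h.1).1 ?_ v hv
  refine le_antisymm (le_ciInf fun w => h.2 w w.2) ?_
  exact ciInf_le ⟨0, by rintro _ ⟨w, rfl⟩; exact norm_nonneg _⟩ (⟨y, h.1⟩ : K)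

end Closest

/-! Quadratic functions -/

section Quad

variable {d : ℕ}

/-- The quadratic function `xᵀ A x + xᵀ b + c`. -/
noncomputable def quad (A : Matrix (Fin d) (Fin d) ℝ) (b : EuclideanSpace ℝ (Fin d)) (c : ℝ)
    (x : EuclideanSpace ℝ (Fin d)) : ℝ :=
  x.ofLp ⬝ᵥ (A *ᵥ x.ofLp) + ⟪x, b⟫ + c

/-- The gradient of `quad A b c`. -/
noncomputable def quadGrad (A : Matrix (Fin d) (Fin d) ℝ) (b x : EuclideanSpace ℝ (Fin d)) :
    EuclideanSpace ℝ (Fin d) :=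
  Matrix.toEuclideanCLM (n := Fin d) (𝕜 := ℝ) (A + Aᵀ) x + b

variable (A : Matrix (Fin d) (Fin d) ℝ) (b : EuclideanSpace ℝ (Fin d)) (c : ℝ)
  (x y h : EuclideanSpace ℝ (Fin d))

theorem inner_quadGrad : ⟪quadGrad A b x, h⟫ =
    h.ofLp ⬝ᵥ (A *ᵥ x.ofLp) + x.ofLp ⬝ᵥ (A *ᵥ h.ofLp) + ⟪h, b⟫ := by
  rw [quadGrad, real_inner_comm, inner_add_right, Matrix.inner_toEuclideanCLM, Matrix.add_mulVec,
    dotProduct_add, Matrix.mulVec_transpose, dotProduct_comm h.ofLp (_ ᵥ* _),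
    ← Matrix.dotProduct_mulVec]

theorem quad_add : quad A b c (x + h) =
    quad A b c x + ⟪quadGrad A b x, h⟫ + h.ofLp ⬝ᵥ (A *ᵥ h.ofLp) := by
  rw [inner_quadGrad, quad, quad]
  simp only [WithLp.ofLp_add, Matrix.mulVec_add, dotProduct_add, add_dotProduct, inner_add_left]
  ring

theorem quad_sub : quad A b c x - quad A b c y =
    ⟪quadGrad A b y, x - y⟫ + (x - y).ofLp ⬝ᵥ (A *ᵥ (x - y).ofLp) := by
  have := quad_add A b c y (x - y)
  rw [add_sub_cancel] at this
  linarith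

theorem dotProduct_mulVec_smul (t : ℝ) :
    (t • h).ofLp ⬝ᵥ (A *ᵥ (t • h).ofLp) = t ^ 2 * (h.ofLp ⬝ᵥ (A *ᵥ h.ofLp)) := by
  simp only [WithLp.ofLp_smul, Matrix.mulVec_smul, dotProduct_smul, smul_dotProduct, smul_eq_mul]
  ring

theorem abs_dotProduct_mulVec_le : |x.ofLp ⬝ᵥ (A *ᵥ y.ofLp)| ≤ ‖A‖ * ‖x‖ * ‖y‖ := by
  rw [← Matrix.inner_toEuclideanCLM]
  refine (abs_real_inner_le_norm _ _).trans ?_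
  have := (Matrix.toEuclideanCLM (n := Fin d) (𝕜 := ℝ) A).le_opNorm y
  rw [Matrix.l2_opNorm_toEuclideanCLM] at this
  nlinarith [norm_nonneg x]

theorem continuous_quad : Continuous (quad A b c) := by
  have : quad A b c = fun x =>
      ⟪x, Matrix.toEuclideanCLM (n := Fin d) (𝕜 := ℝ) A x⟫ + ⟪x, b⟫ + c := by
    funext x
    rw [Matrix.inner_toEuclideanCLM, quad]
  rw [this]
  fun_prop

theorem hasGradientAt_quad : HasGradientAt (quad A b c) (quadGrad A b x) x := by
  rw [hasGradientAt_iff_isLittleO_nhds_zero]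
  have e : (fun h => quad A b c (x + h) - quad A b c x - ⟪quadGrad A b x, h⟫)
      = fun h => h.ofLp ⬝ᵥ (A *ᵥ h.ofLp) := by
    funext h
    rw [quad_add]
    ring
  rw [e]
  refine Asymptotics.IsBigO.trans_isLittleO (g := fun h => ‖h‖ ^ 2) ?_
    (Asymptotics.isLittleO_norm_pow_id one_lt_two)
  refine Asymptotics.IsBigO.of_bound ‖A‖ (Filter.Eventually.of_forall fun h => ?_)
  rw [Real.norm_eq_abs, Real.norm_eq_abs, abs_of_nonneg (by positivity : (0 : ℝ) ≤ ‖h‖ ^ 2)]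
  have := abs_dotProduct_mulVec_le A h h
  linarith [sq ‖h‖]

variable {A b c}

theorem inner_quadGrad_le_of_posSemidef (hA : A.PosSemidef) :
    ⟪quadGrad A b y, x - y⟫ ≤ quad A b c x - quad A b c y := by
  rw [quad_sub]
  have := hA.dotProduct_mulVec_nonneg (x - y).ofLp
  simp only [star_trivial] at this
  linarith

/-- First-order optimality for the minimization of a quadratic function over a convex set. -/
theorem inner_quadGrad_nonneg_of_argminOn {W : Set (EuclideanSpace ℝ (Fin d))} (hW : Convex ℝ W)
    {x y : EuclideanSpace ℝ (Fin d)} (hy : y ∈ argminOn (quad A b c) W) (hx : x ∈ W) :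
    0 ≤ ⟪quadGrad A b y, x - y⟫ := by
  by_contra hcon
  push Not at hcon
  have hcont : Filter.Tendsto
      (fun t : ℝ => ⟪quadGrad A b y, x - y⟫ + t * ((x - y).ofLp ⬝ᵥ (A *ᵥ (x - y).ofLp)))
      (nhdsWithin 0 (Set.Ioi 0))
      (nhds (⟪quadGrad A b y, x - y⟫ + 0 * ((x - y).ofLp ⬝ᵥ (A *ᵥ (x - y).ofLp)))) :=
    Filter.Tendsto.mono_left (Continuous.tendsto (by fun_prop) 0) nhdsWithin_le_nhds
  rw [zero_mul, add_zero] at hcont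
  have hev : ∀ᶠ t in nhdsWithin (0 : ℝ) (Set.Ioi 0), t < 1 :=
    nhdsWithin_le_nhds (eventually_lt_nhds one_pos)
  obtain ⟨t, h1, h2, h3⟩ :=
    ((hcont.eventually_lt_const hcon).and (hev.and self_mem_nhdsWithin)).exists
  have ht : 0 < t := h3
  have hmem : y + t • (x - y) ∈ W := hW.add_smul_sub_mem hy.1 hx ⟨ht.le, h2.le⟩
  have := hy.2 _ hmem
  rw [quad_add, inner_smul_right, dotProduct_mulVec_smul] at this
  nlinarith

/-- A quadratic function which is `G`-Lipschitz on a convex set has directional derivatives at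
most `G` within this set. -/
theorem abs_inner_quadGrad_le_of_lipschitz {W : Set (EuclideanSpace ℝ (Fin d))} (hW : Convex ℝ W)
    {G : ℝ} (hG : ∀ x ∈ W, ∀ y ∈ W, |quad A b c x - quad A b c y| ≤ G * ‖x - y‖)
    {x y : EuclideanSpace ℝ (Fin d)} (hy : y ∈ W) (hx : x ∈ W) :
    |⟪quadGrad A b y, x - y⟫| ≤ G * ‖x - y‖ := by
  have hcont : Filter.Tendsto
      (fun t : ℝ => |⟪quadGrad A b y, x - y⟫ + t * ((x - y).ofLp ⬝ᵥ (A *ᵥ (x - y).ofLp))|)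
      (nhdsWithin 0 (Set.Ioi 0))
      (nhds |⟪quadGrad A b y, x - y⟫ + 0 * ((x - y).ofLp ⬝ᵥ (A *ᵥ (x - y).ofLp))|) :=
    Filter.Tendsto.mono_left (Continuous.tendsto (by fun_prop) 0) nhdsWithin_le_nhds
  rw [zero_mul, add_zero] at hcont
  refine le_of_tendsto hcont ?_
  have hev : ∀ᶠ t in nhdsWithin (0 : ℝ) (Set.Ioi 0), t < 1 :=
    nhdsWithin_le_nhds (eventually_lt_nhds one_pos)
  filter_upwards [hev, self_mem_nhdsWithin] with t h2 h3
  have ht : 0 < t := h3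
  have hmem : y + t • (x - y) ∈ W := hW.add_smul_sub_mem hy hx ⟨ht.le, h2.le⟩
  have := hG _ hmem y hy
  rw [quad_add, inner_smul_right, dotProduct_mulVec_smul, add_sub_cancel_left, norm_smul,
    Real.norm_eq_abs, abs_of_pos ht] at this
  have e : quad A b c y + t * ⟪quadGrad A b y, x - y⟫
      + t ^ 2 * ((x - y).ofLp ⬝ᵥ (A *ᵥ (x - y).ofLp))
      - quad A b c y
      = t * (⟪quadGrad A b y, x - y⟫ + t * ((x - y).ofLp ⬝ᵥ (A *ᵥ (x - y).ofLp))) := by ring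
  rw [e, abs_mul, abs_of_pos ht] at this
  have h4 : t * |⟪quadGrad A b y, x - y⟫ + t * ((x - y).ofLp ⬝ᵥ (A *ᵥ (x - y).ofLp))|
      ≤ t * (G * ‖x - y‖) := by linarith
  exact le_of_mul_le_mul_left h4 ht

/-- The coordinates of `H h` are controlled by the quadratic form of a positive semidefinite
matrix `H`. -/
theorem Matrix.PosSemidef.sq_mulVec_le {H : Matrix (Fin d) (Fin d) ℝ} (hH : H.PosSemidef)
    (h : Fin d → ℝ) (j : Fin d) : (H *ᵥ h) j ^ 2 ≤ H j j * (h ⬝ᵥ (H *ᵥ h)) := by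
  -- Non-negativity of the form at `h + t eⱼ` for all `t`; the discriminant condition is the
  -- Cauchy-Schwarz inequality.
  have key : ∀ t : ℝ, 0 ≤ H j j * (t * t) + 2 * (H *ᵥ h) j * t + h ⬝ᵥ (H *ᵥ h) := by
    intro t
    have h1 := hH.dotProduct_mulVec_nonneg (h + Pi.single j t)
    have hs : Hᵀ = H := by
      have := hH.isHermitian.eq
      rwa [Matrix.conjTranspose_eq_transpose_of_trivial] at this
    have h2 : h ⬝ᵥ (H *ᵥ Pi.single j t) = (H *ᵥ h) j * t := by
      rw [Matrix.dotProduct_mulVec, dotProduct_single, ← Matrix.mulVec_transpose, hs]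
    have h3 : Pi.single j t ⬝ᵥ (H *ᵥ Pi.single j t) = H j j * (t * t) := by
      rw [single_dotProduct, Matrix.mulVec_single]
      simp
      ring
    simp only [star_trivial, Matrix.mulVec_add, dotProduct_add, add_dotProduct, h2, h3,
      single_dotProduct] at h1
    linarith
  have := discrim_le_zero key
  rw [discrim] at this
  nlinarith

end Quad

/-! The error bound condition for convex quadratic functions on bounded polyhedra -/

section ErrorBound

variable {d : ℕ}

theorem argminOn_nonempty {F : EuclideanSpace ℝ (Fin d) → ℝ} {W : Set (EuclideanSpace ℝ (Fin d))}
    (hF : Continuous F) (hW : IsCompact W) (hne : W.Nonempty) : (argminOn F W).Nonempty := by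
  obtain ⟨x, hx, hmin⟩ := hW.exists_isMinOn hne hF.continuousOn
  exact ⟨x, hx, fun y hy => hmin hy⟩

theorem isClosed_argminOn {F : EuclideanSpace ℝ (Fin d) → ℝ} {W : Set (EuclideanSpace ℝ (Fin d))}
    (hF : Continuous F) (hW : IsClosed W) : IsClosed (argminOn F W) := by
  have : argminOn F W = W ∩ ⋂ y ∈ W, {x | F x ≤ F y} := by
    ext x; simp [argminOn]
  rw [this]
  exact hW.inter (isClosed_biInter fun y _ => isClosed_le hF continuous_const)

theorem convex_argminOn_quad {A : Matrix (Fin d) (Fin d) ℝ} {b : EuclideanSpace ℝ (Fin d)} {c : ℝ}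
    (hA : A.PosSemidef) {W : Set (EuclideanSpace ℝ (Fin d))} (hW : Convex ℝ W) :
    Convex ℝ (argminOn (quad A b c) W) := by
  intro x hx y hy s t hs ht hst
  refine ⟨hW hx.1 hy.1 hs ht hst, fun v hv => ?_⟩
  have h1 := inner_quadGrad_le_of_posSemidef (b := b) (c := c) x (s • x + t • y) hA
  have h2 := inner_quadGrad_le_of_posSemidef (b := b) (c := c) y (s • x + t • y) hA
  have h3 : s * ⟪quadGrad A b (s • x + t • y), x - (s • x + t • y)⟫
      + t * ⟪quadGrad A b (s • x + t • y), y - (s • x + t • y)⟫ = 0 := by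
    rw [← inner_smul_right, ← inner_smul_right, ← inner_add_right]
    have : s • (x - (s • x + t • y)) + t • (y - (s • x + t • y))
        = (s • x + t • y) - (s + t) • (s • x + t • y) := by module
    rw [this, hst, one_smul, sub_self, inner_zero_right]
  have h4 : s * quad A b c x ≤ s * quad A b c v := by gcongr; exact hx.2 v hv
  have h5 : t * quad A b c y ≤ t * quad A b c v := by gcongr; exact hy.2 v hv
  have h6 := mul_le_mul_of_nonneg_left h1 hs
  have h7 := mul_le_mul_of_nonneg_left h2 ht
  have h8 : quad A b c v = s * quad A b c v + t * quad A b c v := by rw [← add_mul, hst, one_mul]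
  have h9 : quad A b c (s • x + t • y) = s * quad A b c (s • x + t • y)
    + t * quad A b c (s • x + t • y) := by rw [← add_mul, hst, one_mul]
  linarith

/-- A convex quadratic function on a bounded polyhedron satisfies the error bound condition with
exponent `1`. -/
theorem exists_EBC_quad {A : Matrix (Fin d) (Fin d) ℝ} {b : EuclideanSpace ℝ (Fin d)} {c : ℝ}
    (hA : A.PosSemidef) {W : Set (EuclideanSpace ℝ (Fin d))} (hW : IsPolyhedron W)
    (hb : Bornology.IsBounded W) (hne : W.Nonempty) : ∃ α, EBC W (quad A b c) 1 α := by
  have hcomp : IsCompact W := Metric.isCompact_of_isClosed_isBounded hW.isClosed hb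
  have hcont := continuous_quad A b c
  obtain ⟨x₀, hx₀⟩ := argminOn_nonempty hcont hcomp hne
  obtain ⟨xM, hxM, hmax⟩ := hcomp.exists_isMaxOn hne hcont.continuousOn
  have hconv := hW.convex
  obtain ⟨k, a, β, hWeq⟩ := hW
  set g := quadGrad A b x₀ with hg
  set row : Fin d → EuclideanSpace ℝ (Fin d) := fun j => WithLp.toLp 2 (A j) with hrow
  have hrow_inner : ∀ j x, ⟪row j, x⟫ = (A *ᵥ x.ofLp) j := by
    intro j x
    rw [real_inner_comm, EuclideanSpace.inner_eq_star_dotProduct]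
    simp [hrow, Matrix.mulVec, dotProduct_comm]
  -- The system consists of the constraints of `W`, the equations `A y = A x₀` as two inequalities
  -- per row, and `⟪g, y⟫ ≤ ⟪g, x₀⟫`.
  obtain ⟨κ, hκ, hH⟩ := exists_hoffman_const
    (Sum.elim a (Sum.elim row (Sum.elim (fun j => -row j) (fun _ : Unit => g))))
  set rhs : Fin k ⊕ Fin d ⊕ Fin d ⊕ Unit → ℝ :=
    Sum.elim β (Sum.elim (fun j => ⟪row j, x₀⟫) (Sum.elim (fun j => -⟪row j, x₀⟫)
      (fun _ => ⟪g, x₀⟫))) with hrhs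
  specialize hH rhs
  set S : Set (EuclideanSpace ℝ (Fin d)) := {y | ∀ i, ⟪(Sum.elim a (Sum.elim row
    (Sum.elim (fun j => -row j) (fun _ : Unit => g))) : Fin k ⊕ Fin d ⊕ Fin d ⊕ Unit → _) i, y⟫
      ≤ rhs i} with hS
  have hSclosed : IsClosed S := by
    rw [hS, Set.ofPred_forall]
    exact isClosed_iInter fun i => isClosed_le (by fun_prop) continuous_const
  have hx₀S : x₀ ∈ S := by
    rintro (i | j | j | _)
    · have := hx₀.1
      rw [hWeq] at this
      exact this i
    · simp [hrhs]
    · simp [hrhs]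
    · simp [hrhs]
  -- Only this inclusion is needed: the distance to `S` bounds the distance to the minimizers from
  -- above.
  have hSarg : S ⊆ argminOn (quad A b c) W := by
    intro y hy
    have hyW : y ∈ W := by
      rw [hWeq]
      exact fun i => by simpa [hrhs] using hy (Sum.inl i)
    refine ⟨hyW, fun v hv => le_trans ?_ (hx₀.2 v hv)⟩
    have h1 : A *ᵥ (y - x₀).ofLp = 0 := by
      funext j
      have ha : ⟪row j, y⟫ ≤ ⟪row j, x₀⟫ := by simpa [hrhs] using hy (Sum.inr (Sum.inl j))
      have hb : ⟪row j, x₀⟫ ≤ ⟪row j, y⟫ := by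
        simpa [hrhs] using hy (Sum.inr (Sum.inr (Sum.inl j)))
      rw [← hrow_inner, inner_sub_right, le_antisymm ha hb, sub_self]
      rfl
    have h2 : ⟪g, y⟫ ≤ ⟪g, x₀⟫ := by simpa [hrhs] using hy (Sum.inr (Sum.inr (Sum.inr ())))
    have h3 := quad_sub A b c y x₀
    rw [h1, dotProduct_zero, ← hg, inner_sub_right] at h3
    linarith
  -- The largest excess risk on `W`. It bounds the linear term through `Δ = √Δ √Δ ≤ √D √Δ`.
  set D : ℝ := quad A b c xM - quad A b c x₀ with hD
  set B : ℝ := ∑ j, Real.sqrt (A j j) + Real.sqrt D with hB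
  have hB0 : 0 ≤ B := add_nonneg (Finset.sum_nonneg fun _ _ => Real.sqrt_nonneg _)
    (Real.sqrt_nonneg _)
  -- The summand `1` only ensures `α > 0`.
  refine ⟨(κ * B) ^ 2 + 1, one_pos, le_rfl, by positivity, fun x hx => ?_⟩
  obtain ⟨xs, hxs⟩ := exists_isClosest (isClosed_argminOn hcont hcomp.isClosed) ⟨x₀, hx₀⟩ x
  obtain ⟨p, hp⟩ := exists_isClosest hSclosed ⟨x₀, hx₀S⟩ x
  refine ⟨xs, hxs, ?_⟩
  have hval : quad A b c xs = quad A b c x₀ :=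
    le_antisymm (hxs.1.2 _ hx₀.1) (hx₀.2 _ hxs.1.1)
  rw [Real.rpow_one, hval]
  set Δ := quad A b c x - quad A b c x₀ with hΔ
  have hΔ0 : 0 ≤ Δ := sub_nonneg.2 (hx₀.2 x hx)
  have hΔD : Δ ≤ D := sub_le_sub_right (hmax hx) _
  have hquad := quad_sub A b c x x₀
  rw [← hg, ← hΔ] at hquad
  have hg0 : 0 ≤ ⟪g, x - x₀⟫ := inner_quadGrad_nonneg_of_argminOn hconv hx₀ hx
  have hA0 : 0 ≤ (x - x₀).ofLp ⬝ᵥ (A *ᵥ (x - x₀).ofLp) := by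
    simpa using hA.dotProduct_mulVec_nonneg (x - x₀).ofLp
  have hdist : ‖x - xs‖ ≤ κ * (B * Real.sqrt Δ) := by
    refine (hxs.2 p (hSarg hp.1)).trans ((hH x p hp.1 hp.2).trans ?_)
    gcongr
    have hsplit : ∑ i, max (⟪(Sum.elim a (Sum.elim row
        (Sum.elim (fun j => -row j) (fun _ : Unit => g))) : Fin k ⊕ Fin d ⊕ Fin d ⊕ Unit → _) i, x⟫
        - rhs i) 0 = ∑ j, |(A *ᵥ (x - x₀).ofLp) j| + ⟪g, x - x₀⟫ := by
      simp only [Fintype.sum_sum_type, hrhs, Sum.elim_inl, Sum.elim_inr, Finset.univ_unique,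
        Finset.sum_singleton, inner_neg_left, ← inner_sub_right]
      have h0 : ∑ i, max (⟪a i, x⟫ - β i) 0 = 0 := by
        refine Finset.sum_eq_zero fun i _ => max_eq_right ?_
        rw [hWeq] at hx
        exact sub_nonpos.2 (hx i)
      rw [h0, zero_add, max_eq_left hg0, ← add_assoc, ← Finset.sum_add_distrib]
      congr 1
      refine Finset.sum_congr rfl fun j _ => ?_
      rw [← hrow_inner, inner_sub_right]
      rcases le_total 0 (⟪row j, x⟫ - ⟪row j, x₀⟫) with h | h
      · rw [max_eq_left h, abs_of_nonneg h, max_eq_right (by linarith), add_zero]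
      · rw [max_eq_right h, abs_of_nonpos h, max_eq_left (by linarith), zero_add]
        ring
    rw [hsplit, hB, add_mul, Finset.sum_mul]
    refine add_le_add (Finset.sum_le_sum fun j _ => ?_) ?_
    · rw [← Real.sqrt_mul hA.diag_nonneg]
      refine Real.abs_le_sqrt ((hA.sq_mulVec_le _ j).trans ?_)
      exact mul_le_mul_of_nonneg_left (by linarith) hA.diag_nonneg
    · calc ⟪g, x - x₀⟫ ≤ Δ := by linarith
        _ = Real.sqrt Δ * Real.sqrt Δ := (Real.mul_self_sqrt hΔ0).symm
        _ ≤ _ := by gcongr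
  calc ‖x - xs‖ ^ 2 ≤ (κ * (B * Real.sqrt Δ)) ^ 2 := by gcongr
    _ = (κ * B) ^ 2 * Δ := by rw [← mul_assoc, mul_pow, Real.sq_sqrt hΔ0]
    _ ≤ _ := by nlinarith

end ErrorBound

/-! Basic properties of stochastic quadratic problems -/

namespace QuadProblem

variable {d : ℕ} {Z : Type u} {Z' : Type v} [MeasurableSpace Z] [MeasurableSpace Z']
  {Q : QuadProblem d Z Z'}

theorem loss_eq_quad (x : EuclideanSpace ℝ (Fin d)) (p : Z × Z') :
    Q.loss x p = quad (Q.A p.1) (Q.b p.2) Q.c x := rfl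

theorem risk_eq_quad : Q.risk = quad Q.meanA Q.meanb Q.c := rfl

theorem gradient_loss (x : EuclideanSpace ℝ (Fin d)) (p : Z × Z') :
    gradient (fun y => Q.loss y p) x = quadGrad (Q.A p.1) (Q.b p.2) x :=
  (hasGradientAt_quad _ _ _ _).gradient

namespace Standing

theorem convex_W (hQ : Q.Standing) : Convex ℝ Q.W := hQ.polyhedron.convex

theorem isClosed_W (hQ : Q.Standing) : IsClosed Q.W := hQ.polyhedron.isClosed

theorem isCompact_W (hQ : Q.Standing) : IsCompact Q.W :=
  Metric.isCompact_of_isClosed_isBounded hQ.isClosed_W hQ.bounded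

theorem argmin_nonempty (hQ : Q.Standing) : (argminOn Q.risk Q.W).Nonempty :=
  argminOn_nonempty (continuous_quad _ _ _) hQ.isCompact_W hQ.nonempty

theorem exists_EBC (hQ : Q.Standing) : ∃ α : ℝ, EBC Q.W Q.risk 1 α :=
  exists_EBC_quad hQ.posSemidef hQ.polyhedron hQ.bounded hQ.nonempty

theorem optRisk_eq {x : EuclideanSpace ℝ (Fin d)} (hx : x ∈ argminOn Q.risk Q.W) :
    Q.optRisk = Q.risk x := by
  refine IsLeast.csInf_eq ⟨⟨x, hx.1, rfl⟩, ?_⟩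
  rintro _ ⟨y, hy, rfl⟩
  exact hx.2 y hy

theorem integrable_dotProduct (hQ : Q.Standing) (x y : Fin d → ℝ) :
    Integrable (fun p => x ⬝ᵥ (Q.A p.1 *ᵥ y)) Q.μ := by
  simp only [dotProduct, Matrix.mulVec]
  refine integrable_finsetSum _ fun i _ => Integrable.const_mul ?_ _
  exact integrable_finsetSum _ fun j _ => (hQ.integrable_A i j).mul_const _

theorem integral_dotProduct (hQ : Q.Standing) (x y : Fin d → ℝ) :
    ∫ p, x ⬝ᵥ (Q.A p.1 *ᵥ y) ∂Q.μ = x ⬝ᵥ (Q.meanA *ᵥ y) := by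
  simp only [dotProduct, Matrix.mulVec, meanA, Matrix.of_apply]
  rw [integral_finsetSum _ fun i _ => Integrable.const_mul
    (integrable_finsetSum _ fun j _ => (hQ.integrable_A i j).mul_const _) _]
  refine Finset.sum_congr rfl fun i _ => ?_
  rw [integral_const_mul, integral_finsetSum _ fun j _ => (hQ.integrable_A i j).mul_const _]
  simp_rw [integral_mul_const]

theorem integrable_inner_b (hQ : Q.Standing) (x : EuclideanSpace ℝ (Fin d)) :
    Integrable (fun p => ⟪x, Q.b p.2⟫) Q.μ := hQ.integrable_b.const_inner x

theorem integral_inner_b (hQ : Q.Standing) (x : EuclideanSpace ℝ (Fin d)) :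
    ∫ p, ⟪x, Q.b p.2⟫ ∂Q.μ = ⟪x, Q.meanb⟫ := integral_inner hQ.integrable_b x

theorem integrable_loss (hQ : Q.Standing) (x : EuclideanSpace ℝ (Fin d)) :
    Integrable (Q.loss x) Q.μ := by
  have := hQ.isProbability
  exact ((hQ.integrable_dotProduct _ _).add (hQ.integrable_inner_b x)).add (integrable_const _)

theorem integral_loss (hQ : Q.Standing) (x : EuclideanSpace ℝ (Fin d)) :
    ∫ p, Q.loss x p ∂Q.μ = Q.risk x := by
  have := hQ.isProbability
  simp only [loss, risk]
  have h12 : Integrable (fun p => x.ofLp ⬝ᵥ (Q.A p.1 *ᵥ x.ofLp) + ⟪x, Q.b p.2⟫) Q.μ :=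
    (hQ.integrable_dotProduct _ _).add (hQ.integrable_inner_b x)
  rw [integral_add h12 (integrable_const _),
    integral_add (hQ.integrable_dotProduct _ _) (hQ.integrable_inner_b x),
    hQ.integral_dotProduct, hQ.integral_inner_b]
  simp

theorem integrable_inner_grad (hQ : Q.Standing) (x h : EuclideanSpace ℝ (Fin d)) :
    Integrable (fun p => ⟪quadGrad (Q.A p.1) (Q.b p.2) x, h⟫) Q.μ := by
  simp only [inner_quadGrad]
  exact ((hQ.integrable_dotProduct _ _).add (hQ.integrable_dotProduct _ _)).add
    (hQ.integrable_inner_b h)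

theorem integral_inner_grad (hQ : Q.Standing) (x h : EuclideanSpace ℝ (Fin d)) :
    ∫ p, ⟪quadGrad (Q.A p.1) (Q.b p.2) x, h⟫ ∂Q.μ = ⟪quadGrad Q.meanA Q.meanb x, h⟫ := by
  simp only [inner_quadGrad]
  have h12 : Integrable (fun p => h.ofLp ⬝ᵥ (Q.A p.1 *ᵥ x.ofLp)
      + x.ofLp ⬝ᵥ (Q.A p.1 *ᵥ h.ofLp)) Q.μ :=
    (hQ.integrable_dotProduct _ _).add (hQ.integrable_dotProduct _ _)
  rw [integral_add h12 (hQ.integrable_inner_b h), integral_add (hQ.integrable_dotProduct _ _)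
    (hQ.integrable_dotProduct _ _), hQ.integral_dotProduct, hQ.integral_dotProduct,
    hQ.integral_inner_b]

end Standing

end QuadProblem

/-! Concentration of empirical means -/

section Concentration

variable {Ω : Type w} {X : Type*} [MeasurableSpace Ω] [MeasurableSpace X] {Pr : Measure Ω}
  {μ : Measure X} {ξ : ℕ → Ω → X}

theorem IsIIDSample.ae_forall (h : IsIIDSample Pr μ ξ) {p : X → Prop} (hp : ∀ᵐ x ∂μ, p x) :
    ∀ᵐ ω ∂Pr, ∀ i, p (ξ i ω) := by
  rw [ae_all_iff]
  intro i
  rw [← h.law i] at hp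
  exact ae_of_ae_map (h.measurable i).aemeasurable hp

/-- A one-sided Bernstein inequality: if the variance proxy `l * E[g²]` is at most `E[g] / 4`, then
the empirical mean of `g` is rarely below one half of its expectation. -/
theorem IsIIDSample.measure_sum_le_half [IsProbabilityMeasure μ] (h : IsIIDSample Pr μ ξ)
    {g : X → ℝ} (hg : Measurable g) {B l : ℝ} (hl : 0 ≤ l) (hB : ∀ᵐ p ∂μ, |g p| ≤ B)
    (hlB : l * B ≤ 1) (hvar : l * ∫ p, g p ^ 2 ∂μ ≤ (∫ p, g p ∂μ) / 4) (n : ℕ) :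
    Pr {ω | ∑ i ∈ Finset.range n, g (ξ i ω) ≤ n * (∫ p, g p ∂μ) / 2}
      ≤ ENNReal.ofReal (Real.exp (-(n * (l * (∫ p, g p ∂μ) / 4)))) := by
  have hPr : IsProbabilityMeasure Pr := h.indep.isProbabilityMeasure
  have hind : iIndepFun (fun i => g ∘ ξ i) Pr := h.indep.comp _ fun _ => hg
  have hmeas : ∀ i, Measurable (g ∘ ξ i) := fun i => hg.comp (h.measurable i)
  have hB' : ∀ᵐ p ∂μ, |-l * g p| ≤ 1 := by
    filter_upwards [hB] with p hp
    rw [abs_mul, abs_neg, abs_of_nonneg hl]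
    exact (mul_le_mul_of_nonneg_left hp hl).trans hlB
  have hexp_meas : Measurable fun p => Real.exp (-l * g p) := (hg.const_mul _).exp
  have hint : Integrable (fun p => Real.exp (-l * g p)) μ := by
    refine Integrable.of_bound hexp_meas.aestronglyMeasurable (Real.exp 1) ?_
    filter_upwards [hB'] with p hp
    rw [Real.norm_eq_abs, Real.abs_exp]
    exact Real.exp_le_exp.2 (le_trans (le_abs_self _) hp)
  have hintg : Integrable g μ := Integrable.of_bound hg.aestronglyMeasurable B hB
  have hintg2 : Integrable (fun p => g p ^ 2) μ := by
    refine Integrable.of_bound (hg.pow_const 2).aestronglyMeasurable (B ^ 2) ?_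
    filter_upwards [hB] with p hp
    rw [Real.norm_eq_abs, abs_pow]
    gcongr
  have hmgf : ∫ p, Real.exp (-l * g p) ∂μ ≤ Real.exp (-(3 / 4 * (l * ∫ p, g p ∂μ))) := by
    -- `exp u ≤ 1 + u + u²` for `|u| ≤ 1`, with `u = -l g`. By `hvar` the quadratic term costs at
    -- most a quarter of the linear one, hence the factor `3/4` in the exponent.
    have h1 : ∫ p, Real.exp (-l * g p) ∂μ ≤ ∫ p, (1 + -l * g p + l ^ 2 * g p ^ 2) ∂μ := by
      refine integral_mono_ae hint
        (((integrable_const _).add (hintg.const_mul _)).add (hintg2.const_mul _)) ?_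
      filter_upwards [hB'] with p hp
      have := (abs_le.1 (Real.abs_exp_sub_one_sub_id_le hp)).2
      have e : (-l * g p) ^ 2 = l ^ 2 * g p ^ 2 := by ring
      rw [e] at this
      show Real.exp (-l * g p) ≤ 1 + -l * g p + l ^ 2 * g p ^ 2
      linarith
    have h2 : ∫ p, (1 + -l * g p + l ^ 2 * g p ^ 2) ∂μ
        = 1 - l * ∫ p, g p ∂μ + l ^ 2 * ∫ p, g p ^ 2 ∂μ := by
      have h12 : Integrable (fun p => 1 + -l * g p) μ :=
        (integrable_const _).add (hintg.const_mul _)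
      rw [integral_add h12 (hintg2.const_mul _),
        integral_add (integrable_const _) (hintg.const_mul _), integral_const_mul,
        integral_const_mul]
      simp
      ring
    have h3 := Real.add_one_le_exp (-(3 / 4 * (l * ∫ p, g p ∂μ)))
    have h4 := mul_le_mul_of_nonneg_left hvar hl
    nlinarith
  have hmgf_i : ∀ i, mgf (g ∘ ξ i) Pr (-l) = ∫ p, Real.exp (-l * g p) ∂μ := by
    intro i
    rw [← h.law i, integral_map (h.measurable i).aemeasurable hexp_meas.aestronglyMeasurable]
    rfl
  have hint_i : ∀ i, Integrable (fun ω => Real.exp (-l * (g ∘ ξ i) ω)) Pr := by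
    intro i
    rw [← h.law i] at hint
    exact (integrable_map_measure hexp_meas.aestronglyMeasurable
      (h.measurable i).aemeasurable).1 hint
  have hch := measure_le_le_exp_mul_mgf (μ := Pr) (X := ∑ i ∈ Finset.range n, g ∘ ξ i)
    (t := -l) (n * (∫ p, g p ∂μ) / 2) (by linarith)
    (hind.integrable_exp_mul_sum hmeas fun i _ => hint_i i)
  rw [hind.mgf_sum hmeas, Finset.prod_congr rfl fun i _ => hmgf_i i, Finset.prod_const,
    Finset.card_range] at hch
  have hset : {ω | ∑ i ∈ Finset.range n, g (ξ i ω) ≤ n * (∫ p, g p ∂μ) / 2}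
      = {ω | (∑ i ∈ Finset.range n, g ∘ ξ i) ω ≤ n * (∫ p, g p ∂μ) / 2} := by
    ext ω
    simp
  rw [hset, ← ofReal_measureReal]
  refine ENNReal.ofReal_le_ofReal (hch.trans ?_)
  calc Real.exp (- -l * (n * (∫ p, g p ∂μ) / 2)) * (∫ p, Real.exp (-l * g p) ∂μ) ^ n
      ≤ Real.exp (- -l * (n * (∫ p, g p ∂μ) / 2))
        * Real.exp (-(3 / 4 * (l * ∫ p, g p ∂μ))) ^ n := by
        gcongr
    _ = _ := by
      rw [← Real.exp_nat_mul, ← Real.exp_add]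
      congr 1
      ring

end Concentration

/-! Finite nets of bounded sets -/

/-- Cut the cube into cells of side `1/k` and keep one point of `W` from every cell that meets `W`.
The representatives lie in `W` itself because the losses are Lipschitz only there. -/
theorem exists_finset_net {d : ℕ} {W : Set (EuclideanSpace ℝ (Fin d))} {R k : ℕ} (hk : 0 < k)
    (hW : ∀ x ∈ W, ‖x‖ ≤ R) :
    ∃ V : Finset (EuclideanSpace ℝ (Fin d)), (∀ v ∈ V, v ∈ W) ∧ V.card ≤ (2 * (R * k) + 1) ^ d ∧
      ∀ x ∈ W, ∃ v ∈ V, ‖x - v‖ ≤ (d : ℝ) / k := by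
  classical
  have hk0 : (0 : ℝ) < k := by exact_mod_cast hk
  set cell : EuclideanSpace ℝ (Fin d) → Fin d → ℤ := fun x i => ⌊x i * k⌋ with hcell
  set F : Finset (Fin d → ℤ) :=
    Fintype.piFinset fun _ => Finset.Icc (-((R * k : ℕ) : ℤ)) ((R * k : ℕ) : ℤ) with hF
  have hFmem : ∀ x ∈ W, cell x ∈ F := by
    intro x hx
    rw [hF, Fintype.mem_piFinset]
    intro i
    have h1 : |x i| ≤ R := (PiLp.norm_apply_le x i).trans (hW x hx)
    have h2 := abs_le.1 h1
    rw [Finset.mem_Icc]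
    constructor
    · rw [Int.le_floor]
      push_cast
      nlinarith
    · have : x i * k ≤ ((R * k : ℕ) : ℤ) := by
        push_cast
        nlinarith
      exact Int.cast_le.1 ((Int.floor_le (x i * k)).trans this)
  set rep : (Fin d → ℤ) → EuclideanSpace ℝ (Fin d) := fun c =>
    if h : ∃ x ∈ W, cell x = c then h.choose else 0 with hrep
  have hrep_spec : ∀ c, (∃ x ∈ W, cell x = c) → rep c ∈ W ∧ cell (rep c) = c := by
    intro c hc
    simp only [hrep, dif_pos hc]
    exact hc.choose_spec
  refine ⟨(F.filter fun c => ∃ x ∈ W, cell x = c).image rep, ?_, ?_, ?_⟩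
  · intro v hv
    obtain ⟨c, hc, rfl⟩ := Finset.mem_image.1 hv
    exact (hrep_spec c (Finset.mem_filter.1 hc).2).1
  · refine Finset.card_image_le.trans ((Finset.card_filter_le _ _).trans ?_)
    rw [hF, Fintype.card_piFinset_const, Int.card_Icc]
    apply le_of_eq
    congr 1
    omega
  · intro x hx
    refine ⟨rep (cell x), Finset.mem_image_of_mem _
      (Finset.mem_filter.2 ⟨hFmem x hx, x, hx, rfl⟩), ?_⟩
    obtain ⟨-, hc⟩ := hrep_spec (cell x) ⟨x, hx, rfl⟩
    have hcoord : ∀ i, |x i - rep (cell x) i| ≤ 1 / k := by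
      intro i
      have h1 : ⌊rep (cell x) i * k⌋ = ⌊x i * k⌋ := congrFun hc i
      have h2 := Int.abs_sub_lt_one_of_floor_eq_floor h1
      rw [← sub_mul, abs_mul, abs_of_pos hk0] at h2
      rw [abs_sub_comm, le_div_iff₀ hk0]
      exact h2.le
    rw [EuclideanSpace.norm_eq]
    refine Real.sqrt_le_iff.2 ⟨by positivity, ?_⟩
    calc ∑ i, ‖(x - rep (cell x)) i‖ ^ 2 ≤ ∑ _i : Fin d, (1 / (k : ℝ)) ^ 2 := by
          refine Finset.sum_le_sum fun i _ => ?_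
          have := hcoord i
          rw [Real.norm_eq_abs]
          exact pow_le_pow_left₀ (abs_nonneg _) this 2
      _ = d * (1 / (k : ℝ)) ^ 2 := by simp
      -- The crude bound `√d ≤ d` is harmless: the mesh enters the final rate only through `log k`
      -- and a lower-order error.
      _ ≤ (d : ℝ) ^ 2 * (1 / (k : ℝ)) ^ 2 := by
          gcongr
          exact_mod_cast Nat.le_self_pow two_ne_zero d
      _ = (d / k) ^ 2 := by ring

/-! Empirical risk minimization -/

namespace QuadProblem

variable {d : ℕ} {Z : Type u} {Z' : Type v} [MeasurableSpace Z] [MeasurableSpace Z']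
  {Q : QuadProblem d Z Z'}

theorem Standing.measurable_loss (hQ : Q.Standing) (x : EuclideanSpace ℝ (Fin d)) :
    Measurable (Q.loss x) := by
  have h1 : Measurable fun p : Z × Z' => x.ofLp ⬝ᵥ (Q.A p.1 *ᵥ x.ofLp) := by
    simp only [dotProduct, Matrix.mulVec]
    refine Finset.measurable_sum _ fun i _ => Measurable.const_mul ?_ _
    refine Finset.measurable_sum _ fun j _ => Measurable.mul_const ?_ _
    exact (hQ.measurable_A i j).comp measurable_fst
  have h2 : Measurable fun p : Z × Z' => ⟪x, Q.b p.2⟫ :=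
    measurable_const.inner (hQ.measurable_b.comp measurable_snd)
  exact (h1.add h2).add_const _

theorem Standing.abs_risk_sub_le (hQ : Q.Standing) {G : ℝ} (hG : Q.LossLipschitz G)
    {x y : EuclideanSpace ℝ (Fin d)} (hx : x ∈ Q.W) (hy : y ∈ Q.W) :
    |Q.risk x - Q.risk y| ≤ G * ‖x - y‖ := by
  have := hQ.isProbability
  rw [← hQ.integral_loss, ← hQ.integral_loss,
    ← integral_sub (hQ.integrable_loss x) (hQ.integrable_loss y)]
  have := norm_integral_le_of_norm_le_const (μ := Q.μ) (f := fun p => Q.loss x p - Q.loss y p)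
    (C := G * ‖x - y‖) (by filter_upwards [hG] with p hp using hp x hx y hy)
  simpa using this

theorem Standing.integral_loss_sub (hQ : Q.Standing) (x y : EuclideanSpace ℝ (Fin d)) :
    ∫ p, (Q.loss x p - Q.loss y p) ∂Q.μ = Q.risk x - Q.risk y := by
  rw [integral_sub (hQ.integrable_loss x) (hQ.integrable_loss y), hQ.integral_loss,
    hQ.integral_loss]

/-- The excess risk of empirical risk minimizers is at most `τ`, up to the discretization error,
as soon as every feasible point with excess risk above `τ` has a comparator for which the second
moment of the loss difference is small compared to the square of the excess risk. -/
theorem Standing.erm_excess_le (hQ : Q.Standing) {G τ T δ : ℝ} {R k n : ℕ} (hG0 : 0 ≤ G)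
    (hG : Q.LossLipschitz G) (hR : ∀ x ∈ Q.W, ‖x‖ ≤ R) (hk : 0 < k) (hn : 0 < n) (hT : 0 ≤ T)
    (hτ : 0 ≤ τ)
    (hcomp : ∀ x ∈ Q.W, τ < Q.risk x - Q.optRisk → ∃ y ∈ argminOn Q.risk Q.W,
      4 * T * (G * ‖x - y‖) ≤ Q.risk x - Q.optRisk ∧
      16 * T * ∫ p, (Q.loss x p - Q.loss y p) ^ 2 ∂Q.μ ≤ (Q.risk x - Q.optRisk) ^ 2)
    (hcard : ((2 * (R * k) + 1) ^ d : ℝ) * Real.exp (-(n * T)) ≤ δ)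
    {Ω : Type w} [MeasurableSpace Ω] {Pr : Measure Ω} {ξ : ℕ → Ω → Z × Z'}
    (hξ : IsIIDSample Pr Q.μ ξ) :
    WithHighProb Pr δ fun ω => ∀ x ∈ argminOn (Q.empRisk n fun i => ξ i ω) Q.W,
      Q.risk x - Q.optRisk ≤ τ + 3 * (G * (d / k)) := by
  have := hQ.isProbability
  obtain ⟨V, hVW, hVcard, hVnet⟩ := exists_finset_net hk hR
  have hε0 : 0 ≤ G * ((d : ℝ) / k) := by positivity
  choose! cmp hcmp hcmp1 hcmp2 using hcomp
  set bad : EuclideanSpace ℝ (Fin d) → Set Ω := fun v => {ω | τ < Q.risk v - Q.optRisk ∧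
    ∑ i ∈ Finset.range n, (Q.loss v (ξ i ω) - Q.loss (cmp v) (ξ i ω))
      ≤ n * (Q.risk v - Q.optRisk) / 2} with hbad
  have hbad_le : ∀ v ∈ V, Pr (bad v) ≤ ENNReal.ofReal (Real.exp (-(n * T))) := by
    intro v hv
    by_cases hτv : τ < Q.risk v - Q.optRisk
    · have hvW := hVW v hv
      have hmin := hcmp v hvW hτv
      have hint : ∫ p, (Q.loss v p - Q.loss (cmp v) p) ∂Q.μ = Q.risk v - Q.optRisk := by
        rw [hQ.integral_loss_sub, optRisk_eq hmin]
      have hΔ : 0 < Q.risk v - Q.optRisk := hτ.trans_lt hτv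
      -- With `l = 4T/Δ` the two comparator conditions are exactly `l B ≤ 1` and the variance
      -- condition of Bernstein's inequality, and the exponent `n l Δ / 4` equals `n T`.
      have hb := hξ.measure_sum_le_half (g := fun p => Q.loss v p - Q.loss (cmp v) p)
        ((hQ.measurable_loss v).sub (hQ.measurable_loss _)) (B := G * ‖v - cmp v‖)
        (l := 4 * T / (Q.risk v - Q.optRisk)) (by positivity)
        (by filter_upwards [hG] with p hp using hp _ hvW _ hmin.1)
        (by
          rw [div_mul_eq_mul_div, div_le_one hΔ]
          exact hcmp1 v hvW hτv)
        (by
          rw [hint, div_mul_eq_mul_div, div_le_iff₀ hΔ]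
          nlinarith [hcmp2 v hvW hτv]) n
      rw [hint] at hb
      refine (measure_mono fun ω hω => hω.2).trans (hb.trans (le_of_eq ?_))
      congr 3
      field_simp
    · have : bad v = ∅ := by
        ext ω
        simp [hbad, hτv]
      rw [this, measure_empty]
      exact zero_le
  have hae := hξ.ae_forall hG
  have hsub : {ω | ¬ ∀ x ∈ argminOn (Q.empRisk n fun i => ξ i ω) Q.W,
      Q.risk x - Q.optRisk ≤ τ + 3 * (G * (d / k))}
      ⊆ {ω | ¬ ∀ i, ∀ x ∈ Q.W, ∀ y ∈ Q.W, |Q.loss x (ξ i ω) - Q.loss y (ξ i ω)| ≤ G * ‖x - y‖}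
        ∪ ⋃ v ∈ V, bad v := by
    intro ω hω
    by_contra hcon
    rw [Set.mem_union, not_or] at hcon
    obtain ⟨hlip, hnb⟩ := hcon
    replace hlip := not_not.1 hlip
    simp only [Set.mem_iUnion, not_exists] at hnb
    refine hω fun x hx => ?_
    obtain ⟨v, hv, hxv⟩ := hVnet x hx.1
    have hvW := hVW v hv
    have hGε : G * ‖x - v‖ ≤ G * (d / k) := mul_le_mul_of_nonneg_left hxv hG0
    have hrisk := (abs_le.1 (hQ.abs_risk_sub_le hG hx.1 hvW)).2
    by_cases hτv : τ < Q.risk v - Q.optRisk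
    · have hmin := hcmp v hvW hτv
      have h1 : ¬ ∑ i ∈ Finset.range n, (Q.loss v (ξ i ω) - Q.loss (cmp v) (ξ i ω))
          ≤ n * (Q.risk v - Q.optRisk) / 2 := fun h => hnb v hv ⟨hτv, h⟩
      have hn0 : (0 : ℝ) < n := by exact_mod_cast hn
      have h2 := hx.2 _ hmin.1
      simp only [empRisk] at h2
      replace h2 := le_of_mul_le_mul_left h2 (by positivity)
      -- The net point `v` inherits near-optimality from `x`, so its empirical margin over the
      -- comparator is at most the mesh error. Outside `bad v` this forces the excess risk of `v`
      -- below twice that error; returning to `x` costs it once more.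
      have h3 : ∑ i ∈ Finset.range n, (Q.loss v (ξ i ω) - Q.loss x (ξ i ω))
          ≤ ∑ _i ∈ Finset.range n, G * (d / k) := by
        refine Finset.sum_le_sum fun i _ => ?_
        have := (abs_le.1 (hlip i v hvW x hx.1)).2
        rw [norm_sub_rev] at this
        linarith
      rw [Finset.sum_const, Finset.card_range, nsmul_eq_mul, Finset.sum_sub_distrib] at h3
      rw [not_le, Finset.sum_sub_distrib] at h1
      have h4 : n * ((Q.risk v - Q.optRisk) / 2) < n * (G * (d / k)) := by linarith
      have h5 := lt_of_mul_lt_mul_left h4 hn0.le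
      linarith
    · linarith
  refine (measure_mono hsub).trans ((measure_union_le _ _).trans ?_)
  have h0 : Pr {ω | ¬ ∀ i, ∀ x ∈ Q.W, ∀ y ∈ Q.W,
      |Q.loss x (ξ i ω) - Q.loss y (ξ i ω)| ≤ G * ‖x - y‖} = 0 := hae
  rw [h0, zero_add]
  refine (measure_biUnion_finset_le _ _).trans ((Finset.sum_le_sum hbad_le).trans ?_)
  rw [Finset.sum_const, nsmul_eq_mul, ← ENNReal.ofReal_natCast,
    ← ENNReal.ofReal_mul (by positivity)]
  refine ENNReal.ofReal_le_ofReal (le_trans ?_ hcard)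
  gcongr
  exact_mod_cast hVcard

end QuadProblem

theorem WithHighProb.mono {Ω : Type w} [MeasurableSpace Ω] {Pr : Measure Ω} {δ : ℝ}
    {p q : Ω → Prop} (h : WithHighProb Pr δ p) (hpq : ∀ ω, p ω → q ω) : WithHighProb Pr δ q :=
  le_trans (measure_mono fun _ hω hp => hω (hpq _ hp)) h

/-! ### Rates for empirical risk minimization from second moment bounds -/

namespace QuadProblem

variable {d : ℕ} {Z : Type u} {Z' : Type v} [MeasurableSpace Z] [MeasurableSpace Z']
  {Q : QuadProblem d Z Z'}

theorem exists_comparator {α : ℝ} (hE : EBC Q.W Q.risk 1 α) {x : EuclideanSpace ℝ (Fin d)}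
    (hx : x ∈ Q.W) :
    ∃ y ∈ argminOn Q.risk Q.W, ‖x - y‖ ^ 2 ≤ α * (Q.risk x - Q.optRisk) := by
  obtain ⟨y, hy, h⟩ := hE.2.2.2 x hx
  refine ⟨y, hy.1, ?_⟩
  rwa [Standing.optRisk_eq hy.1, ← Real.rpow_one (Q.risk x - Q.risk y)]

theorem Standing.optRisk_nonneg (hQ : Q.Standing)
    (h : ∀ᵐ p ∂Q.μ, ∀ x ∈ Q.W, 0 ≤ Q.loss x p) : 0 ≤ Q.optRisk := by
  obtain ⟨y, hy⟩ := hQ.argmin_nonempty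
  rw [optRisk_eq hy, ← hQ.integral_loss]
  exact integral_nonneg_of_ae (by filter_upwards [h] with p hp using hp y hy.1)

theorem BoundedBy.nonneg {σ : ℝ} (hQ : Q.Standing) (h : Q.BoundedBy σ) : 0 ≤ σ := by
  have := hQ.isProbability
  obtain ⟨p, hp⟩ := h.exists
  exact (norm_nonneg _).trans ((le_max_left _ _).trans hp)

theorem BoundedBy.lossLipschitz {σ R : ℝ} (h : Q.BoundedBy σ) (hR : ∀ x ∈ Q.W, ‖x‖ ≤ R) :
    Q.LossLipschitz (2 * σ * R + σ) := by
  filter_upwards [h] with p hp x hx y hy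
  have hA := (le_max_left _ _).trans hp
  have hb := (le_max_right _ _).trans hp
  have hσ := (norm_nonneg _).trans hA
  have hRx := hR x hx
  have hRy := hR y hy
  have e : Q.loss x p - Q.loss y p = x.ofLp ⬝ᵥ (Q.A p.1 *ᵥ (x - y).ofLp)
      + (x - y).ofLp ⬝ᵥ (Q.A p.1 *ᵥ y.ofLp) + ⟪x - y, Q.b p.2⟫ := by
    simp only [loss, WithLp.ofLp_sub, Matrix.mulVec_sub, dotProduct_sub, sub_dotProduct,
      inner_sub_left]
    ring
  rw [e]
  have h1 : |x.ofLp ⬝ᵥ (Q.A p.1 *ᵥ (x - y).ofLp)| ≤ σ * R * ‖x - y‖ :=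
    (abs_dotProduct_mulVec_le _ _ _).trans (by gcongr)
  have h2 : |(x - y).ofLp ⬝ᵥ (Q.A p.1 *ᵥ y.ofLp)| ≤ σ * ‖x - y‖ * R :=
    (abs_dotProduct_mulVec_le _ _ _).trans (by gcongr)
  have h3 : |⟪x - y, Q.b p.2⟫| ≤ ‖x - y‖ * σ :=
    (abs_real_inner_le_norm _ _).trans (by gcongr)
  refine (abs_add_three _ _ _).trans ?_
  linarith

theorem Standing.integral_sq_le (hQ : Q.Standing) {G : ℝ} (hG : Q.LossLipschitz G)
    {x y : EuclideanSpace ℝ (Fin d)} (hx : x ∈ Q.W) (hy : y ∈ Q.W) :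
    ∫ p, (Q.loss x p - Q.loss y p) ^ 2 ∂Q.μ ≤ (G * ‖x - y‖) ^ 2 := by
  have := hQ.isProbability
  have h := norm_integral_le_of_norm_le_const (μ := Q.μ)
    (f := fun p => (Q.loss x p - Q.loss y p) ^ 2) (C := (G * ‖x - y‖) ^ 2) (by
      filter_upwards [hG] with p hp
      rw [Real.norm_eq_abs, abs_pow]
      exact pow_le_pow_left₀ (abs_nonneg _) (hp x hx y hy) 2)
  rw [probReal_univ, mul_one] at h
  exact (le_abs_self _).trans h

/-- The factor by which the logarithmic size of a sufficiently fine net exceeds `d log n`. -/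
noncomputable def netFactor (R : ℝ) : ℝ := Real.log (3 * (⌈R⌉₊ + 1)) / Real.log 2 + 3

theorem one_le_netFactor (R : ℝ) : 1 ≤ netFactor R := by
  have h1 : 0 ≤ Real.log (3 * (⌈R⌉₊ + 1)) := by
    refine Real.log_nonneg ?_
    have : (0 : ℝ) ≤ ⌈R⌉₊ := Nat.cast_nonneg _
    linarith
  have h2 : 0 ≤ Real.log (3 * (⌈R⌉₊ + 1)) / Real.log 2 :=
    div_nonneg h1 (Real.log_nonneg one_le_two)
  rw [netFactor]
  linarith

/-- The net of mesh `1 / n²` is small enough for the union bound. -/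
theorem card_net_mul_exp_le {R δ η : ℝ} {d n : ℕ} (hd : 1 ≤ d) (hn : 2 ≤ n) (hδ : 0 < δ)
    (hδ1 : δ < 1) (hη : η = (d * Real.log n + Real.log (1 / δ)) / n) (hη2 : η ≤ 1 / 2) :
    ((2 * (((⌈R⌉₊ + 1 : ℕ) : ℝ) * ((n ^ 2 * d : ℕ) : ℝ)) + 1) ^ d : ℝ)
      * Real.exp (-(n * (netFactor R * η))) ≤ δ := by
  have hn2 : (2 : ℝ) ≤ n := by exact_mod_cast hn
  have hn0 : (0 : ℝ) < n := by linarith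
  have hd1 : (1 : ℝ) ≤ d := by exact_mod_cast hd
  have hlog2 : 0.5 ≤ Real.log 2 := by have := Real.log_two_gt_d9; linarith
  have hlogn : Real.log 2 ≤ Real.log n := Real.log_le_log two_pos hn2
  have hlogδ : 0 ≤ Real.log (1 / δ) := Real.log_nonneg (by rw [le_div_iff₀ hδ]; linarith)
  have hD : n * η = d * Real.log n + Real.log (1 / δ) := by
    rw [hη]
    field_simp
  -- `d log n ≤ n η ≤ n / 2` and `log n ≥ 1/2`; this removes `d` from the base of the covering
  -- number.
  have hdn : (d : ℝ) ≤ n := by nlinarith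
  set r : ℝ := ⌈R⌉₊ + 1 with hr
  have hr1 : 1 ≤ r := by
    have : (0 : ℝ) ≤ ⌈R⌉₊ := Nat.cast_nonneg _
    linarith
  have hbase : 2 * (((⌈R⌉₊ + 1 : ℕ) : ℝ) * ((n ^ 2 * d : ℕ) : ℝ)) + 1 ≤ 3 * r * n ^ 3 := by
    push_cast
    rw [← hr]
    have h1 : (n : ℝ) ^ 2 * d ≤ n ^ 3 := by nlinarith [sq_nonneg (n : ℝ)]
    have h2 : (1 : ℝ) ≤ n ^ 3 := one_le_pow₀ (by linarith)
    nlinarith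
  have hlogbase : Real.log (3 * r * n ^ 3) ≤ netFactor R * Real.log n := by
    rw [Real.log_mul (by positivity) (by positivity), Real.log_pow, netFactor, ← hr, add_mul]
    push_cast
    have h3 : 0 ≤ Real.log (3 * r) := Real.log_nonneg (by linarith)
    have h4 : Real.log (3 * r) ≤ Real.log (3 * r) / Real.log 2 * Real.log n := by
      rw [div_mul_eq_mul_div, le_div_iff₀ (by linarith)]
      gcongr
    linarith
  calc ((2 * (((⌈R⌉₊ + 1 : ℕ) : ℝ) * ((n ^ 2 * d : ℕ) : ℝ)) + 1) ^ d : ℝ)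
        * Real.exp (-(n * (netFactor R * η)))
      ≤ (3 * r * n ^ 3) ^ d * Real.exp (-(n * (netFactor R * η))) := by gcongr
    _ = Real.exp (d * Real.log (3 * r * n ^ 3) - netFactor R * (n * η)) := by
        rw [sub_eq_add_neg, Real.exp_add, Real.exp_nat_mul, Real.exp_log (by positivity)]
        ring_nf
    _ ≤ Real.exp (Real.log δ) := by
        rw [Real.exp_le_exp, hD]
        have h5 : d * Real.log (3 * r * n ^ 3) ≤ d * (netFactor R * Real.log n) := by gcongr
        have h6 : Real.log (1 / δ) = -Real.log δ := by rw [one_div, Real.log_inv]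
        have h7 := mul_le_mul_of_nonneg_right (one_le_netFactor R) hlogδ
        rw [h6] at h7 ⊢
        linarith
    _ = δ := Real.exp_log hδ

theorem ERMRate.mono {adm : ℕ → Prop} {r s : ℕ → ℝ → ℝ} (h : ERMRate.{u, v, w} Q adm r)
    {adm' : ℕ → Prop} (hadm : ∀ n, adm' n → adm n)
    (hrs : ∀ n δ, adm' n → 0 < δ → δ < 1 → r n δ ≤ s n δ) : ERMRate.{u, v, w} Q adm' s := by
  intro Ω _ Pr _ ξ hξ n hn δ hδ hδ1
  refine (h Ω Pr ξ hξ n (hadm n hn) δ hδ hδ1).mono fun ω hω x hx => ?_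
  exact (hω x hx).trans (hrs n δ hn hδ hδ1)

/-- A rate for empirical risk minimization follows from a bound for second moments of loss
differences. Only the case where `(d log n + log (1/δ)) / n` is small matters. -/
theorem Standing.ermRate_of_comparators (hQ : Q.Standing) {G R c : ℝ} (hG0 : 0 ≤ G)
    (hG : Q.LossLipschitz G) (hR : ∀ x ∈ Q.W, ‖x‖ ≤ R) (hc : c ≤ 1 / 2) {rate : ℕ → ℝ → ℝ}
    (hrate : ∀ (n : ℕ) (δ η : ℝ), 2 ≤ n → 0 < δ → δ < 1 →
      η = (d * Real.log n + Real.log (1 / δ)) / n → 0 ≤ η → 0 ≤ rate n δ ∧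
      (c < η → 2 * G * R ≤ rate n δ) ∧ (η ≤ c → ∃ τ, 0 ≤ τ ∧ τ + 12 * G * η ^ 2 ≤ rate n δ ∧
        ∀ x ∈ Q.W, τ < Q.risk x - Q.optRisk → ∃ y ∈ argminOn Q.risk Q.W,
          4 * (netFactor R * η) * (G * ‖x - y‖) ≤ Q.risk x - Q.optRisk ∧
          16 * (netFactor R * η) * ∫ p, (Q.loss x p - Q.loss y p) ^ 2 ∂Q.μ
            ≤ (Q.risk x - Q.optRisk) ^ 2)) :
    ERMRate.{u, v, w} Q (fun n => 2 ≤ n) rate := by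
  intro Ω _ Pr _ ξ hξ n hn δ hδ hδ1
  have hn2 : (2 : ℝ) ≤ n := by exact_mod_cast hn
  have hn0 : (0 : ℝ) < n := by linarith
  have hlog2 : 0.5 ≤ Real.log 2 := by have := Real.log_two_gt_d9; linarith
  have hlogn : Real.log 2 ≤ Real.log n := Real.log_le_log two_pos hn2
  have hlogδ : 0 ≤ Real.log (1 / δ) := Real.log_nonneg (by rw [le_div_iff₀ hδ]; linarith)
  obtain ⟨η, hη⟩ : ∃ η, η = (d * Real.log n + Real.log (1 / δ)) / n := ⟨_, rfl⟩
  have hD : n * η = d * Real.log n + Real.log (1 / δ) := by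
    rw [hη]
    field_simp
  have hη0 : 0 ≤ η := by
    rw [hη]
    positivity
  obtain ⟨h0, hlarge, hsmall⟩ := hrate n δ η hn hδ hδ1 hη hη0
  have htriv : (∀ x ∈ Q.W, Q.risk x - Q.optRisk ≤ rate n δ) → WithHighProb Pr δ fun ω =>
      ∀ x ∈ argminOn (Q.empRisk n fun i => ξ i ω) Q.W, Q.risk x - Q.optRisk ≤ rate n δ := by
    intro h
    have : {ω | ¬ ∀ x ∈ argminOn (Q.empRisk n fun i => ξ i ω) Q.W,
        Q.risk x - Q.optRisk ≤ rate n δ} = ∅ :=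
      Set.eq_empty_of_forall_notMem fun ω hω => hω fun x hx => h x hx.1
    rw [WithHighProb, this, measure_empty]
    exact zero_le
  obtain ⟨y, hy⟩ := hQ.argmin_nonempty
  -- In dimension `0` the mesh parameter `n² d` would vanish, but there the feasible set is a single
  -- point.
  rcases Nat.eq_zero_or_pos d with rfl | hd
  · refine htriv fun x _ => ?_
    rw [optRisk_eq hy, Subsingleton.elim x y, sub_self]
    exact h0
  rcases lt_or_ge c η with hcη | hcη
  -- For large `η` the diameter bound `2 G R` is already below the rate.
  · refine htriv fun x hx => le_trans ?_ (hlarge hcη)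
    have h1 := (abs_le.1 (hQ.abs_risk_sub_le hG hx hy.1)).2
    have h2 : ‖x - y‖ ≤ R + R := (norm_sub_le _ _).trans (add_le_add (hR x hx) (hR y hy.1))
    rw [optRisk_eq hy]
    have h3 := mul_le_mul_of_nonneg_left h2 hG0
    linarith
  obtain ⟨τ, hτ0, hτ, hcomp⟩ := hsmall hcη
  have hk : 0 < n ^ 2 * d := by positivity
  have hT : 0 ≤ netFactor R * η := mul_nonneg (by have := one_le_netFactor R; linarith) hη0
  have hR' : ∀ x ∈ Q.W, ‖x‖ ≤ ((⌈R⌉₊ + 1 : ℕ) : ℝ) := by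
    intro x hx
    push_cast
    have := Nat.le_ceil R
    linarith [hR x hx]
  have main := hQ.erm_excess_le (R := ⌈R⌉₊ + 1) (k := n ^ 2 * d) (n := n) (τ := τ) hG0 hG hR' hk
    (by omega) hT hτ0 hcomp (card_net_mul_exp_le hd hn hδ hδ1 hη (hcη.trans hc)) hξ
  refine main.mono fun ω hω x hx => (hω x hx).trans (le_trans ?_ hτ)
  have hd1 : (1 : ℝ) ≤ d := by exact_mod_cast hd
  have e : (d : ℝ) / ((n ^ 2 * d : ℕ) : ℝ) = 1 / n ^ 2 := by
    push_cast
    field_simp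
  -- Since `d log n ≥ log 2 ≥ 1/2`, the discretization error `3 G / n²` is at most `12 G η²`.
  have h4 : 1 / 2 ≤ n * η := by nlinarith
  have h5 : 1 / (n : ℝ) ^ 2 ≤ 4 * η ^ 2 := by
    rw [div_le_iff₀ (by positivity)]
    nlinarith
  rw [e]
  have h6 := mul_le_mul_of_nonneg_left h5 hG0
  linarith

/-- The constant in the rate of empirical risk minimization for Lipschitz losses. -/
noncomputable def ermConst (α G R : ℝ) : ℝ :=
  16 * G ^ 2 * α * netFactor R ^ 2 + 6 * G + 4 * G * R

/-- The Lipschitz property and the error bound give the second moment `G² α Δ`, which is small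
against `Δ²` as soon as `Δ` exceeds `τ = 16 G² α K² η`. The other summands of `ermConst` pay for the
discretization and for `η > 1/2`. -/
theorem Standing.ermRate_of_lipschitz (hQ : Q.Standing) {α G R : ℝ} (hE : EBC Q.W Q.risk 1 α)
    (hG0 : 0 ≤ G) (hG : Q.LossLipschitz G) (hR : ∀ x ∈ Q.W, ‖x‖ ≤ R) :
    ERMRate.{u, v, w} Q (fun n => 2 ≤ n)
      (fun n δ => ermConst α G R * ((d * Real.log n + Real.log (1 / δ)) / n)) := by
  have hα := hE.2.2.1
  have hK := one_le_netFactor R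
  obtain ⟨x₀, hx₀⟩ := hQ.nonempty
  have hR0 : 0 ≤ R := (norm_nonneg _).trans (hR x₀ hx₀)
  refine hQ.ermRate_of_comparators hG0 hG hR le_rfl fun n δ η hn hδ hδ1 hη hη0 => ?_
  rw [← hη]
  set K := netFactor R with hKdef
  have hC : ermConst α G R = 16 * G ^ 2 * α * K ^ 2 + 6 * G + 4 * G * R := rfl
  have hC0 : 0 ≤ ermConst α G R := by
    rw [hC]
    positivity
  refine ⟨mul_nonneg hC0 hη0, fun hη2 => ?_, fun hη2 => ⟨16 * G ^ 2 * α * K ^ 2 * η, by positivity,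
    ?_, fun x hx hτ => ?_⟩⟩
  · calc 2 * G * R ≤ 4 * G * R * η := by nlinarith [mul_nonneg hG0 hR0]
      _ ≤ ermConst α G R * η := by
        gcongr
        rw [hC]
        have : 0 ≤ 16 * G ^ 2 * α * K ^ 2 := by positivity
        linarith
  · have h1 : 12 * G * η ^ 2 ≤ 6 * G * η := by nlinarith [mul_nonneg hG0 hη0]
    have h2 : 0 ≤ 4 * G * R * η := by positivity
    rw [hC]
    linarith
  · obtain ⟨y, hy, hxy⟩ := exists_comparator hE hx
    set Δ := Q.risk x - Q.optRisk with hΔ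
    have hΔ0 : 0 < Δ := lt_of_le_of_lt (by positivity) hτ
    refine ⟨y, hy, ?_, ?_⟩
    -- Squares are compared because the error bound controls `‖x - y‖²`.
    · refine abs_le_of_sq_le_sq' ?_ hΔ0.le |>.2
      calc (4 * (K * η) * (G * ‖x - y‖)) ^ 2
          = 16 * K ^ 2 * η ^ 2 * G ^ 2 * ‖x - y‖ ^ 2 := by ring
        _ ≤ 16 * K ^ 2 * η ^ 2 * G ^ 2 * (α * Δ) := by gcongr
        _ = (16 * G ^ 2 * α * K ^ 2 * η) * η * Δ := by ring
        _ ≤ Δ * 1 * Δ := by gcongr; linarith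
        _ = Δ ^ 2 := by ring
    · calc 16 * (K * η) * ∫ p, (Q.loss x p - Q.loss y p) ^ 2 ∂Q.μ
          ≤ 16 * (K * η) * (G * ‖x - y‖) ^ 2 := by
            gcongr
            exact hQ.integral_sq_le hG hx hy.1
        _ = 16 * G ^ 2 * (K * 1) * η * ‖x - y‖ ^ 2 := by ring
        _ ≤ 16 * G ^ 2 * (K * K) * η * (α * Δ) := by gcongr
        _ = (16 * G ^ 2 * α * K ^ 2 * η) * Δ := by ring
        _ ≤ Δ * Δ := by gcongr
        _ = Δ ^ 2 := by ring

/-! ### Fast rates for non-negative losses -/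

theorem Standing.integrable_sq_sub (hQ : Q.Standing) {G : ℝ} (hG : Q.LossLipschitz G)
    {x y : EuclideanSpace ℝ (Fin d)} (hx : x ∈ Q.W) (hy : y ∈ Q.W) :
    Integrable (fun p => (Q.loss x p - Q.loss y p) ^ 2) Q.μ := by
  have := hQ.isProbability
  refine Integrable.of_bound
    (((hQ.measurable_loss x).sub (hQ.measurable_loss y)).pow_const 2).aestronglyMeasurable
    ((G * ‖x - y‖) ^ 2) ?_
  filter_upwards [hG] with p hp
  rw [Real.norm_eq_abs, abs_pow]
  exact pow_le_pow_left₀ (abs_nonneg _) (hp x hx y hy) 2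

/-- A nonnegative quadratic function has a small gradient where its value is small. -/
theorem sq_inner_quadGrad_le {A : Matrix (Fin d) (Fin d) ℝ} {b : EuclideanSpace ℝ (Fin d)} {c : ℝ}
    (hf : ∀ x, 0 ≤ quad A b c x) (y h : EuclideanSpace ℝ (Fin d)) :
    ⟪quadGrad A b y, h⟫ ^ 2 ≤ 4 * quad A b c y * (‖A‖ * ‖h‖ ^ 2) := by
  -- The loss restricted to a whole line is a non-negative quadratic polynomial, so its discriminant
  -- is non-positive. This is where non-negativity outside `W` enters.
  have key : ∀ t : ℝ, 0 ≤ (h.ofLp ⬝ᵥ (A *ᵥ h.ofLp)) * (t * t) + ⟪quadGrad A b y, h⟫ * t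
      + quad A b c y := by
    intro t
    have := hf (y + t • h)
    rw [quad_add, inner_smul_right, dotProduct_mulVec_smul] at this
    linarith
  have h1 := discrim_le_zero key
  rw [discrim] at h1
  have h2 := (abs_le.1 (abs_dotProduct_mulVec_le A h h)).2
  have h3 := mul_le_mul_of_nonneg_left h2 (hf y)
  linarith

/-- For nonnegative quadratic losses, the second moment of the loss difference is controlled by
the risk of the comparator. -/
theorem Standing.integral_sq_le_of_nonneg (hQ : Q.Standing) {σ G : ℝ} (hσ : Q.BoundedBy σ)
    (hG : Q.LossLipschitz G) (hpos : ∀ᵐ p ∂Q.μ, ∀ x, 0 ≤ Q.loss x p)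
    {x y : EuclideanSpace ℝ (Fin d)} (hx : x ∈ Q.W) (hy : y ∈ Q.W) :
    ∫ p, (Q.loss x p - Q.loss y p) ^ 2 ∂Q.μ
      ≤ 8 * σ * Q.risk y * ‖x - y‖ ^ 2 + 2 * σ ^ 2 * (‖x - y‖ ^ 2) ^ 2 := by
  have := hQ.isProbability
  have h1 : ∫ p, (Q.loss x p - Q.loss y p) ^ 2 ∂Q.μ
      ≤ ∫ p, (8 * σ * ‖x - y‖ ^ 2 * Q.loss y p + 2 * σ ^ 2 * (‖x - y‖ ^ 2) ^ 2) ∂Q.μ := by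
    refine integral_mono_ae (hQ.integrable_sq_sub hG hx hy)
      (((hQ.integrable_loss y).const_mul _).add (integrable_const _)) ?_
    filter_upwards [hσ, hpos] with p hp hp0
    have hA := (le_max_left _ _).trans hp
    have h2 := sq_inner_quadGrad_le hp0 y (x - y)
    have h3 := abs_dotProduct_mulVec_le (Q.A p.1) (x - y) (x - y)
    have h4 := quad_sub (Q.A p.1) (Q.b p.2) Q.c x y
    have h5 : ‖Q.A p.1‖ * ‖x - y‖ ^ 2 ≤ σ * ‖x - y‖ ^ 2 := by gcongr
    have h6 : 4 * quad (Q.A p.1) (Q.b p.2) Q.c y * (‖Q.A p.1‖ * ‖x - y‖ ^ 2)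
        ≤ 4 * quad (Q.A p.1) (Q.b p.2) Q.c y * (σ * ‖x - y‖ ^ 2) :=
      mul_le_mul_of_nonneg_left h5 (mul_nonneg (by norm_num) (hp0 y))
    have h7 : ((x - y).ofLp ⬝ᵥ (Q.A p.1 *ᵥ (x - y).ofLp)) ^ 2 ≤ (σ * ‖x - y‖ ^ 2) ^ 2 := by
      rw [← sq_abs]
      refine pow_le_pow_left₀ (abs_nonneg _) (h3.trans ?_) 2
      rw [mul_assoc, ← sq]
      exact h5
    simp only [loss_eq_quad]
    rw [h4]
    -- `(a + b)² ≤ 2 a² + 2 b²` for the linear and quadratic parts of the loss difference.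
    nlinarith [sq_nonneg (⟪quadGrad (Q.A p.1) (Q.b p.2) y, x - y⟫
      - (x - y).ofLp ⬝ᵥ (Q.A p.1 *ᵥ (x - y).ofLp))]
  refine h1.trans (le_of_eq ?_)
  rw [integral_add ((hQ.integrable_loss y).const_mul _) (integrable_const _), integral_const_mul,
    hQ.integral_loss]
  simp
  ring

/-- The threshold for `(d log n + log (1/δ)) / n` in the fast rate for nonnegative losses. -/
noncomputable def fastThreshold (α σ R : ℝ) : ℝ := 1 / (64 * netFactor R * σ ^ 2 * α ^ 2 + 2)

/-- The constant in the fast rate for nonnegative losses. -/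
noncomputable def fastConst (α σ G R : ℝ) : ℝ :=
  (256 * σ * α + 16 * G ^ 2 * α) * netFactor R ^ 2 + 12 * G + 2 * G * R / fastThreshold α σ R ^ 2

/-- The two parts of the second moment each take half of `Δ²`: the part with `P_*` because `Δ`
exceeds `256 σ α K η P_*`, the fourth-order part because `η` is below `fastThreshold`. Above the
threshold the diameter bound is paid for by `2 G R / c²`. -/
theorem Standing.ermRate_of_nonneg (hQ : Q.Standing) {α σ G R : ℝ} (hE : EBC Q.W Q.risk 1 α)
    (hσ : Q.BoundedBy σ) (hG0 : 0 ≤ G) (hG : Q.LossLipschitz G) (hR : ∀ x ∈ Q.W, ‖x‖ ≤ R)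
    (hpos : ∀ᵐ p ∂Q.μ, ∀ x, 0 ≤ Q.loss x p) :
    ERMRate.{u, v, w} Q (fun n => 2 ≤ n)
      (fun n δ => fastConst α σ G R * (((d * Real.log n + Real.log (1 / δ)) / n) ^ 2
        + (d * Real.log n + Real.log (1 / δ)) * Q.optRisk / n)) := by
  have hα := hE.2.2.1
  have hK := one_le_netFactor R
  have hσ0 := hσ.nonneg hQ
  have hP : 0 ≤ Q.optRisk :=
    hQ.optRisk_nonneg (by filter_upwards [hpos] with p hp using fun x _ => hp x)
  obtain ⟨x₀, hx₀⟩ := hQ.nonempty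
  have hR0 : 0 ≤ R := (norm_nonneg _).trans (hR x₀ hx₀)
  set K := netFactor R with hKdef
  set P := Q.optRisk with hPdef
  set c := fastThreshold α σ R with hc
  have hcdef : c = 1 / (64 * K * σ ^ 2 * α ^ 2 + 2) := rfl
  have hden : 0 ≤ 64 * K * σ ^ 2 * α ^ 2 := by positivity
  have hc0 : 0 < c := by rw [hcdef]; positivity
  have hc2 : c ≤ 1 / 2 := by
    rw [hcdef]
    exact one_div_le_one_div_of_le two_pos (by linarith)
  set C₁ := 256 * σ * α + 16 * G ^ 2 * α with hC₁
  have hC₁0 : 0 ≤ C₁ := by positivity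
  have hC : fastConst α σ G R = C₁ * K ^ 2 + 12 * G + 2 * G * R / c ^ 2 := rfl
  have hquot : 0 ≤ 2 * G * R / c ^ 2 := by positivity
  have hC0 : 0 ≤ fastConst α σ G R := by
    rw [hC]
    positivity
  refine hQ.ermRate_of_comparators hG0 hG hR hc2 fun n δ η hn hδ hδ1 hη hη0 => ?_
  have e : (d * Real.log n + Real.log (1 / δ)) * P / n = η * P := by
    rw [hη]
    ring
  rw [e, ← hη]
  have hηP : 0 ≤ η * P := mul_nonneg hη0 hP
  refine ⟨mul_nonneg hC0 (by positivity), fun hη2 => ?_, fun hη2 =>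
    ⟨C₁ * K ^ 2 * (η ^ 2 + η * P), by positivity, ?_, fun x hx hτ => ?_⟩⟩
  · calc 2 * G * R = 2 * G * R / c ^ 2 * c ^ 2 := by field_simp
      _ ≤ 2 * G * R / c ^ 2 * (η ^ 2 + η * P) := by
        gcongr
        nlinarith
      _ ≤ _ := by
        gcongr
        rw [hC]
        have : 0 ≤ C₁ * K ^ 2 := by positivity
        linarith
  · rw [hC]
    have h1 : 0 ≤ 12 * G * (η * P) := by positivity
    have h2 : 0 ≤ 2 * G * R / c ^ 2 * (η ^ 2 + η * P) := by positivity
    linarith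
  · obtain ⟨y, hy, hxy⟩ := exists_comparator hE hx
    rw [← hKdef, ← hPdef] at *
    set Δ := Q.risk x - P with hΔ
    have hΔ0 : 0 < Δ := lt_of_le_of_lt (by positivity) hτ
    refine ⟨y, hy, ?_, ?_⟩
    · refine abs_le_of_sq_le_sq' ?_ hΔ0.le |>.2
      calc (4 * (K * η) * (G * ‖x - y‖)) ^ 2
          = 16 * K ^ 2 * η ^ 2 * G ^ 2 * ‖x - y‖ ^ 2 := by ring
        _ ≤ 16 * K ^ 2 * η ^ 2 * G ^ 2 * (α * Δ) := by gcongr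
        _ = (16 * G ^ 2 * α) * K ^ 2 * η ^ 2 * Δ := by ring
        _ ≤ C₁ * K ^ 2 * (η ^ 2 + η * P) * Δ := by
          gcongr
          · rw [hC₁]
            have : 0 ≤ 256 * σ * α := by positivity
            linarith
          · linarith
        _ ≤ Δ * Δ := by gcongr
        _ = Δ ^ 2 := by ring
    · have hrisk : Q.risk y = P := (optRisk_eq hy).symm
      have h1 := hQ.integral_sq_le_of_nonneg hσ hG hpos hx hy.1
      rw [hrisk] at h1
      have h2 : 8 * σ * P * ‖x - y‖ ^ 2 + 2 * σ ^ 2 * (‖x - y‖ ^ 2) ^ 2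
          ≤ 8 * σ * P * (α * Δ) + 2 * σ ^ 2 * (α * Δ) ^ 2 := by gcongr
      have h3 : 256 * σ * α * K * (η * P) ≤ Δ := by
        refine le_trans ?_ hτ.le
        have : 256 * σ * α * K * (η * P) ≤ C₁ * K ^ 2 * (η * P) := by
          gcongr
          · rw [hC₁]
            have : 0 ≤ 16 * G ^ 2 * α := by positivity
            linarith
          · nlinarith
        have : 0 ≤ C₁ * K ^ 2 * η ^ 2 := by positivity
        linarith
      have h4 : 64 * K * σ ^ 2 * α ^ 2 * η ≤ 1 := by
        have h5 : (64 * K * σ ^ 2 * α ^ 2 + 2) * η ≤ (64 * K * σ ^ 2 * α ^ 2 + 2) * c := by gcongr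
        rw [hcdef, mul_one_div_cancel (by positivity)] at h5
        linarith
      calc 16 * (K * η) * ∫ p, (Q.loss x p - Q.loss y p) ^ 2 ∂Q.μ
          ≤ 16 * (K * η) * (8 * σ * P * (α * Δ) + 2 * σ ^ 2 * (α * Δ) ^ 2) := by
            gcongr
            exact h1.trans h2
        _ = (256 * σ * α * K * (η * P)) / 2 * Δ + (64 * K * σ ^ 2 * α ^ 2 * η) / 2 * Δ ^ 2 := by
            ring
        _ ≤ Δ / 2 * Δ + 1 / 2 * Δ ^ 2 := by gcongr
        _ = Δ ^ 2 := by ring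

/-- A non-negative loss with zero mean vanishes almost surely, so the squared difference is `f(x)²`.
One factor is bounded by the Lipschitz property and the other integrates to the risk. -/
theorem Standing.integral_sq_le_of_nonneg_of_risk_eq_zero (hQ : Q.Standing) {G : ℝ}
    (hG : Q.LossLipschitz G) (hpos : ∀ᵐ p ∂Q.μ, ∀ x ∈ Q.W, 0 ≤ Q.loss x p)
    {x y : EuclideanSpace ℝ (Fin d)} (hx : x ∈ Q.W) (hy : y ∈ Q.W) (hy0 : Q.risk y = 0) :
    ∫ p, (Q.loss x p - Q.loss y p) ^ 2 ∂Q.μ ≤ G * ‖x - y‖ * Q.risk x := by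
  have hzero : ∀ᵐ p ∂Q.μ, Q.loss y p = 0 := by
    rw [← hQ.integral_loss, integral_eq_zero_iff_of_nonneg_ae
      (by filter_upwards [hpos] with p hp using hp y hy) (hQ.integrable_loss y)] at hy0
    filter_upwards [hy0] with p hp using hp
  rw [← hQ.integral_loss x, ← integral_const_mul]
  refine integral_mono_ae (hQ.integrable_sq_sub hG hx hy) ((hQ.integrable_loss x).const_mul _) ?_
  filter_upwards [hpos, hzero, hG] with p hp hp0 hpG
  have h1 := hp x hx
  have h2 := hpG x hx y hy
  rw [hp0, sub_zero, abs_of_nonneg h1] at h2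
  show (Q.loss x p - Q.loss y p) ^ 2 ≤ G * ‖x - y‖ * Q.loss x p
  rw [hp0, sub_zero, sq]
  gcongr

theorem Standing.ermRate_of_optRisk_eq_zero (hQ : Q.Standing) {α G R : ℝ}
    (hE : EBC Q.W Q.risk 1 α) (hG0 : 0 ≤ G) (hG : Q.LossLipschitz G)
    (hR : ∀ x ∈ Q.W, ‖x‖ ≤ R) (hpos : ∀ᵐ p ∂Q.μ, ∀ x ∈ Q.W, 0 ≤ Q.loss x p)
    (hP : Q.optRisk = 0) :
    ERMRate.{u, v, w} Q (fun n => 2 ≤ n)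
      (fun n δ => (256 * G ^ 2 * α * netFactor R ^ 2 + 12 * G + 8 * G * R)
        * ((d * Real.log n + Real.log (1 / δ)) / n) ^ 2) := by
  have hα := hE.2.2.1
  have hK := one_le_netFactor R
  obtain ⟨x₀, hx₀⟩ := hQ.nonempty
  have hR0 : 0 ≤ R := (norm_nonneg _).trans (hR x₀ hx₀)
  set K := netFactor R with hKdef
  refine hQ.ermRate_of_comparators hG0 hG hR le_rfl fun n δ η hn hδ hδ1 hη hη0 => ?_
  rw [← hη]
  refine ⟨by positivity, fun hη2 => ?_, fun hη2 =>
    ⟨256 * G ^ 2 * α * K ^ 2 * η ^ 2, by positivity, ?_, fun x hx hτ => ?_⟩⟩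
  · calc 2 * G * R ≤ 8 * G * R * η ^ 2 := by
          have : 1 / 4 ≤ η ^ 2 := by nlinarith
          nlinarith [mul_nonneg hG0 hR0]
      _ ≤ _ := by
        gcongr
        have : 0 ≤ 256 * G ^ 2 * α * K ^ 2 := by positivity
        linarith
  · have : 0 ≤ 8 * G * R * η ^ 2 := by positivity
    linarith
  · obtain ⟨y, hy, hxy⟩ := exists_comparator hE hx
    have h1 := hQ.integral_sq_le_of_nonneg_of_risk_eq_zero hG hpos hx hy.1
      (by rw [← optRisk_eq hy, hP])
    rw [hP, sub_zero] at *
    set Δ := Q.risk x with hΔ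
    have hΔ0 : 0 < Δ := lt_of_le_of_lt (by positivity) hτ
    have h2 : 16 * (K * η) * (G * ‖x - y‖) ≤ Δ := by
      refine abs_le_of_sq_le_sq' ?_ hΔ0.le |>.2
      calc (16 * (K * η) * (G * ‖x - y‖)) ^ 2
          = 256 * K ^ 2 * η ^ 2 * G ^ 2 * ‖x - y‖ ^ 2 := by ring
        _ ≤ 256 * K ^ 2 * η ^ 2 * G ^ 2 * (α * Δ) := by gcongr
        _ = 256 * G ^ 2 * α * K ^ 2 * η ^ 2 * Δ := by ring
        _ ≤ Δ * Δ := by gcongr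
        _ = Δ ^ 2 := by ring
    refine ⟨y, hy, ?_, ?_⟩
    · have : 0 ≤ 12 * (K * η) * (G * ‖x - y‖) := by positivity
      linarith
    · calc 16 * (K * η) * ∫ p, (Q.loss x p - Q.loss y p) ^ 2 ∂Q.μ
          ≤ 16 * (K * η) * (G * ‖x - y‖ * Δ) := by gcongr
        _ = 16 * (K * η) * (G * ‖x - y‖) * Δ := by ring
        _ ≤ Δ * Δ := by gcongr
        _ = Δ ^ 2 := by ring

end QuadProblem

/-! Deviations of sums along adapted sequences -/

section Adapted

variable {Ω : Type w} {X : Type*} [mX : MeasurableSpace X]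

/-- The σ-algebra generated by the first `N` samples. -/
abbrev samplePast (ξ : ℕ → Ω → X) (N : ℕ) : MeasurableSpace Ω :=
  ⨆ i ∈ Set.Iio N, MeasurableSpace.comap (ξ i) mX

theorem samplePast_mono (ξ : ℕ → Ω → X) {M N : ℕ} (h : M ≤ N) :
    samplePast ξ M ≤ samplePast ξ N :=
  biSup_mono fun _ hi => lt_of_lt_of_le hi h

theorem measurable_samplePast (ξ : ℕ → Ω → X) {M N : ℕ} (h : M < N) :
    Measurable[samplePast ξ N] (ξ M) := by
  have h1 : MeasurableSpace.comap (ξ M) mX ≤ samplePast ξ N :=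
    le_biSup (fun i => MeasurableSpace.comap (ξ i) mX) (show M ∈ Set.Iio N from h)
  exact (comap_measurable (ξ M)).mono h1 le_rfl

variable [mΩ : MeasurableSpace Ω] {Pr : Measure Ω} {μ : Measure X} {ξ : ℕ → Ω → X}

theorem IsIIDSample.samplePast_le (h : IsIIDSample Pr μ ξ) (N : ℕ) : samplePast ξ N ≤ mΩ :=
  iSup₂_le fun i _ => (h.measurable i).comap_le

/-- Disjoint blocks of an independent family generate independent σ-algebras. -/
theorem IsIIDSample.indepFun_past (h : IsIIDSample Pr μ ξ) {S : Type*} [MeasurableSpace S] {N : ℕ}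
    {V : Ω → S} (hV : Measurable[samplePast ξ N] V) : IndepFun V (ξ N) Pr := by
  have h1 := indep_iSup_of_disjoint (fun i => (h.measurable i).comap_le) h.indep.iIndep
    (S := Set.Iio N) (T := {N}) (by simp)
  rw [IndepFun_iff_Indep]
  refine indep_of_indep_of_le_left (indep_of_indep_of_le_right h1 ?_) hV.comap_le
  simp

/-- The substitute for conditioning on the past: the joint law is a product, so the fresh sample is
integrated out by Tonelli, without integrability conditions. -/
theorem IsIIDSample.lintegral_past (h : IsIIDSample Pr μ ξ) {S : Type*} [MeasurableSpace S] {N : ℕ}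
    {V : Ω → S} (hV : Measurable[samplePast ξ N] V) {F : S → X → ENNReal}
    (hF : Measurable (Function.uncurry F)) :
    ∫⁻ ω, F (V ω) (ξ N ω) ∂Pr = ∫⁻ ω, ∫⁻ p, F (V ω) p ∂μ ∂Pr := by
  have hPr : IsProbabilityMeasure Pr := h.indep.isProbabilityMeasure
  have hV' : Measurable V := hV.mono (h.samplePast_le N) le_rfl
  have hμ : IsProbabilityMeasure μ := by
    rw [← h.law 0]
    exact Measure.isProbabilityMeasure_map (h.measurable 0).aemeasurable
  have hprod := (indepFun_iff_map_prod_eq_prod_map_map hV'.aemeasurable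
    (h.measurable N).aemeasurable).1 (h.indepFun_past hV)
  rw [h.law N] at hprod
  have h1 : ∫⁻ ω, F (V ω) (ξ N ω) ∂Pr
      = ∫⁻ z, Function.uncurry F z ∂(Pr.map fun ω => (V ω, ξ N ω)) :=
    (lintegral_map hF (hV'.prodMk (h.measurable N))).symm
  rw [h1, hprod, lintegral_prod _ hF.aemeasurable,
    lintegral_map (hF.lintegral_prod_right' (f := Function.uncurry F)) hV']
  rfl

/-- Hoeffding's lemma on the interval `[-c, c]`. -/
theorem lintegral_exp_le_of_bounded [IsProbabilityMeasure μ] {g : X → ℝ} (hg : Measurable g) {c : ℝ}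
    (hc : 0 ≤ c) (hb : ∀ᵐ p ∂μ, |g p| ≤ c) (h0 : ∫ p, g p ∂μ = 0) (l : ℝ) :
    ∫⁻ p, ENNReal.ofReal (Real.exp (l * g p)) ∂μ
      ≤ ENNReal.ofReal (Real.exp (c ^ 2 * l ^ 2 / 2)) := by
  have h := hasSubgaussianMGF_of_mem_Icc_of_integral_eq_zero (a := -c) (b := c) hg.aemeasurable
    (by filter_upwards [hb] with p hp using abs_le.1 hp) h0
  rw [← ofReal_integral_eq_lintegral_ofReal (h.integrable_exp_mul l)
    (Filter.Eventually.of_forall fun p => (Real.exp_pos _).le)]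
  refine ENNReal.ofReal_le_ofReal ((h.mgf_le l).trans (le_of_eq ?_))
  congr 3
  push_cast
  rw [Real.norm_eq_abs, sub_neg_eq_add, abs_of_nonneg (by linarith)]
  ring

/-- The exponential moments of a sum of bounded centered increments along an adapted sequence. -/
theorem IsIIDSample.lintegral_exp_sum_le (h : IsIIDSample Pr μ ξ) {S : Type*} [MeasurableSpace S]
    {D : S → X → ℝ} (hD : Measurable (Function.uncurry D)) {c : ℝ} (hc : 0 ≤ c) {T : Set S}
    (hb : ∀ a ∈ T, ∀ᵐ p ∂μ, |D a p| ≤ c) (h0 : ∀ a ∈ T, ∫ p, D a p ∂μ = 0) (s : ℕ)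
    {U : ℕ → Ω → S} (hU : ∀ t, Measurable[samplePast ξ (s + t)] (U t)) (hUT : ∀ t ω, U t ω ∈ T)
    (l : ℝ) (N : ℕ) :
    ∫⁻ ω, ENNReal.ofReal (Real.exp (l * ∑ t ∈ Finset.range N, D (U t ω) (ξ (s + t) ω))) ∂Pr
      ≤ ENNReal.ofReal (Real.exp (N * (c ^ 2 * l ^ 2 / 2))) := by
  have hPr : IsProbabilityMeasure Pr := h.indep.isProbabilityMeasure
  have hμ : IsProbabilityMeasure μ := by
    rw [← h.law 0]
    exact Measure.isProbabilityMeasure_map (h.measurable 0).aemeasurable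
  induction N with
  | zero => simp
  | succ N ih =>
    have hsum : Measurable[samplePast ξ (s + N)]
        fun ω => ∑ t ∈ Finset.range N, D (U t ω) (ξ (s + t) ω) := by
      refine Finset.measurable_fun_sum _ fun t ht => ?_
      have ht' := Finset.mem_range.1 ht
      have h1 : Measurable[samplePast ξ (s + N)] (U t) :=
        (hU t).mono (samplePast_mono ξ (by omega)) le_rfl
      have h2 : Measurable[samplePast ξ (s + N)] (ξ (s + t)) :=
        measurable_samplePast ξ (by omega)
      exact hD.comp (Measurable.prodMk h1 h2)
    -- The partial sum and the next state together form the past; only the last increment meets a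
    -- fresh sample.
    have hV : Measurable[samplePast ξ (s + N)]
        fun ω => (∑ t ∈ Finset.range N, D (U t ω) (ξ (s + t) ω), U N ω) :=
      Measurable.prodMk hsum (hU N)
    have hF : Measurable (Function.uncurry fun (z : ℝ × S) (p : X) =>
        ENNReal.ofReal (Real.exp (l * z.1)) * ENNReal.ofReal (Real.exp (l * D z.2 p))) := by
      have hD' : Measurable fun q : (ℝ × S) × X => D q.1.2 q.2 :=
        hD.comp ((measurable_snd.comp measurable_fst).prodMk measurable_snd)
      have hz : Measurable fun q : (ℝ × S) × X => q.1.1 := measurable_fst.comp measurable_fst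
      exact ((hz.const_mul l).exp.ennreal_ofReal).mul ((hD'.const_mul l).exp.ennreal_ofReal)
    calc ∫⁻ ω, ENNReal.ofReal
          (Real.exp (l * ∑ t ∈ Finset.range (N + 1), D (U t ω) (ξ (s + t) ω))) ∂Pr
        = ∫⁻ ω, ENNReal.ofReal (Real.exp (l * ∑ t ∈ Finset.range N, D (U t ω) (ξ (s + t) ω)))
            * ENNReal.ofReal (Real.exp (l * D (U N ω) (ξ (s + N) ω))) ∂Pr := by
          refine lintegral_congr fun ω => ?_
          rw [Finset.sum_range_succ, mul_add, Real.exp_add,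
            ENNReal.ofReal_mul (Real.exp_pos _).le]
      _ = ∫⁻ ω, ∫⁻ p, ENNReal.ofReal
            (Real.exp (l * ∑ t ∈ Finset.range N, D (U t ω) (ξ (s + t) ω)))
            * ENNReal.ofReal (Real.exp (l * D (U N ω) p)) ∂μ ∂Pr := h.lintegral_past hV hF
      _ ≤ ∫⁻ ω, ENNReal.ofReal (Real.exp (l * ∑ t ∈ Finset.range N, D (U t ω) (ξ (s + t) ω)))
            * ENNReal.ofReal (Real.exp (c ^ 2 * l ^ 2 / 2)) ∂Pr := by
          refine lintegral_mono fun ω => ?_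
          have hDU : Measurable (D (U N ω)) := hD.comp measurable_prodMk_left
          rw [lintegral_const_mul _ ((hDU.const_mul l).exp.ennreal_ofReal)]
          gcongr
          exact lintegral_exp_le_of_bounded hDU hc (hb _ (hUT N ω)) (h0 _ (hUT N ω)) l
      _ = (∫⁻ ω, ENNReal.ofReal (Real.exp (l * ∑ t ∈ Finset.range N, D (U t ω) (ξ (s + t) ω))) ∂Pr)
            * ENNReal.ofReal (Real.exp (c ^ 2 * l ^ 2 / 2)) := by
          refine lintegral_mul_const _ ?_
          exact ((hsum.mono (h.samplePast_le _) le_rfl).const_mul l).exp.ennreal_ofReal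
      _ ≤ ENNReal.ofReal (Real.exp (N * (c ^ 2 * l ^ 2 / 2)))
            * ENNReal.ofReal (Real.exp (c ^ 2 * l ^ 2 / 2)) := by gcongr
      _ = _ := by
          rw [← ENNReal.ofReal_mul (Real.exp_pos _).le, ← Real.exp_add]
          congr 2
          push_cast
          ring

/-- The **Azuma-Hoeffding inequality** along an adapted sequence. -/
theorem IsIIDSample.measure_sum_gt_le (h : IsIIDSample Pr μ ξ) {S : Type*} [MeasurableSpace S]
    {D : S → X → ℝ} (hD : Measurable (Function.uncurry D)) {c : ℝ} (hc : 0 < c) {T : Set S}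
    (hb : ∀ a ∈ T, ∀ᵐ p ∂μ, |D a p| ≤ c) (h0 : ∀ a ∈ T, ∫ p, D a p ∂μ = 0) (s : ℕ)
    {U : ℕ → Ω → S} (hU : ∀ t, Measurable[samplePast ξ (s + t)] (U t)) (hUT : ∀ t ω, U t ω ∈ T)
    (N : ℕ) {ℓ : ℝ} (hℓ : 0 ≤ ℓ) :
    Pr {ω | c * Real.sqrt (2 * ((N + 1) * ℓ)) < ∑ t ∈ Finset.range N, D (U t ω) (ξ (s + t) ω)}
      ≤ ENNReal.ofReal (Real.exp (-ℓ)) := by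
  have hN : (0 : ℝ) < N + 1 := by positivity
  set q := Real.sqrt (2 * ((N + 1) * ℓ)) with hq
  have hq2 : q ^ 2 = 2 * ((N + 1) * ℓ) := Real.sq_sqrt (by positivity)
  -- Chernoff's parameter, with `N + 1` in place of `N` to cover the empty sum: the moment bound
  -- costs at most `ℓ` and the threshold gains `2 ℓ`.
  set l := q / (c * (N + 1)) with hl
  have hl0 : 0 ≤ l := by positivity
  have hlq : l * (c * q) = 2 * ℓ := by
    rw [hl]
    field_simp
    rw [hq2]
    ring
  have hl2 : N * (c ^ 2 * l ^ 2 / 2) ≤ ℓ := by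
    have : c ^ 2 * l ^ 2 / 2 = ℓ / (N + 1) := by
      rw [hl, div_pow, hq2]
      field_simp
    rw [this, mul_div_assoc', div_le_iff₀ hN]
    nlinarith
  have hmain := h.lintegral_exp_sum_le hD hc.le hb h0 s hU hUT l N
  have hmeas : Measurable fun ω => ∑ t ∈ Finset.range N, D (U t ω) (ξ (s + t) ω) := by
    refine Finset.measurable_fun_sum _ fun t _ => ?_
    have h1 : Measurable (U t) := (hU t).mono (h.samplePast_le _) le_rfl
    exact hD.comp (h1.prodMk (h.measurable _))
  have hMarkov := meas_ge_le_lintegral_div (μ := Pr)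
    (f := fun ω => ENNReal.ofReal (Real.exp (l * ∑ t ∈ Finset.range N, D (U t ω) (ξ (s + t) ω))))
    (hmeas.const_mul l).exp.ennreal_ofReal.aemeasurable
    (ε := ENNReal.ofReal (Real.exp (2 * ℓ))) (by simp [Real.exp_pos]) ENNReal.ofReal_ne_top
  refine (measure_mono fun ω hω => ?_).trans (hMarkov.trans ?_)
  · refine ENNReal.ofReal_le_ofReal (Real.exp_le_exp.2 ?_)
    rw [← hlq]
    exact mul_le_mul_of_nonneg_left (le_of_lt hω) hl0
  · refine (ENNReal.div_le_div_right hmain _).trans ?_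
    rw [← ENNReal.ofReal_div_of_pos (Real.exp_pos _), ← Real.exp_sub]
    exact ENNReal.ofReal_le_ofReal (Real.exp_le_exp.2 (by linarith))

end Adapted

/-! Continuity of projections -/

section ProjContinuity

variable {d : ℕ}

/-- Projections onto convex sets depend Hölder continuously on the point and on the set. -/
theorem IsClosest.norm_sub_sq_le {K K' : Set (EuclideanSpace ℝ (Fin d))} (hK : Convex ℝ K)
    (hK' : Convex ℝ K') {w w' y y' : EuclideanSpace ℝ (Fin d)} (h : IsClosest K w y)
    (h' : IsClosest K' w' y') {η : ℝ} (hη : ∃ v ∈ K, ‖v - y'‖ ≤ η) (hη' : ∃ v ∈ K', ‖v - y‖ ≤ η) :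
    ‖y - y'‖ ^ 2 ≤ ‖w - w'‖ * ‖y - y'‖ + η * (‖w - y‖ + ‖w' - y'‖) := by
  obtain ⟨v, hv, hvη⟩ := hη
  obtain ⟨v', hv', hvη'⟩ := hη'
  -- The variational inequality of each projection is tested near the other projection, at the price
  -- `η` since the sets differ; their sum is the usual non-expansiveness estimate.
  have h1 := h.inner_le_zero hK hv
  have h2 := h'.inner_le_zero hK' hv'
  have e1 : v - y = (v - y') - (y - y') := by abel
  have e2 : v' - y' = (v' - y) + (y - y') := by abel
  rw [e1, inner_sub_right] at h1
  rw [e2, inner_add_right] at h2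
  have h3 : |⟪w - y, v - y'⟫| ≤ ‖w - y‖ * η :=
    (abs_real_inner_le_norm _ _).trans (by gcongr)
  have h4 : |⟪w' - y', v' - y⟫| ≤ ‖w' - y'‖ * η :=
    (abs_real_inner_le_norm _ _).trans (by gcongr)
  have h5 := real_inner_le_norm (w - w') (y - y')
  have h6 : ⟪w' - y', y - y'⟫ - ⟪w - y, y - y'⟫ = ‖y - y'‖ ^ 2 - ⟪w - w', y - y'⟫ := by
    rw [← inner_sub_left, ← real_inner_self_eq_norm_sq, ← inner_sub_left]
    congr 1
    abel
  have h7 := (abs_le.1 h3).1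
  have h8 := (abs_le.1 h4).1
  linarith

theorem continuous_proj {K : Set (EuclideanSpace ℝ (Fin d))} (hc : IsClosed K) (hK : Convex ℝ K)
    (hne : K.Nonempty) : Continuous (proj K) := by
  refine LipschitzWith.continuous (K := 1) (LipschitzWith.of_dist_le_mul fun w w' => ?_)
  rw [dist_eq_norm, dist_eq_norm, NNReal.coe_one, one_mul]
  have h := proj_isClosest hc hne w
  have h' := proj_isClosest hc hne w'
  have := h.norm_sub_sq_le hK hK h' (η := 0) ⟨_, h'.1, by simp⟩ ⟨_, h.1, by simp⟩
  rw [zero_mul, add_zero, sq] at this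
  by_contra hlt
  push Not at hlt
  have h0 := (norm_nonneg (w - w')).trans_lt hlt
  exact absurd (le_of_mul_le_mul_right this h0) (not_le.2 hlt)

/-- Moving `y'` towards `x` by the fraction `η / (r + η)`, where `η = ‖x - x'‖`, brings it into the
new ball, and convexity keeps it in `W`. -/
theorem exists_mem_inter_closedBall {W : Set (EuclideanSpace ℝ (Fin d))} (hW : Convex ℝ W) {r : ℝ}
    (hr : 0 < r) {x x' y' : EuclideanSpace ℝ (Fin d)} (hx : x ∈ W)
    (hy' : y' ∈ W ∩ Metric.closedBall x' r) :
    ∃ v ∈ W ∩ Metric.closedBall x r, ‖v - y'‖ ≤ 2 * ‖x - x'‖ := by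
  have hy2 : ‖y' - x'‖ ≤ r := by
    have := hy'.2
    rwa [Metric.mem_closedBall, dist_eq_norm] at this
  have hxy : ‖y' - x‖ ≤ r + ‖x - x'‖ := by
    have : y' - x = (y' - x') - (x - x') := by abel
    rw [this]
    exact (norm_sub_le _ _).trans (by gcongr)
  have hη := norm_nonneg (x - x')
  set η := ‖x - x'‖
  refine ⟨y' + (η / (r + η)) • (x - y'), ⟨hW.add_smul_sub_mem hy'.1 hx
    ⟨by positivity, div_le_one_of_le₀ (by linarith) (by linarith)⟩, ?_⟩, ?_⟩
  · rw [Metric.mem_closedBall, dist_eq_norm]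
    have e : y' + (η / (r + η)) • (x - y') - x = (r / (r + η)) • (y' - x) := by
      have : r / (r + η) = 1 - η / (r + η) := by field_simp; ring
      rw [this]
      module
    rw [e, norm_smul, Real.norm_eq_abs, abs_of_nonneg (by positivity), div_mul_eq_mul_div,
      div_le_iff₀ (by linarith)]
    gcongr
  · rw [add_sub_cancel_left, norm_smul, Real.norm_eq_abs, abs_of_nonneg (by positivity),
      norm_sub_rev]
    calc η / (r + η) * ‖y' - x‖ ≤ η / (r + η) * (r + η) := by gcongr
      _ = η := by field_simp
      _ ≤ 2 * η := by linarith

theorem isClosed_inter_closedBall {W : Set (EuclideanSpace ℝ (Fin d))} (hc : IsClosed W) {r : ℝ}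
    (x : EuclideanSpace ℝ (Fin d)) : IsClosed (W ∩ Metric.closedBall x r) :=
  hc.inter Metric.isClosed_closedBall

/-- Joint continuity in center and point, needed because the feasible set of a stage is random.
Replacing the center by `proj W z.1` makes all these sets nonempty without changing centers in `W`.
-/
theorem continuous_proj_inter_closedBall {W : Set (EuclideanSpace ℝ (Fin d))} (hc : IsClosed W)
    (hW : Convex ℝ W) (hne : W.Nonempty) (hbd : Bornology.IsBounded W) {r : ℝ} (hr : 0 < r) :
    Continuous fun z : EuclideanSpace ℝ (Fin d) × EuclideanSpace ℝ (Fin d) =>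
      proj (W ∩ Metric.closedBall (proj W z.1) r) z.2 := by
  obtain ⟨R, hR⟩ := hbd.exists_norm_le
  have hpc := continuous_proj hc hW hne
  have hmem : ∀ x, proj W x ∈ W := fun x => (proj_isClosest hc hne x).1
  have hcl : ∀ z : EuclideanSpace ℝ (Fin d) × EuclideanSpace ℝ (Fin d),
      IsClosest (W ∩ Metric.closedBall (proj W z.1) r) z.2
        (proj (W ∩ Metric.closedBall (proj W z.1) r) z.2) := fun z =>
    proj_isClosest (isClosed_inter_closedBall hc _)
      ⟨proj W z.1, hmem _, Metric.mem_closedBall_self hr.le⟩ _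
  set f := fun z : EuclideanSpace ℝ (Fin d) × EuclideanSpace ℝ (Fin d) =>
      proj (W ∩ Metric.closedBall (proj W z.1) r) z.2 with hf
  rw [continuous_iff_continuousAt]
  intro z₀
  have hbound : ∀ z, ‖f z - f z₀‖ ^ 2 ≤ ‖z.2 - z₀.2‖ * (R + R)
      + 2 * ‖proj W z.1 - proj W z₀.1‖ * ((‖z.2‖ + R) + (‖z₀.2‖ + R)) := by
    intro z
    have hconv : ∀ x : EuclideanSpace ℝ (Fin d), Convex ℝ (W ∩ Metric.closedBall x r) :=
      fun x => hW.inter (convex_closedBall x r)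
    have h1 := (hcl z).norm_sub_sq_le (hconv _) (hconv _) (hcl z₀)
      (η := 2 * ‖proj W z.1 - proj W z₀.1‖)
      (exists_mem_inter_closedBall hW hr (hmem _) (hcl z₀).1)
      (by
        rw [norm_sub_rev]
        exact exists_mem_inter_closedBall hW hr (hmem _) (hcl z).1)
    refine h1.trans ?_
    have h2 := hR _ (hcl z).1.1
    have h3 := hR _ (hcl z₀).1.1
    gcongr
    · exact (norm_sub_le _ _).trans (add_le_add h2 h3)
    · exact (norm_sub_le _ _).trans (by gcongr)
    · exact (norm_sub_le _ _).trans (by gcongr)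
  have hlim : Filter.Tendsto (fun z : EuclideanSpace ℝ (Fin d) × EuclideanSpace ℝ (Fin d) =>
      Real.sqrt (‖z.2 - z₀.2‖ * (R + R)
        + 2 * ‖proj W z.1 - proj W z₀.1‖ * ((‖z.2‖ + R) + (‖z₀.2‖ + R)))) (nhds z₀) (nhds 0) := by
    have hcont : Continuous fun z : EuclideanSpace ℝ (Fin d) × EuclideanSpace ℝ (Fin d) =>
        Real.sqrt (‖z.2 - z₀.2‖ * (R + R)
          + 2 * ‖proj W z.1 - proj W z₀.1‖ * ((‖z.2‖ + R) + (‖z₀.2‖ + R))) := by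
      have := hpc.comp (continuous_fst (X := EuclideanSpace ℝ (Fin d))
        (Y := EuclideanSpace ℝ (Fin d)))
      simp only [Function.comp_def] at this
      fun_prop
    have := hcont.tendsto z₀
    simpa using this
  rw [ContinuousAt, tendsto_iff_norm_sub_tendsto_zero]
  exact squeeze_zero (fun z => norm_nonneg _) (fun z => Real.le_sqrt_of_sq_le (hbound z)) hlim

end ProjContinuity

/-! The projected stochastic gradient method -/

section ProjectedStep

variable {d : ℕ}

/-- One projected gradient step, where the gradient is only bounded in feasible directions. -/
theorem norm_projected_step_sq_le {K : Set (EuclideanSpace ℝ (Fin d))} (hK : Convex ℝ K) {G γ : ℝ}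
    (hγ : 0 ≤ γ) {u u' y g : EuclideanSpace ℝ (Fin d)} (hu' : IsClosest K (u - γ • g) u')
    (hy : y ∈ K) (hg : |⟪g, u' - u⟫| ≤ G * ‖u' - u‖) :
    ‖u' - y‖ ^ 2 ≤ ‖u - y‖ ^ 2 - 2 * γ * ⟪g, u - y⟫ + γ ^ 2 * G ^ 2 := by
  have h1 := hu'.inner_le_zero hK hy
  have e : u - γ • g - u' = (u - u') - γ • g := by abel
  rw [e, inner_sub_left, real_inner_smul_left] at h1
  have h2 : ‖u - y‖ ^ 2 = ‖u' - u‖ ^ 2 - 2 * ⟪u - u', y - u'⟫ + ‖u' - y‖ ^ 2 := by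
    have : u - y = (u - u') - (y - u') := by abel
    rw [this, norm_sub_sq_real, norm_sub_rev u u', norm_sub_rev y u']
  have h3 : ⟪g, y - u'⟫ = -⟪g, u - y⟫ - ⟪g, u' - u⟫ := by
    rw [← inner_neg_right, ← inner_sub_right]
    congr 1
    abel
  have h4 := mul_le_mul_of_nonneg_left (abs_le.1 hg).1 hγ
  rw [h3] at h1
  -- `2 γ G ‖u' - u‖ ≤ ‖u' - u‖² + γ² G²`. Only `⟪g, u' - u⟫` is estimated: a loss that is Lipschitz
  -- on a lower-dimensional `W` may have a large gradient across it.
  nlinarith [sq_nonneg (‖u' - u‖ - γ * G)]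

end ProjectedStep

namespace QuadProblem

variable {d : ℕ} {Z : Type u} {Z' : Type v} [MeasurableSpace Z] [MeasurableSpace Z']
  {Q : QuadProblem d Z Z'}

theorem ssgIter_mem {K : Set (EuclideanSpace ℝ (Fin d))} (hc : IsClosed K) {γ : ℝ}
    {x : EuclideanSpace ℝ (Fin d)} (hx : x ∈ K) (s : ℕ → Z × Z') (t : ℕ) :
    Q.ssgIter K γ x s t ∈ K := by
  cases t with
  | zero => exact hx
  | succ t => exact (proj_isClosest hc ⟨x, hx⟩ _).1

theorem ssg_mem {K : Set (EuclideanSpace ℝ (Fin d))} (hc : IsClosed K) (hK : Convex ℝ K) {γ : ℝ}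
    {x : EuclideanSpace ℝ (Fin d)} (hx : x ∈ K) (s : ℕ → Z × Z') (N : ℕ) :
    Q.ssg x γ N K s ∈ K := by
  rw [ssg, Finset.smul_sum]
  refine hK.sum_mem (fun _ _ => by positivity) ?_ fun t _ => ssgIter_mem hc hx s t
  rw [Finset.sum_const, Finset.card_range, nsmul_eq_mul]
  push_cast
  field_simp

/-- The difference between the directional derivatives of the risk and of the loss at a sample, at
`a.1` in the direction `a.1 - a.2`. -/
noncomputable def gradNoise (Q : QuadProblem d Z Z')
    (a : EuclideanSpace ℝ (Fin d) × EuclideanSpace ℝ (Fin d)) (p : Z × Z') : ℝ :=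
  ⟪quadGrad Q.meanA Q.meanb a.1, a.1 - a.2⟫ - ⟪quadGrad (Q.A p.1) (Q.b p.2) a.1, a.1 - a.2⟫

/-- The one-step inequality telescopes. -/
theorem Standing.sum_inner_grad_le (hQ : Q.Standing) {G γ : ℝ} (hγ : 0 ≤ γ)
    {K : Set (EuclideanSpace ℝ (Fin d))} (hc : IsClosed K) (hK : Convex ℝ K) (hKW : K ⊆ Q.W)
    {x y : EuclideanSpace ℝ (Fin d)} (hx : x ∈ K) (hy : y ∈ K) {s : ℕ → Z × Z'}
    (hs : ∀ t, ∀ x ∈ Q.W, ∀ y ∈ Q.W, |Q.loss x (s t) - Q.loss y (s t)| ≤ G * ‖x - y‖) (N : ℕ) :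
    ‖Q.ssgIter K γ x s N - y‖ ^ 2 + 2 * γ * ∑ t ∈ Finset.range N,
      ⟪quadGrad (Q.A (s t).1) (Q.b (s t).2) (Q.ssgIter K γ x s t), Q.ssgIter K γ x s t - y⟫
      ≤ ‖x - y‖ ^ 2 + N * (γ ^ 2 * G ^ 2) := by
  induction N with
  | zero => simp [ssgIter]
  | succ N ih =>
    have hmem := fun t => ssgIter_mem (Q := Q) hc hx (γ := γ) s t
    have hstep := norm_projected_step_sq_le hK hγ (G := G) (y := y)
      (g := quadGrad (Q.A (s N).1) (Q.b (s N).2) (Q.ssgIter K γ x s N))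
      (u := Q.ssgIter K γ x s N) (u' := Q.ssgIter K γ x s (N + 1))
      (by
        have := proj_isClosest hc ⟨x, hx⟩ (Q.ssgIter K γ x s N
          - γ • gradient (fun y => Q.loss y (s N)) (Q.ssgIter K γ x s N))
        rw [← gradient_loss]
        exact this)
      hy (abs_inner_quadGrad_le_of_lipschitz hQ.convex_W (hs N) (hKW (hmem N))
        (hKW (hmem (N + 1))))
    rw [Finset.sum_range_succ, mul_add]
    push_cast
    linarith

/-- Regret bound, convexity of the risk and Jensen's inequality for the average. The step size
balances `r²` against `γ² G² (N + 1)`. Of the factor `3`, the regret takes `1` and the last iterate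
`2`. -/
theorem Standing.risk_ssg_sub_le (hQ : Q.Standing) {G r : ℝ} (hr : 0 < r) (hG0 : 0 < G)
    (hG : Q.LossLipschitz G) {x y : EuclideanSpace ℝ (Fin d)} (hx : x ∈ Q.W)
    (hy : y ∈ Q.W ∩ Metric.closedBall x r) {s : ℕ → Z × Z'}
    (hs : ∀ t, ∀ x ∈ Q.W, ∀ y ∈ Q.W, |Q.loss x (s t) - Q.loss y (s t)| ≤ G * ‖x - y‖) (N : ℕ) :
    ((N : ℝ) + 1) * (Q.risk (Q.ssg x (r / (G * Real.sqrt ((N : ℝ) + 1))) N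
      (Q.W ∩ Metric.closedBall x r) s) - Q.risk y) ≤
      3 * (G * r * Real.sqrt ((N : ℝ) + 1)) + ∑ t ∈ Finset.range N, Q.gradNoise
        (Q.ssgIter (Q.W ∩ Metric.closedBall x r) (r / (G * Real.sqrt ((N : ℝ) + 1))) x s t, y)
        (s t) := by
  set K := Q.W ∩ Metric.closedBall x r with hKdef
  set q := Real.sqrt ((N : ℝ) + 1) with hq
  have hN1 : (1 : ℝ) ≤ N + 1 := by have := Nat.cast_nonneg (α := ℝ) N; linarith
  have hq1 : 1 ≤ q := Real.one_le_sqrt.2 hN1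
  have hq2 : q ^ 2 = N + 1 := Real.sq_sqrt (by positivity)
  set γ := r / (G * q) with hγ
  have hγ0 : 0 < γ := by positivity
  have hc : IsClosed K := isClosed_inter_closedBall hQ.isClosed_W x
  have hK : Convex ℝ K := hQ.convex_W.inter (convex_closedBall x r)
  have hxK : x ∈ K := ⟨hx, Metric.mem_closedBall_self hr.le⟩
  have hmem := fun t => ssgIter_mem (Q := Q) hc hxK (γ := γ) s t
  set U := Q.ssgIter K γ x s with hU
  set ū := Q.ssg x γ N K s with hū
  have hball : ∀ z ∈ K, ‖z - x‖ ≤ r := fun z hz => by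
    have := hz.2
    rwa [Metric.mem_closedBall, dist_eq_norm] at this
  have hconv : ∀ t, Q.risk (U t) - Q.risk y ≤ ⟪quadGrad Q.meanA Q.meanb (U t), U t - y⟫ := by
    intro t
    have := inner_quadGrad_le_of_posSemidef (b := Q.meanb) (c := Q.c) y (U t) hQ.posSemidef
    rw [risk_eq_quad]
    rw [← neg_sub (U t) y, inner_neg_right] at this
    linarith
  have hjensen : ((N : ℝ) + 1) * (Q.risk ū - Q.risk y)
      ≤ ∑ t ∈ Finset.range (N + 1), (Q.risk (U t) - Q.risk y) := by
    have h1 : ∑ t ∈ Finset.range (N + 1), ⟪quadGrad Q.meanA Q.meanb ū, U t - ū⟫ = 0 := by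
      rw [← inner_sum, Finset.sum_sub_distrib, Finset.sum_const, Finset.card_range,
        ← Nat.cast_smul_eq_nsmul ℝ, hū, ssg, ← hU, smul_smul]
      push_cast
      rw [mul_one_div_cancel (by positivity), one_smul, sub_self, inner_zero_right]
    have h2 : ∑ t ∈ Finset.range (N + 1), ⟪quadGrad Q.meanA Q.meanb ū, U t - ū⟫
        ≤ ∑ t ∈ Finset.range (N + 1), (Q.risk (U t) - Q.risk ū) :=
      Finset.sum_le_sum fun t _ => inner_quadGrad_le_of_posSemidef _ _ hQ.posSemidef
    rw [h1] at h2
    simp only [Finset.sum_sub_distrib, Finset.sum_const, Finset.card_range, nsmul_eq_mul] at h2 ⊢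
    push_cast at h2 ⊢
    linarith
  -- The average has `N + 1` iterates but only `N` gradients are sampled; the last iterate is
  -- handled by the Lipschitz bound and the diameter of the ball.
  have hlast : Q.risk (U N) - Q.risk y ≤ 2 * (G * r) := by
    have h1 := (abs_le.1 (hQ.abs_risk_sub_le hG (hmem N).1 hy.1)).2
    have h2 : ‖U N - y‖ ≤ r + r := by
      have : U N - y = (U N - x) - (y - x) := by abel
      rw [this]
      exact (norm_sub_le _ _).trans (add_le_add (hball _ (hmem N)) (hball _ hy))
    have h3 := mul_le_mul_of_nonneg_left h2 hG0.le
    linarith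
  have hreg := hQ.sum_inner_grad_le hγ0.le hc hK Set.inter_subset_left hxK hy hs N
  rw [← hU] at hreg
  have hreg2 : ∑ t ∈ Finset.range N, ⟪quadGrad (Q.A (s t).1) (Q.b (s t).2) (U t), U t - y⟫
      ≤ G * r * q := by
    have h1 : ‖x - y‖ ^ 2 ≤ r ^ 2 := by
      rw [norm_sub_rev]
      exact pow_le_pow_left₀ (norm_nonneg _) (hball y hy) 2
    have h2 : γ * (G * q) = r := by
      rw [hγ]
      field_simp
    have h3 : N * (γ ^ 2 * G ^ 2) ≤ r ^ 2 := by
      rw [← h2, mul_pow, mul_pow, hq2]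
      have : 0 ≤ γ ^ 2 * G ^ 2 := by positivity
      linarith
    have h4 : 2 * γ * ∑ t ∈ Finset.range N,
        ⟪quadGrad (Q.A (s t).1) (Q.b (s t).2) (U t), U t - y⟫ ≤ 2 * γ * (G * r * q) := by
      have e : 2 * γ * (G * r * q) = 2 * r * (γ * (G * q)) := by ring
      rw [e, h2]
      nlinarith [sq_nonneg ‖U N - y‖]
    exact le_of_mul_le_mul_left h4 (by positivity)
  have hsplit : ∑ t ∈ Finset.range N, (Q.risk (U t) - Q.risk y)
      ≤ ∑ t ∈ Finset.range N, ⟪quadGrad (Q.A (s t).1) (Q.b (s t).2) (U t), U t - y⟫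
        + ∑ t ∈ Finset.range N, Q.gradNoise (U t, y) (s t) := by
    rw [← Finset.sum_add_distrib]
    refine Finset.sum_le_sum fun t _ => (hconv t).trans (le_of_eq ?_)
    simp only [gradNoise]
    ring
  rw [Finset.sum_range_succ] at hjensen
  have hGr : 0 < G * r := mul_pos hG0 hr
  nlinarith

/-! Measurability and concentration of the gradient noise -/

theorem Standing.measurable_dotProduct (hQ : Q.Standing) :
    Measurable fun z : (EuclideanSpace ℝ (Fin d) × EuclideanSpace ℝ (Fin d)) × (Z × Z') =>
      z.1.1.ofLp ⬝ᵥ (Q.A z.2.1 *ᵥ z.1.2.ofLp) := by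
  simp only [dotProduct, Matrix.mulVec]
  have h1 : ∀ i, Measurable fun z : (EuclideanSpace ℝ (Fin d) × EuclideanSpace ℝ (Fin d)) ×
      (Z × Z') => z.1.1.ofLp i := fun i => by fun_prop
  have h2 : ∀ i, Measurable fun z : (EuclideanSpace ℝ (Fin d) × EuclideanSpace ℝ (Fin d)) ×
      (Z × Z') => z.1.2.ofLp i := fun i => by fun_prop
  refine Finset.measurable_fun_sum _ fun i _ => (h1 i).mul ?_
  refine Finset.measurable_fun_sum _ fun j _ => Measurable.mul ?_ (h2 j)
  exact (hQ.measurable_A i j).comp (measurable_fst.comp measurable_snd)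

theorem Standing.measurable_inner_grad (hQ : Q.Standing) :
    Measurable fun z : (EuclideanSpace ℝ (Fin d) × EuclideanSpace ℝ (Fin d)) × (Z × Z') =>
      ⟪quadGrad (Q.A z.2.1) (Q.b z.2.2) z.1.1, z.1.2⟫ := by
  simp only [inner_quadGrad]
  have hb : Measurable fun z : (EuclideanSpace ℝ (Fin d) × EuclideanSpace ℝ (Fin d)) ×
      (Z × Z') => ⟪z.1.2, Q.b z.2.2⟫ :=
    Measurable.inner (by fun_prop) (hQ.measurable_b.comp (measurable_snd.comp measurable_snd))
  have hswap : Measurable fun z : (EuclideanSpace ℝ (Fin d) × EuclideanSpace ℝ (Fin d)) ×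
      (Z × Z') => ((z.1.2, z.1.1), z.2) := by fun_prop
  exact ((hQ.measurable_dotProduct.comp hswap).add hQ.measurable_dotProduct).add hb

theorem Standing.measurable_quadGrad (hQ : Q.Standing) :
    Measurable fun z : EuclideanSpace ℝ (Fin d) × (Z × Z') =>
      quadGrad (Q.A z.2.1) (Q.b z.2.2) z.1 := by
  have hcoord : ∀ i : Fin d, Measurable fun z : EuclideanSpace ℝ (Fin d) × (Z × Z') =>
      (quadGrad (Q.A z.2.1) (Q.b z.2.2) z.1).ofLp i := by
    intro i
    have h1 : Measurable fun z : EuclideanSpace ℝ (Fin d) × (Z × Z') =>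
        ((z.1, EuclideanSpace.single i (1 : ℝ)), z.2) := by fun_prop
    have h2 := hQ.measurable_inner_grad.comp h1
    simpa [Function.comp_def, EuclideanSpace.inner_single_right] using h2
  exact (WithLp.measurable_toLp 2 _).comp (measurable_pi_lambda _ hcoord)

theorem Standing.measurable_gradNoise (hQ : Q.Standing) :
    Measurable (Function.uncurry Q.gradNoise) := by
  have h1 : Measurable fun z : (EuclideanSpace ℝ (Fin d) × EuclideanSpace ℝ (Fin d)) × (Z × Z') =>
      ((z.1.1, z.1.1 - z.1.2), z.2) := by fun_prop
  have h2 := hQ.measurable_inner_grad.comp h1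
  have h3 : Measurable fun z : (EuclideanSpace ℝ (Fin d) × EuclideanSpace ℝ (Fin d)) × (Z × Z') =>
      ⟪quadGrad Q.meanA Q.meanb z.1.1, z.1.1 - z.1.2⟫ := by
    unfold quadGrad
    fun_prop
  exact h3.sub h2

theorem Standing.integral_gradNoise (hQ : Q.Standing)
    (a : EuclideanSpace ℝ (Fin d) × EuclideanSpace ℝ (Fin d)) :
    ∫ p, Q.gradNoise a p ∂Q.μ = 0 := by
  have := hQ.isProbability
  simp only [gradNoise]
  rw [integral_sub (integrable_const _) (hQ.integrable_inner_grad _ _), hQ.integral_inner_grad]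
  simp

theorem Standing.abs_gradNoise_le (hQ : Q.Standing) {G r : ℝ} (hG0 : 0 ≤ G)
    (hG : Q.LossLipschitz G) {a : EuclideanSpace ℝ (Fin d) × EuclideanSpace ℝ (Fin d)}
    (h1 : a.1 ∈ Q.W) (h2 : a.2 ∈ Q.W) (h12 : ‖a.1 - a.2‖ ≤ 2 * r) :
    ∀ᵐ p ∂Q.μ, |Q.gradNoise a p| ≤ 4 * G * r := by
  have hdir : ∀ {A : Matrix (Fin d) (Fin d) ℝ} {b : EuclideanSpace ℝ (Fin d)} {c : ℝ},
      (∀ x ∈ Q.W, ∀ y ∈ Q.W, |quad A b c x - quad A b c y| ≤ G * ‖x - y‖) →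
      |⟪quadGrad A b a.1, a.1 - a.2⟫| ≤ G * (2 * r) := by
    intro A b c h
    rw [← neg_sub, inner_neg_right, abs_neg]
    refine (abs_inner_quadGrad_le_of_lipschitz hQ.convex_W h h1 h2).trans ?_
    rw [norm_sub_rev]
    gcongr
  filter_upwards [hG] with p hp
  have h3 := hdir hp
  have h4 := hdir (c := Q.c) (A := Q.meanA) (b := Q.meanb)
    fun x hx y hy => hQ.abs_risk_sub_le hG hx hy
  rw [gradNoise]
  refine (abs_sub _ _).trans ?_
  linarith

/-! The stages of ASA -/

/-- The reference point of a stage: the closest minimizer if it is feasible for the stage, and the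
starting point otherwise. -/
noncomputable def stageComparator (Q : QuadProblem d Z Z') (r : ℝ)
    (x : EuclideanSpace ℝ (Fin d)) : EuclideanSpace ℝ (Fin d) :=
  open Classical in
  if ‖x - proj (argminOn Q.risk Q.W) x‖ ≤ r then proj (argminOn Q.risk Q.W) x else x

theorem Standing.proj_argmin_isClosest (hQ : Q.Standing) (x : EuclideanSpace ℝ (Fin d)) :
    IsClosest (argminOn Q.risk Q.W) x (proj (argminOn Q.risk Q.W) x) :=
  proj_isClosest (isClosed_argminOn (continuous_quad _ _ _) hQ.isClosed_W) hQ.argmin_nonempty x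

theorem Standing.stageComparator_mem (hQ : Q.Standing) {r : ℝ} (hr : 0 ≤ r)
    {x : EuclideanSpace ℝ (Fin d)} (hx : x ∈ Q.W) :
    Q.stageComparator r x ∈ Q.W ∩ Metric.closedBall x r := by
  rw [stageComparator]
  split_ifs with h
  · refine ⟨(hQ.proj_argmin_isClosest x).1.1, ?_⟩
    rwa [Metric.mem_closedBall, dist_eq_norm, norm_sub_rev]
  · exact ⟨hx, Metric.mem_closedBall_self hr⟩

theorem Standing.measurable_stageComparator (hQ : Q.Standing) (r : ℝ) :
    Measurable (Q.stageComparator r) := by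
  have hcont : Continuous (proj (argminOn Q.risk Q.W)) :=
    continuous_proj (isClosed_argminOn (continuous_quad _ _ _) hQ.isClosed_W)
      (convex_argminOn_quad hQ.posSemidef hQ.convex_W) hQ.argmin_nonempty
  unfold stageComparator
  refine Measurable.ite ?_ hcont.measurable measurable_id
  exact (isClosed_le (by fun_prop) continuous_const).measurableSet

theorem Standing.asaStage_mem (hQ : Q.Standing) {G R₀ : ℝ} (hR₀ : 0 ≤ R₀) {n₀ : ℕ}
    {x₁ : EuclideanSpace ℝ (Fin d)} (hx₁ : x₁ ∈ Q.W) (s : ℕ → Z × Z') (k : ℕ) :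
    Q.asaStage G R₀ n₀ x₁ s k ∈ Q.W := by
  induction k with
  | zero => exact hx₁
  | succ k ih =>
    exact (ssg_mem (isClosed_inter_closedBall hQ.isClosed_W _)
      (hQ.convex_W.inter (convex_closedBall _ _))
      ⟨ih, Metric.mem_closedBall_self (by positivity)⟩ _ _).1

/-! ### The iterates are functions of past samples -/

section Measurability

variable {Ω : Type w} {ξ : ℕ → Ω → Z × Z'}

theorem Standing.measurable_ssgIter (hQ : Q.Standing) {r γ : ℝ} (hr : 0 < r)
    {x : Ω → EuclideanSpace ℝ (Fin d)} (hxW : ∀ ω, x ω ∈ Q.W) {s : ℕ}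
    (hx : Measurable[samplePast ξ s] x) (t : ℕ) :
    Measurable[samplePast ξ (s + t)] fun ω =>
      Q.ssgIter (Q.W ∩ Metric.closedBall (x ω) r) γ (x ω) (fun i => ξ (s + i) ω) t := by
  -- The continuity result has `proj Q.W` applied to the center, which is the identity here.
  have hproj : ∀ y ∈ Q.W, proj Q.W y = y := by
    intro y hy
    have := (proj_isClosest hQ.isClosed_W hQ.nonempty y).2 y hy
    rw [sub_self, norm_zero] at this
    exact (sub_eq_zero.1 (norm_le_zero_iff.1 this)).symm
  induction t with
  | zero => exact hx
  | succ t ih =>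
    have hcont := (continuous_proj_inter_closedBall hQ.isClosed_W hQ.convex_W hQ.nonempty
      hQ.bounded hr).measurable
    have hx' : Measurable[samplePast ξ (s + (t + 1))] x :=
      hx.mono (samplePast_mono ξ (by omega)) le_rfl
    have hu := ih.mono (samplePast_mono ξ (show s + t ≤ s + (t + 1) by omega)) le_rfl
    have hξ : Measurable[samplePast ξ (s + (t + 1))] (ξ (s + t)) :=
      measurable_samplePast ξ (by omega)
    have hg := hQ.measurable_quadGrad.comp (Measurable.prodMk hu hξ)
    have := hcont.comp (Measurable.prodMk hx' (Measurable.sub hu (Measurable.const_smul hg γ)))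
    convert this using 1
    funext ω
    simp only [Function.comp_apply, hproj _ (hxW ω), ssgIter, gradient_loss]
    rfl

theorem Standing.measurable_asaStage (hQ : Q.Standing) {G R₀ : ℝ} (hR₀ : 0 < R₀) {n₀ : ℕ}
    {x₁ : EuclideanSpace ℝ (Fin d)} (hx₁ : x₁ ∈ Q.W) (k : ℕ) :
    Measurable[samplePast ξ (k * n₀)] fun ω => Q.asaStage G R₀ n₀ x₁ (fun i => ξ i ω) k := by
  induction k with
  | zero => exact measurable_const
  | succ k ih =>
    have h1 : ∀ t ∈ Finset.range (n₀ + 1), Measurable[samplePast ξ ((k + 1) * n₀)] fun ω =>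
        Q.ssgIter (Q.W ∩ Metric.closedBall (Q.asaStage G R₀ n₀ x₁ (fun i => ξ i ω) k) (R₀ / 2 ^ k))
          (R₀ / 2 ^ k / (G * Real.sqrt ((n₀ : ℝ) + 1)))
          (Q.asaStage G R₀ n₀ x₁ (fun i => ξ i ω) k) (fun i => ξ (k * n₀ + i) ω) t := by
      intro t ht
      have ht' := Finset.mem_range.1 ht
      have h2 := hQ.measurable_ssgIter (γ := R₀ / 2 ^ k / (G * Real.sqrt ((n₀ : ℝ) + 1)))
        (r := R₀ / 2 ^ k) (by positivity)
        (fun ω => hQ.asaStage_mem hR₀.le hx₁ (fun i => ξ i ω) k) ih t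
      refine h2.mono (samplePast_mono ξ ?_) le_rfl
      rw [add_mul, one_mul]
      omega
    exact (Finset.measurable_fun_sum (m := samplePast ξ ((k + 1) * n₀)) _ h1).const_smul
      (1 / ((n₀ : ℝ) + 1))

end Measurability

end QuadProblem

/-! Analysis of ASA -/

/-- The recursion behind the convergence of stage-wise methods with halving radii `r k`: `e k` is
the error and `D k` the distance to the solution set after `k` stages. -/
theorem stage_error_le {e D r : ℕ → ℝ} {α b : ℝ} {m : ℕ} (hα : 0 < α) (hb : 0 ≤ b)
    (hr : ∀ k, 0 < r k) (hhalf : ∀ k, r k = 2 * r (k + 1)) (hD : ∀ k, D k ^ 2 ≤ α * e k)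
    (hD0 : D 0 ≤ r 0)
    (hstep : ∀ k < m, (D k ≤ r k ∧ e (k + 1) ≤ b * r k) ∨
      (r k < D k ∧ e (k + 1) ≤ e k + b * r k)) :
    ∀ k < m, e (k + 1) ≤ b * r k ∨ e (k + 1) ≤ 8 * α * b ^ 2 - b * r k := by
  intro k
  induction k with
  | zero =>
    intro hk
    rcases hstep 0 hk with h | h
    · exact Or.inl h.2
    · exact absurd h.1 (not_lt.2 hD0)
  | succ k ih =>
    intro hk
    rcases hstep (k + 1) hk with h | ⟨h1, h2⟩
    · exact Or.inl h.2
    -- The term `-b r k` is a reserve for later stages: since `r k = 2 r (k + 1)`, the loss `b r (k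
    -- + 1)` of the next stage leaves exactly the reserve required there.
    · right
      have hrk := hr (k + 1)
      have hh := hhalf k
      rcases ih (by omega) with h3 | h3
      -- The first stage with the minimizers out of reach: the error bound gives `r (k + 1) < 2 α
      -- b`, so the new error `3 b r (k + 1)` is below `8 α b²` even after the reserve is set aside.
      · have h4 : r (k + 1) * r (k + 1) < (2 * α * b) * r (k + 1) := by
          have h5 : r (k + 1) * r (k + 1) < D (k + 1) ^ 2 := by nlinarith
          have h6 : α * e (k + 1) ≤ α * (b * r k) := mul_le_mul_of_nonneg_left h3 hα.le
          have h7 := hD (k + 1)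
          rw [hh] at h6
          linarith
        have h8 := lt_of_mul_lt_mul_right h4 hrk.le
        have h9 := mul_le_mul_of_nonneg_left h8.le hb
        rw [hh] at h3
        linarith
      · rw [hh] at h3
        linarith

namespace QuadProblem

variable {d : ℕ} {Z : Type u} {Z' : Type v} [MeasurableSpace Z] [MeasurableSpace Z']
  {Q : QuadProblem d Z Z'}

/-- The sum of the gradient noise during the stage `k + 1` of ASA. -/
noncomputable def stageNoise (Q : QuadProblem d Z Z') (G R₀ : ℝ) (n₀ : ℕ)
    (x₁ : EuclideanSpace ℝ (Fin d)) (s : ℕ → Z × Z') (k : ℕ) : ℝ :=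
  ∑ t ∈ Finset.range n₀, Q.gradNoise
    (Q.ssgIter (Q.W ∩ Metric.closedBall (Q.asaStage G R₀ n₀ x₁ s k) (R₀ / 2 ^ k))
      (R₀ / 2 ^ k / (G * Real.sqrt ((n₀ : ℝ) + 1))) (Q.asaStage G R₀ n₀ x₁ s k)
      (fun i => s (k * n₀ + i)) t,
      Q.stageComparator (R₀ / 2 ^ k) (Q.asaStage G R₀ n₀ x₁ s k)) (s (k * n₀ + t))

/-- Azuma-Hoeffding with the pair of current iterate and comparator as state. Both lie in a ball of
radius `r`, which gives increments of size `4 G r`; the comparator is fixed by the starting point of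
the stage, hence by the past. -/
theorem Standing.measure_stageNoise_gt_le (hQ : Q.Standing) {G R₀ : ℝ} (hR₀ : 0 < R₀)
    (hG0 : 0 < G) (hG : Q.LossLipschitz G) {n₀ : ℕ} {x₁ : EuclideanSpace ℝ (Fin d)}
    (hx₁ : x₁ ∈ Q.W) {Ω : Type w} [MeasurableSpace Ω] {Pr : Measure Ω} {ξ : ℕ → Ω → Z × Z'}
    (hξ : IsIIDSample Pr Q.μ ξ) {ℓ : ℝ} (hℓ : 0 ≤ ℓ) (k : ℕ) :
    Pr {ω | 4 * G * (R₀ / 2 ^ k) * Real.sqrt (2 * ((n₀ + 1) * ℓ))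
      < Q.stageNoise G R₀ n₀ x₁ (fun i => ξ i ω) k} ≤ ENNReal.ofReal (Real.exp (-ℓ)) := by
  have hr : 0 < R₀ / 2 ^ k := by positivity
  set r := R₀ / 2 ^ k with hrdef
  have hX := hQ.measurable_asaStage (G := G) (n₀ := n₀) (ξ := ξ) hR₀ hx₁ k
  have hXW : ∀ ω, Q.asaStage G R₀ n₀ x₁ (fun i => ξ i ω) k ∈ Q.W := fun ω =>
    hQ.asaStage_mem hR₀.le hx₁ _ k
  refine hξ.measure_sum_gt_le hQ.measurable_gradNoise (c := 4 * G * r) (by positivity)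
    (T := {a | a.1 ∈ Q.W ∧ a.2 ∈ Q.W ∧ ‖a.1 - a.2‖ ≤ 2 * r})
    (fun a ha => hQ.abs_gradNoise_le hG0.le hG ha.1 ha.2.1 ha.2.2)
    (fun a _ => hQ.integral_gradNoise a) (k * n₀)
    (U := fun t ω => (Q.ssgIter (Q.W ∩ Metric.closedBall
      (Q.asaStage G R₀ n₀ x₁ (fun i => ξ i ω) k) r) (r / (G * Real.sqrt ((n₀ : ℝ) + 1)))
      (Q.asaStage G R₀ n₀ x₁ (fun i => ξ i ω) k) (fun i => ξ (k * n₀ + i) ω) t,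
      Q.stageComparator r (Q.asaStage G R₀ n₀ x₁ (fun i => ξ i ω) k))) ?_ ?_ n₀ hℓ
  · intro t
    have hX' := hX.mono (samplePast_mono ξ (show k * n₀ ≤ k * n₀ + t by omega)) le_rfl
    exact Measurable.prodMk (hQ.measurable_ssgIter hr hXW hX t)
      ((hQ.measurable_stageComparator r).comp hX')
  · intro t ω
    set x := Q.asaStage G R₀ n₀ x₁ (fun i => ξ i ω) k with hx
    have h1 := ssgIter_mem (Q := Q) (γ := r / (G * Real.sqrt ((n₀ : ℝ) + 1)))
      (isClosed_inter_closedBall hQ.isClosed_W x)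
      ⟨hXW ω, Metric.mem_closedBall_self hr.le⟩ (fun i => ξ (k * n₀ + i) ω) t
    have h2 := hQ.stageComparator_mem hr.le (hXW ω)
    refine ⟨h1.1, h2.1, ?_⟩
    have h3 := dist_triangle_right (Q.ssgIter (Q.W ∩ Metric.closedBall x r)
      (r / (G * Real.sqrt ((n₀ : ℝ) + 1))) x (fun i => ξ (k * n₀ + i) ω) t)
      (Q.stageComparator r x) x
    rw [dist_eq_norm] at h3
    linarith [Metric.mem_closedBall.1 h1.2, Metric.mem_closedBall.1 h2.2]

/-- One stage of ASA on the event that the gradient noise is small. -/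
theorem Standing.risk_asaStage_succ_le (hQ : Q.Standing) {G R₀ : ℝ} (hR₀ : 0 < R₀)
    (hG0 : 0 < G) (hG : Q.LossLipschitz G) {n₀ : ℕ} {x₁ : EuclideanSpace ℝ (Fin d)}
    (hx₁ : x₁ ∈ Q.W) {s : ℕ → Z × Z'}
    (hs : ∀ t, ∀ x ∈ Q.W, ∀ y ∈ Q.W, |Q.loss x (s t) - Q.loss y (s t)| ≤ G * ‖x - y‖) {ℓ : ℝ}
    (hℓ : 1 ≤ ℓ) (k : ℕ)
    (hnoise : Q.stageNoise G R₀ n₀ x₁ s k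
      ≤ 4 * G * (R₀ / 2 ^ k) * Real.sqrt (2 * ((n₀ + 1) * ℓ))) :
    Q.risk (Q.asaStage G R₀ n₀ x₁ s (k + 1))
      - Q.risk (Q.stageComparator (R₀ / 2 ^ k) (Q.asaStage G R₀ n₀ x₁ s k))
      ≤ G * (9 * Real.sqrt (ℓ / (n₀ + 1))) * (R₀ / 2 ^ k) := by
  have hr : 0 < R₀ / 2 ^ k := by positivity
  have hXW := hQ.asaStage_mem (G := G) (n₀ := n₀) hR₀.le hx₁ s k
  have h := hQ.risk_ssg_sub_le hr hG0 hG hXW (hQ.stageComparator_mem hr.le hXW)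
    (s := fun t => s (k * n₀ + t)) (fun t => hs _) n₀
  set r := R₀ / 2 ^ k with hrdef
  replace h := h.trans (add_le_add_right hnoise _)
  set q := Real.sqrt ((n₀ : ℝ) + 1) with hq
  have hq0 : 0 < q := Real.sqrt_pos.2 (by positivity)
  have hq2 : q ^ 2 = n₀ + 1 := Real.sq_sqrt (by positivity)
  -- With `√2 ≤ 3/2` the noise contributes `6` to the constant `9`; the deterministic `3` is
  -- absorbed using `√ℓ ≥ 1`.
  have h1 : Real.sqrt (2 * ((n₀ + 1) * ℓ)) ≤ 3 / 2 * (q * Real.sqrt ℓ) := by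
    refine Real.sqrt_le_iff.2 ⟨by positivity, ?_⟩
    rw [mul_pow, mul_pow, hq2, Real.sq_sqrt (by linarith)]
    have : 0 ≤ ((n₀ : ℝ) + 1) * ℓ := by positivity
    linarith
  have h2 : 1 ≤ Real.sqrt ℓ := Real.one_le_sqrt.2 hℓ
  have h3 : Real.sqrt (ℓ / (n₀ + 1)) = Real.sqrt ℓ / q := by
    rw [Real.sqrt_div (by linarith)]
  have h4 : ((n₀ : ℝ) + 1) * (G * (9 * Real.sqrt (ℓ / (n₀ + 1))) * r)
      = 9 * (G * r * q) * Real.sqrt ℓ := by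
    rw [h3, ← hq2]
    field_simp
  have h5 : 0 < G * r * q := by positivity
  refine le_of_mul_le_mul_left (h.trans ?_) (show (0 : ℝ) < n₀ + 1 by positivity)
  rw [h4]
  have h6 : 4 * G * r * Real.sqrt (2 * ((n₀ + 1) * ℓ))
      ≤ 4 * G * r * (3 / 2 * (q * Real.sqrt ℓ)) := by
    gcongr
  nlinarith

/-- The excess risk of ASA on the event that the gradient noise is small in all stages. -/
theorem Standing.risk_asaStage_le (hQ : Q.Standing) {α G R₀ : ℝ} (hE : EBC Q.W Q.risk 1 α)
    (hR₀ : 0 < R₀) (hG0 : 0 < G) (hG : Q.LossLipschitz G) {n₀ m : ℕ}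
    {x₁ xs : EuclideanSpace ℝ (Fin d)} (hx₁ : x₁ ∈ Q.W)
    (hxs : IsClosest (argminOn Q.risk Q.W) x₁ xs) (hdist : ‖x₁ - xs‖ ≤ R₀) {s : ℕ → Z × Z'}
    (hs : ∀ t, ∀ x ∈ Q.W, ∀ y ∈ Q.W, |Q.loss x (s t) - Q.loss y (s t)| ≤ G * ‖x - y‖) {ℓ : ℝ}
    (hℓ : 1 ≤ ℓ)
    (hnoise : ∀ k < m, Q.stageNoise G R₀ n₀ x₁ s k
      ≤ 4 * G * (R₀ / 2 ^ k) * Real.sqrt (2 * ((n₀ + 1) * ℓ))) :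
    ∀ k < m, Q.risk (Q.asaStage G R₀ n₀ x₁ s (k + 1)) - Q.optRisk
        ≤ G * (9 * Real.sqrt (ℓ / (n₀ + 1))) * (R₀ / 2 ^ k) ∨
      Q.risk (Q.asaStage G R₀ n₀ x₁ s (k + 1)) - Q.optRisk
        ≤ 8 * α * (G * (9 * Real.sqrt (ℓ / (n₀ + 1)))) ^ 2 := by
  set b := G * (9 * Real.sqrt (ℓ / (n₀ + 1))) with hb
  have hb0 : 0 ≤ b := by positivity
  set x := Q.asaStage G R₀ n₀ x₁ s with hx
  have hxW : ∀ k, x k ∈ Q.W := hQ.asaStage_mem hR₀.le hx₁ s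
  set π := proj (argminOn Q.risk Q.W) with hπ
  have hclosest : ∀ k, IsClosest (argminOn Q.risk Q.W) (x k) (π (x k)) := fun k =>
    hQ.proj_argmin_isClosest _
  have hrec := stage_error_le (e := fun k => Q.risk (x k) - Q.optRisk)
    (D := fun k => ‖x k - π (x k)‖) (r := fun k => R₀ / 2 ^ k) (α := α) (b := b) (m := m)
    hE.2.2.1 hb0 (fun k => by positivity) (fun k => by rw [pow_succ]; field_simp)
    (fun k => by
      obtain ⟨y, hy, h⟩ := exists_comparator hE (hxW k)
      exact (pow_le_pow_left₀ (norm_nonneg _) ((hclosest k).2 y hy) 2).trans h)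
    (by simpa using ((hclosest 0).2 xs hxs.1).trans hdist)
    (fun k hk => by
      have h := hQ.risk_asaStage_succ_le hR₀ hG0 hG hx₁ hs hℓ k (hnoise k hk)
      rw [stageComparator] at h
      split_ifs at h with hc
      · left
        have h1 := optRisk_eq (hclosest k).1
        exact ⟨hc, by rw [h1]; exact h⟩
      -- The comparator is now the starting point, so the stage increases the risk by at most `b r`.
      · right
        exact ⟨not_le.1 hc, by linarith⟩)
  intro k hk
  rcases hrec k hk with h | h
  · exact Or.inl h
  · right
    have : 0 ≤ b * (R₀ / 2 ^ k) := by positivity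
    linarith

/-- The degenerate case `R₀ = 0`, where the Azuma bound, stated for positive radii, does not apply:
each feasible set is one point. -/
theorem asaStage_eq_of_radius_zero (hQ : Q.Standing) {G : ℝ} {n₀ : ℕ}
    {x₁ : EuclideanSpace ℝ (Fin d)} (hx₁ : x₁ ∈ Q.W) (s : ℕ → Z × Z') (k : ℕ) :
    Q.asaStage G 0 n₀ x₁ s k = x₁ := by
  induction k with
  | zero => rfl
  | succ k ih =>
    have h := ssg_mem (Q := Q) (γ := 0 / 2 ^ k / (G * Real.sqrt ((n₀ : ℝ) + 1)))
      (isClosed_inter_closedBall hQ.isClosed_W (r := 0 / 2 ^ k) (Q.asaStage G 0 n₀ x₁ s k))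
      (hQ.convex_W.inter (convex_closedBall _ _))
      (x := Q.asaStage G 0 n₀ x₁ s k)
      ⟨hQ.asaStage_mem le_rfl hx₁ s k, Metric.mem_closedBall_self (by simp)⟩
      (fun t => s (k * n₀ + t)) n₀
    have h1 : Q.asaStage G 0 n₀ x₁ s (k + 1)
        ∈ Metric.closedBall (Q.asaStage G 0 n₀ x₁ s k) (0 / 2 ^ k) := h.2
    rwa [zero_div, Metric.closedBall_zero, Set.mem_singleton_iff, ih] at h1

end QuadProblem

/-! The number of stages -/

/-- The choice of `m` serves two aims: `m ≤ log n` controls both the union bound and the stage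
length, while the last radius is of order `√(log n / n)`, so that it matches the statistical error
of one stage. -/
theorem asaNumStages_bounds {n : ℕ} (hn : 100 ≤ n) :
    3 ≤ Real.log n ∧ 1 ≤ asaNumStages n ∧ (asaNumStages n : ℝ) ≤ Real.log n ∧
      1 / (2 : ℝ) ^ (asaNumStages n - 1) ≤ 8 * Real.sqrt (Real.log n / n) := by
  have hn100 : (100 : ℝ) ≤ n := by exact_mod_cast hn
  have hn0 : (0 : ℝ) < n := by linarith
  have hl2 : 0.69 ≤ Real.log 2 := by have := Real.log_two_gt_d9; linarith
  have hl2' : Real.log 2 ≤ 0.7 := by have := Real.log_two_lt_d9; linarith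
  have he3 : Real.exp 3 = Real.exp 1 ^ 3 := by rw [← Real.exp_nat_mul]; norm_num
  have he1 := Real.exp_one_gt_d9
  have he1' := Real.exp_one_lt_d9
  have he3l : 20 ≤ Real.exp 3 := by
    rw [he3]
    calc (20 : ℝ) ≤ 2.718 ^ 3 := by norm_num
      _ ≤ _ := by gcongr; linarith
  have he3u : Real.exp 3 ≤ 100 := by
    rw [he3]
    calc Real.exp 1 ^ 3 ≤ 2.72 ^ 3 := by gcongr; linarith
      _ ≤ _ := by norm_num
  have hlog3 : 3 ≤ Real.log n := by
    rw [Real.le_log_iff_exp_le hn0]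
    linarith
  -- A tangent-type bound at `e³`, sharp enough at `n = 100` to give `q ≥ 16` and hence at least one
  -- stage.
  have hlogu : Real.log n ≤ 2 + n / 20 := by
    have h1 : Real.log n = 3 + Real.log (n / Real.exp 3) := by
      rw [Real.log_div hn0.ne' (Real.exp_pos _).ne', Real.log_exp]
      ring
    have h2 := Real.log_le_sub_one_of_pos (div_pos hn0 (Real.exp_pos 3))
    have h3 : (n : ℝ) / Real.exp 3 ≤ n / 20 := by gcongr
    linarith
  set q : ℝ := 2 * n / Real.logb 2 n with hq
  have hqeq : q = 2 * n * Real.log 2 / Real.log n := by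
    rw [hq, Real.logb]
    field_simp
  have hq16 : 16 ≤ q := by
    rw [hqeq, le_div_iff₀ (by linarith)]
    nlinarith
  have hqn : q ≤ n := by
    rw [hqeq, div_le_iff₀ (by linarith)]
    nlinarith
  have hqlow : (n : ℝ) / Real.log n ≤ q := by
    rw [hqeq]
    gcongr
    nlinarith
  set x : ℝ := 1 / 2 * Real.logb 2 q with hx
  have hx2 : 2 ≤ x := by
    have h1 : (4 : ℝ) ≤ Real.logb 2 q := by
      rw [Real.le_logb_iff_rpow_le one_lt_two (by linarith)]
      norm_num
      exact hq16
    rw [hx]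
    linarith
  have hxlog : x ≤ Real.log n := by
    have h1 : Real.log q ≤ Real.log n := Real.log_le_log (by linarith) hqn
    have h2 : Real.logb 2 q ≤ 2 * Real.log n := by
      rw [Real.logb, div_le_iff₀ (by linarith)]
      nlinarith
    rw [hx]
    linarith
  have hfl2 : 2 ≤ ⌊x⌋₊ := Nat.le_floor (by exact_mod_cast hx2)
  have hm : asaNumStages n = ⌊x⌋₊ - 1 := rfl
  refine ⟨hlog3, by omega, ?_, ?_⟩
  · have h1 : ((⌊x⌋₊ - 1 : ℕ) : ℝ) ≤ ⌊x⌋₊ := by exact_mod_cast Nat.sub_le _ _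
    rw [hm]
    exact h1.trans ((Nat.floor_le (by linarith)).trans hxlog)
  -- Rounding costs less than `1`, the definition of `m` subtracts `1` and the last radius has
  -- exponent `m - 1`; since `2 ^ x = √q`, this is the factor `8`.
  · have h1 : x - 3 ≤ ((asaNumStages n - 1 : ℕ) : ℝ) := by
      have h2 := Nat.lt_floor_add_one x
      have h3 : ⌊x⌋₊ = (asaNumStages n - 1) + 2 := by omega
      rw [h3] at h2
      push_cast at h2
      linarith
    have h4 : Real.sqrt q / 8 ≤ (2 : ℝ) ^ (asaNumStages n - 1) := by
      rw [← Real.rpow_natCast]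
      calc Real.sqrt q / 8 = (2 : ℝ) ^ (x - 3) := by
            rw [Real.rpow_sub two_pos, hx, mul_comm, Real.rpow_mul two_pos.le,
              Real.rpow_logb two_pos (by norm_num) (by linarith), ← Real.sqrt_eq_rpow]
            norm_num
        _ ≤ _ := Real.rpow_le_rpow_of_exponent_le one_le_two h1
    have h5 : Real.sqrt (n / Real.log n) ≤ Real.sqrt q := Real.sqrt_le_sqrt hqlow
    have h6 : 0 < Real.sqrt (n / Real.log n) := Real.sqrt_pos.2 (by positivity)
    calc 1 / (2 : ℝ) ^ (asaNumStages n - 1) ≤ 1 / (Real.sqrt (n / Real.log n) / 8) := by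
          apply one_div_le_one_div_of_le (by positivity)
          linarith
      _ = 8 * (Real.sqrt (n / Real.log n))⁻¹ := by field_simp
      _ = _ := by rw [← Real.sqrt_inv, inv_div]

/-! ### High-probability bound for ASA and assembly of the claims -/

namespace QuadProblem

variable {d : ℕ} {Z : Type u} {Z' : Type v} [MeasurableSpace Z] [MeasurableSpace Z']
  {Q : QuadProblem d Z Z'}

/-- Each stage may fail with probability `δ / log n`, which explains the double logarithm. The
constant is `8 · 9²` from the saturated regime; the regime of shrinking radii needs only `9 · 8`. -/
theorem Standing.asa_highProb (hQ : Q.Standing) {α G R₀ : ℝ} (hE : EBC Q.W Q.risk 1 α)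
    (hG0 : 0 < G) (hG : Q.LossLipschitz G)
    {x₁ xs : EuclideanSpace ℝ (Fin d)} (hx₁ : x₁ ∈ Q.W)
    (hxs : IsClosest (argminOn Q.risk Q.W) x₁ xs) (hdist : ‖x₁ - xs‖ ≤ R₀)
    {Ω : Type w} [MeasurableSpace Ω] {Pr : Measure Ω} {ξ : ℕ → Ω → Z × Z'}
    (hξ : IsIIDSample Pr Q.μ ξ) {n : ℕ} (hn : 100 ≤ n) {δ : ℝ} (hδ : 0 < δ) (hδ1 : δ < 1) :
    WithHighProb Pr δ fun ω =>
      Q.risk (Q.asa G x₁ n R₀ fun i => ξ i ω) - Q.optRisk ≤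
        648 * (max (α * G ^ 2) (R₀ * G) *
          (Real.log n * Real.log (Real.log n / δ)) / n) := by
  have hα := hE.2.2.1
  obtain ⟨hlog3, hm1, hmlog, hpow⟩ := asaNumStages_bounds hn
  have hn0 : (0 : ℝ) < n := by
    have : (100 : ℝ) ≤ n := by exact_mod_cast hn
    linarith
  have hlog0 : 0 < Real.log n := by linarith
  set m := asaNumStages n with hm
  set ℓ := Real.log (Real.log n / δ) with hℓdef
  have hℓ1 : 1 ≤ ℓ := by
    rw [hℓdef, Real.le_log_iff_exp_le (by positivity), le_div_iff₀ hδ]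
    have := Real.exp_one_lt_d9
    nlinarith [Real.exp_pos 1]
  have hM0 : 0 ≤ max (α * G ^ 2) (R₀ * G) := le_max_of_le_left (by positivity)
  have hrate0 : 0 ≤ 648 * (max (α * G ^ 2) (R₀ * G) * (Real.log n * ℓ) / n) := by positivity
  rcases (norm_nonneg _ |>.trans hdist).eq_or_lt with hR | hR₀
  · have hx₁s : x₁ = xs := by
      rw [← hR] at hdist
      exact sub_eq_zero.1 (norm_le_zero_iff.1 hdist)
    have hall : ∀ ω, Q.risk (Q.asa G x₁ n R₀ fun i => ξ i ω) - Q.optRisk ≤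
        648 * (max (α * G ^ 2) (R₀ * G) * (Real.log n * ℓ) / n) := by
      intro ω
      have hasa : (Q.asa G x₁ n R₀ fun i => ξ i ω) = x₁ := by
        rw [asa, ← hR]
        exact asaStage_eq_of_radius_zero hQ hx₁ _ _
      rw [hasa, optRisk_eq hxs.1, ← hx₁s, sub_self]
      exact hrate0
    rw [WithHighProb, Set.eq_empty_of_forall_notMem
      (s := {ω | ¬ (Q.risk (Q.asa G x₁ n R₀ fun i => ξ i ω) - Q.optRisk ≤
        648 * (max (α * G ^ 2) (R₀ * G) * (Real.log n * ℓ) / n))}) fun ω hω => hω (hall ω),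
      measure_empty]
    exact zero_le
  set n₀ := n / m with hn₀
  set bad : ℕ → Set Ω := fun k => {ω | 4 * G * (R₀ / 2 ^ k) * Real.sqrt (2 * ((n₀ + 1) * ℓ))
      < Q.stageNoise G R₀ n₀ x₁ (fun i => ξ i ω) k} with hbad
  have hbad_le : ∀ k ∈ Finset.range m, Pr (bad k) ≤ ENNReal.ofReal (δ / Real.log n) := by
    intro k _
    refine (hQ.measure_stageNoise_gt_le hR₀ hG0 hG hx₁ hξ (by linarith) k).trans (le_of_eq ?_)
    rw [hℓdef, Real.exp_neg, Real.exp_log (by positivity), inv_div]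
  have hae := hξ.ae_forall hG
  have hsub : {ω | ¬ (Q.risk (Q.asa G x₁ n R₀ fun i => ξ i ω) - Q.optRisk ≤
        648 * (max (α * G ^ 2) (R₀ * G) * (Real.log n * ℓ) / n))}
      ⊆ {ω | ¬ ∀ i, ∀ x ∈ Q.W, ∀ y ∈ Q.W, |Q.loss x (ξ i ω) - Q.loss y (ξ i ω)| ≤ G * ‖x - y‖}
        ∪ ⋃ k ∈ Finset.range m, bad k := by
    intro ω hω
    by_contra hcon
    rw [Set.mem_union, not_or] at hcon
    obtain ⟨hlip, hnb⟩ := hcon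
    replace hlip := not_not.1 hlip
    simp only [Set.mem_iUnion, not_exists] at hnb
    refine hω ?_
    have hmain := hQ.risk_asaStage_le hE hR₀ hG0 hG (n₀ := n₀) (m := m) hx₁ hxs hdist hlip hℓ1
      (fun k hk => not_lt.1 (hnb k (Finset.mem_range.2 hk))) (m - 1) (by omega)
    rw [Nat.sub_add_cancel hm1] at hmain
    -- The floor in `n₀` is absorbed by `n < m (n₀ + 1)`.
    have hdiv : ℓ / (n₀ + 1) ≤ ℓ * Real.log n / n := by
      have h1 : (n : ℝ) ≤ Real.log n * (n₀ + 1) := by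
        have h2 : n < m * (n₀ + 1) := by
          have := Nat.lt_div_mul_add (a := n) hm1
          rw [mul_comm] at this
          rw [mul_add, mul_one]
          exact this
        have h3 : (n : ℝ) ≤ m * (n₀ + 1) := by exact_mod_cast h2.le
        exact h3.trans (by gcongr)
      rw [div_le_div_iff₀ (by positivity) hn0]
      nlinarith
    have hsq : Real.sqrt (ℓ / (n₀ + 1)) ≤ Real.sqrt (ℓ * Real.log n / n) := Real.sqrt_le_sqrt hdiv
    have hY : 0 ≤ Real.log n * ℓ / n := by positivity
    have hgoal : 648 * (max (α * G ^ 2) (R₀ * G) * (Real.log n * ℓ) / n)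
        = 648 * (max (α * G ^ 2) (R₀ * G) * (Real.log n * ℓ / n)) := by ring
    have hasa : (Q.asa G x₁ n R₀ fun i => ξ i ω) = Q.asaStage G R₀ n₀ x₁ (fun i => ξ i ω) m := rfl
    rw [hgoal, hasa]
    rcases hmain with h | h
    · refine h.trans ?_
      -- The radius carries no factor `√ℓ`, so `ℓ ≥ 1` is used to pass from `√ℓ` to `ℓ`.
      have h1 : Real.sqrt (ℓ * Real.log n / n) * Real.sqrt (Real.log n / n)
          ≤ Real.log n * ℓ / n := by
        rw [← Real.sqrt_mul (by positivity)]
        refine Real.sqrt_le_iff.2 ⟨hY, ?_⟩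
        have e : ℓ * Real.log n / n * (Real.log n / n) = ℓ * (Real.log n / n) ^ 2 := by ring
        have e2 : (Real.log n * ℓ / n) ^ 2 = ℓ ^ 2 * (Real.log n / n) ^ 2 := by ring
        rw [e, e2]
        gcongr
        nlinarith
      calc G * (9 * Real.sqrt (ℓ / (n₀ + 1))) * (R₀ / 2 ^ (m - 1))
          = 9 * (R₀ * G) * (Real.sqrt (ℓ / (n₀ + 1)) * (1 / 2 ^ (m - 1))) := by ring
        _ ≤ 9 * (R₀ * G) * (Real.sqrt (ℓ * Real.log n / n) * (8 * Real.sqrt (Real.log n / n))) := by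
          gcongr
        _ = 72 * (R₀ * G) * (Real.sqrt (ℓ * Real.log n / n) * Real.sqrt (Real.log n / n)) := by
          ring
        _ ≤ 72 * (R₀ * G) * (Real.log n * ℓ / n) := by gcongr
        _ ≤ 72 * max (α * G ^ 2) (R₀ * G) * (Real.log n * ℓ / n) := by
          gcongr
          exact le_max_right _ _
        _ ≤ _ := by nlinarith [mul_nonneg hM0 hY]
    · refine h.trans ?_
      have h1 : Real.sqrt (ℓ / (n₀ + 1)) ^ 2 ≤ Real.log n * ℓ / n := by
        rw [Real.sq_sqrt (by positivity)]
        exact hdiv.trans (le_of_eq (by ring))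
      calc 8 * α * (G * (9 * Real.sqrt (ℓ / (n₀ + 1)))) ^ 2
          = 648 * (α * G ^ 2) * Real.sqrt (ℓ / (n₀ + 1)) ^ 2 := by ring
        _ ≤ 648 * (max (α * G ^ 2) (R₀ * G)) * (Real.log n * ℓ / n) := by
          gcongr
          exact le_max_left _ _
        _ = _ := by ring
  refine (measure_mono hsub).trans ((measure_union_le _ _).trans ?_)
  have h0 : Pr {ω | ¬ ∀ i, ∀ x ∈ Q.W, ∀ y ∈ Q.W,
      |Q.loss x (ξ i ω) - Q.loss y (ξ i ω)| ≤ G * ‖x - y‖} = 0 := hae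
  rw [h0, zero_add]
  refine (measure_biUnion_finset_le _ _).trans ((Finset.sum_le_sum hbad_le).trans ?_)
  rw [Finset.sum_const, nsmul_eq_mul, Finset.card_range, ← ENNReal.ofReal_natCast,
    ← ENNReal.ofReal_mul (by positivity)]
  refine ENNReal.ofReal_le_ofReal ?_
  rw [mul_div_assoc', div_le_iff₀ hlog0]
  nlinarith

theorem deviation_nonneg (d : ℕ) {n : ℕ} {δ : ℝ} (hδ : 0 < δ) (hδ1 : δ < 1) :
    0 ≤ d * Real.log n + Real.log (1 / δ) := by
  have h1 : 0 ≤ Real.log (1 / δ) := Real.log_nonneg (by rw [le_div_iff₀ hδ]; linarith)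
  have h2 : 0 ≤ Real.log n := Real.log_natCast_nonneg n
  positivity

theorem BoundedBy.lipschitzConst_nonneg {σ R : ℝ} (hQ : Q.Standing) (hσ : Q.BoundedBy σ)
    (hR : ∀ x ∈ Q.W, ‖x‖ ≤ R) : 0 ≤ 2 * σ * R + σ := by
  obtain ⟨x, hx⟩ := hQ.nonempty
  have h1 : 0 ≤ R := (norm_nonneg _).trans (hR x hx)
  have h2 := hσ.nonneg hQ
  positivity

/-- The fast rate when losses are nonnegative on the feasible set only; the constant depends on
the optimal risk. -/
theorem Standing.exists_ermRate_of_nonneg_on (hQ : Q.Standing) {σ : ℝ} (hσ : Q.BoundedBy σ)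
    (hpos : ∀ᵐ p ∂Q.μ, ∀ x ∈ Q.W, 0 ≤ Q.loss x p) :
    ∃ C : ℝ, 0 < C ∧ ERMRate.{u, v, w} Q (fun n => 2 ≤ n)
      (fun n δ => C * (((d * Real.log n + Real.log (1 / δ)) / n) ^ 2
        + (d * Real.log n + Real.log (1 / δ)) * Q.optRisk / n)) := by
  obtain ⟨α, hE⟩ := hQ.exists_EBC
  obtain ⟨R, hR⟩ := hQ.bounded.exists_norm_le
  have hG := hσ.lossLipschitz hR
  have hG0 := hσ.lipschitzConst_nonneg hQ hR
  -- For `P_* > 0` the rate `η` is a multiple of `η P_*`, with a constant depending on the problem;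
  -- for `P_* = 0` the losses vanish at a minimizer.
  rcases (hQ.optRisk_nonneg hpos).eq_or_lt with hP | hP
  · refine ⟨max 1 (256 * (2 * σ * R + σ) ^ 2 * α * netFactor R ^ 2 + 12 * (2 * σ * R + σ)
      + 8 * (2 * σ * R + σ) * R), lt_max_of_lt_left one_pos, ?_⟩
    refine (hQ.ermRate_of_optRisk_eq_zero hE hG0 hG hR hpos hP.symm).mono (fun n h => h)
      fun n δ _ _ _ => ?_
    rw [← hP, mul_zero, zero_div, add_zero]
    gcongr
    exact le_max_right _ _
  · refine ⟨max 1 (ermConst α (2 * σ * R + σ) R / Q.optRisk), lt_max_of_lt_left one_pos, ?_⟩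
    refine (hQ.ermRate_of_lipschitz hE hG0 hG hR).mono (fun n h => h) fun n δ _ hδ hδ1 => ?_
    have hD := deviation_nonneg d (n := n) hδ hδ1
    calc ermConst α (2 * σ * R + σ) R * ((d * Real.log n + Real.log (1 / δ)) / n)
        = ermConst α (2 * σ * R + σ) R / Q.optRisk
          * ((d * Real.log n + Real.log (1 / δ)) * Q.optRisk / n) := by field_simp
      _ ≤ max 1 (ermConst α (2 * σ * R + σ) R / Q.optRisk)
          * ((d * Real.log n + Real.log (1 / δ)) * Q.optRisk / n) := by
        gcongr
        exact le_max_right _ _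
      _ ≤ _ := by
        gcongr
        exact le_add_of_nonneg_left (by positivity)

end QuadProblem

theorem corollary1 :
    -- (i) the error bound condition with exponent 1
    (∀ (d : ℕ) (Z : Type u) (Z' : Type v) [MeasurableSpace Z] [MeasurableSpace Z']
        (Q : QuadProblem d Z Z'), Q.Standing → ∃ α : ℝ, EBC Q.W Q.risk 1 α) ∧
    -- (ii) ERM, bounded data
    (∀ α σ R : ℝ, ∃ C : ℝ, 0 < C ∧
      ∀ (d : ℕ) (Z : Type u) (Z' : Type v) [MeasurableSpace Z] [MeasurableSpace Z']
        (Q : QuadProblem d Z Z'), Q.Standing → EBC Q.W Q.risk 1 α →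
        (∀ x ∈ Q.W, ‖x‖ ≤ R) → Q.BoundedBy σ →
        QuadProblem.ERMRate.{u, v, w} Q (fun n => 2 ≤ n)
          (fun n δ => C * ((d * Real.log n + Real.log (1 / δ)) / n))) ∧
    -- (iii) ERM, bounded data and non-negative, convex, smooth losses
    (∀ α σ R L : ℝ, ∃ C N : ℝ, 0 < C ∧ 0 < N ∧
      ∀ (d : ℕ) (Z : Type u) (Z' : Type v) [MeasurableSpace Z] [MeasurableSpace Z']
        (Q : QuadProblem d Z Z'), Q.Standing → EBC Q.W Q.risk 1 α →
        (∀ x ∈ Q.W, ‖x‖ ≤ R) → Q.BoundedBy σ →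
        (∀ᵐ p ∂Q.μ, ∀ x, 0 ≤ Q.loss x p) → Q.LossConvexSmooth L →
        QuadProblem.ERMRate.{u, v, w} Q (fun n => 2 ≤ n ∧ N * (d * Real.log n) ≤ n)
          (fun n δ => C * (((d * Real.log n + Real.log (1 / δ)) / n) ^ 2
            + (d * Real.log n + Real.log (1 / δ)) * Q.optRisk / n))) ∧
    -- (iii') the same rate for each single problem when non-negativity is known only on `W`
    (∀ (d : ℕ) (Z : Type u) (Z' : Type v) [MeasurableSpace Z] [MeasurableSpace Z']
        (Q : QuadProblem d Z Z') (σ L : ℝ), Q.Standing → Q.BoundedBy σ →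
        (∀ᵐ p ∂Q.μ, ∀ x ∈ Q.W, 0 ≤ Q.loss x p) → Q.LossConvexSmooth L →
        ∃ C N : ℝ, 0 < C ∧ 0 < N ∧
          QuadProblem.ERMRate.{u, v, w} Q (fun n => 2 ≤ n ∧ N * (d * Real.log n) ≤ n)
            (fun n δ => C * (((d * Real.log n + Real.log (1 / δ)) / n) ^ 2
              + (d * Real.log n + Real.log (1 / δ)) * Q.optRisk / n))) ∧
    -- (iv) ASA, bounded data, with an absolute constant
    (∃ C : ℝ, 0 < C ∧
      ∀ (d : ℕ) (Z : Type u) (Z' : Type v) [MeasurableSpace Z] [MeasurableSpace Z']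
        (Q : QuadProblem d Z Z') (α σ G R₀ : ℝ) (x₁ xs : EuclideanSpace ℝ (Fin d)),
        Q.Standing → EBC Q.W Q.risk 1 α → Q.BoundedBy σ →
        0 < G → Q.LossLipschitz G →
        x₁ ∈ Q.W → IsClosest (argminOn Q.risk Q.W) x₁ xs → ‖x₁ - xs‖ ≤ R₀ →
        ∀ (Ω : Type w) [MeasurableSpace Ω] (Pr : Measure Ω) [IsProbabilityMeasure Pr]
          (ξ : ℕ → Ω → Z × Z'), IsIIDSample Pr Q.μ ξ →
          ∀ n : ℕ, 100 ≤ n → ∀ δ : ℝ, 0 < δ → δ < 1 →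
            WithHighProb Pr δ fun ω =>
              Q.risk (Q.asa G x₁ n R₀ fun i => ξ i ω) - Q.optRisk ≤
                C * (max (α * G ^ 2) (R₀ * G) *
                  (Real.log n * Real.log (Real.log n / δ)) / n)) := by
  refine ⟨fun d Z Z' _ _ Q hQ => hQ.exists_EBC, fun α σ R => ?_, fun α σ R L => ?_,
    fun d Z Z' _ _ Q σ L hQ hσ hpos _ => ?_, ?_⟩
  · refine ⟨max 1 (QuadProblem.ermConst α (2 * σ * R + σ) R), lt_max_of_lt_left one_pos,
      fun d Z Z' _ _ Q hQ hE hR hσ => ?_⟩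
    refine (hQ.ermRate_of_lipschitz hE (hσ.lipschitzConst_nonneg hQ hR)
      (hσ.lossLipschitz hR) hR).mono (fun n h => h) fun n δ _ hδ hδ1 => ?_
    have hD := QuadProblem.deviation_nonneg d (n := n) hδ hδ1
    gcongr
    exact le_max_right _ _
  -- `N = 1` suffices because large deviations are absorbed into `C`; the maximum with `1` makes `C`
  -- positive for all real parameters.
  · refine ⟨max 1 (QuadProblem.fastConst α σ (2 * σ * R + σ) R), 1, lt_max_of_lt_left one_pos,
      one_pos, fun d Z Z' _ _ Q hQ hE hR hσ hpos _ => ?_⟩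
    refine (hQ.ermRate_of_nonneg hE hσ (hσ.lipschitzConst_nonneg hQ hR)
      (hσ.lossLipschitz hR) hR hpos).mono (fun n h => h.1) fun n δ _ hδ hδ1 => ?_
    have hD := QuadProblem.deviation_nonneg d (n := n) hδ hδ1
    have hP := hQ.optRisk_nonneg (by filter_upwards [hpos] with p hp using fun x _ => hp x)
    gcongr
    exact le_max_right _ _
  · obtain ⟨C, hC, h⟩ := hQ.exists_ermRate_of_nonneg_on hσ hpos
    exact ⟨C, 1, hC, one_pos, h.mono (fun n h => h.1) fun n δ _ _ _ => le_rfl⟩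
  · refine ⟨648, by norm_num, fun d Z Z' _ _ Q α σ G R₀ x₁ xs hQ hE _ hG0 hG hx₁ hxs hdist
      Ω _ Pr _ ξ hξ n hn δ hδ hδ1 => ?_⟩
    exact hQ.asa_highProb hE hG0 hG hx₁ hxs hdist hξ hn hδ hδ1
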